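/- Let $0<\alpha<1$, let $\Omega\subset\mathbb C$ be a bounded simply connected domain of class $C^{1,\alpha}$ (near each boundary point, in suitable Cartesian coordinates, $\Omega$ is the region above the graph of a $C^{1,\alpha}$ function), and let $\zeta_c\in\Omega$, $\zeta_b\in\partial\Omega$. Let $L=|\partial\Omega|$ be the perimeter and let $\gamma:\mathbb R\to\partial\Omega$ be the $L$-periodic counterclockwise arclength parametrization of $\partial\Omega$ with $\gamma(0)=\zeta_b$, so that $i\gamma'(s)$ is the interior unit normal at $\gamma(s)$. Let $U$ be the Green's function of $\Omega$ with pole $\zeta_c$, that is, the solution of $-\Delta U=\delta_{\zeta_c}$ in $\Omega$, $U=0$ on $\partial\Omega$ (so $U(z)+\frac1{2\pi}\log|z-\zeta_c|$ is harmonic in $\Omega$ and $U$ is continuous on $\overline\Omega\setminus\{\zeta_c\}$). Let $\varphi(s)$ be its interior normal derivative at $\gamma(s)$, i.e. the limit of $\nabla U(z)\cdot i\gamma'(s)$ as $z\to\gamma(s)$, $z\in\Omega$, and put $\Phi(s)=2\pi\int_0^s\varphi(\sigma)\,d\sigma$. Assume that $\varphi$ is continuously differentiable as an $L$-periodic function on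 $\mathbb R$. Let $\kappa=d\psi/ds$ be the signed curvature of $\partial\Omega$, where $\psi$ is the continuous tangent angle, $\gamma'=e^{i\psi}$. Then at every $s$ at which $\kappa(s)$ exists, the principal value below exists and $$\kappa(s)=2\pi\varphi(s)\left[1-\frac1{2\pi}\,\mathrm{p.v.}\!\int_0^{L}\cot\left(\frac{\Phi(s)-\Phi(\sigma)}2\right)\frac{d}{d\sigma}(\log\varphi)(\sigma)\,d\sigma\right],$$ where, the integrand being $L$-periodic in $\sigma$, $\mathrm{p.v.}\int_0^L$ stands for $\lim_{\varepsilon\to0^+}\int_{s+\varepsilon}^{s+L-\varepsilon}$. If moreover $\varphi'$ is Hölder continuous (with some positive exponent), then $\kappa(s)$ exists for every $s$, and so the formula holds for every $s\in[0,L]$. -/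

import Mathlib

open Set Filter Topology
open scoped NNReal

noncomputable section

/-- `Ω` is a bounded simply connected plane domain of class `C^{1,α}`: near every boundary point `p`,
in coordinates `p + u (x + i y)` with `‖u‖ = 1`, the domain is the region strictly above the graph
of a `C^{1,α}` function, so that the boundary is locally that graph. -/
structure IsC1HolderDomain (α : ℝ≥0) (Ω : Set ℂ) : Prop where
  isOpen : IsOpen Ω
  isConnected : IsConnected Ω
  isSimplyConnected : IsSimplyConnected Ω
  isBounded : Bornology.IsBounded Ω
  local_graph : ∀ p ∈ frontier Ω, ∃ (u : ℂ) (r : ℝ) (g : ℝ → ℝ) (C : ℝ≥0),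
    ‖u‖ = 1 ∧ 0 < r ∧ ContDiff ℝ 1 g ∧ HolderWith C α (deriv g) ∧
    ∀ x y : ℝ, |x| < r → |y| < r →
      (p + u * ((x : ℂ) + (y : ℂ) * Complex.I) ∈ Ω ↔ g x < y)

/-- `γ` is the counterclockwise arclength parametrization of `∂Ω` starting from `b`, extended
periodically to `ℝ`; its period `L` is the perimeter `|∂Ω|`. Counterclockwise means that `Ω` lies
to the left of `γ`, that is, `i γ'(s)` is the interior unit normal at `γ(s)`. -/
structure IsBoundaryParam (Ω : Set ℂ) (b : ℂ) (L : ℝ) (γ : ℝ → ℂ) : Prop where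
  pos : 0 < L
  contDiff : ContDiff ℝ 1 γ
  unit_speed : ∀ s, ‖deriv γ s‖ = 1
  periodic : Function.Periodic γ L
  injOn : InjOn γ (Ico 0 L)
  range_eq : range γ = frontier Ω
  start : γ 0 = b
  left : ∀ s, ∀ᶠ t : ℝ in 𝓝[>] 0, γ s + (t : ℂ) * (Complex.I * deriv γ s) ∈ Ω

/-- `U` is the Green's function of `Ω` with pole `c`, i.e. the solution of `-ΔU = δ_c` in `Ω`,
`U = 0` on `∂Ω`: it is the sum of the fundamental solution `-(1/2π) log |z - c|` and a harmonic
function in `Ω`, is continuous on the closure away from `c`, and vanishes on the boundary. -/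
structure IsGreenFunction (Ω : Set ℂ) (c : ℂ) (U : ℂ → ℝ) : Prop where
  pole : ∃ h : ℂ → ℝ, InnerProductSpace.HarmonicOnNhd h Ω ∧
    ∀ z ∈ Ω, z ≠ c → U z = -(1 / (2 * Real.pi)) * Real.log ‖z - c‖ + h z
  continuousOn : ContinuousOn U (closure Ω \ {c})
  boundary : ∀ z ∈ frontier Ω, U z = 0

/-- `φ` is the interior normal derivative of `U` on `∂Ω`, as a function of the arclength of `γ`:
`φ(s)` is the boundary value at `γ(s)`, from within `Ω`, of the derivative of `U` in the direction
of the interior unit normal `i γ'(s)`. -/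
def IsNormalDerivative (Ω : Set ℂ) (γ : ℝ → ℂ) (U : ℂ → ℝ) (φ : ℝ → ℝ) : Prop :=
  ∀ s, Tendsto (fun z => fderiv ℝ U z (Complex.I * deriv γ s)) (𝓝[Ω] (γ s)) (𝓝 (φ s))

/-- The signed curvature of the unit speed curve `γ` at `s` exists and equals `k`: it is the
derivative `dψ/ds` of the (continuous) angle `ψ` between the positive real axis and the tangent. -/
def HasSignedCurvatureAt (γ : ℝ → ℂ) (s k : ℝ) : Prop :=
  ∃ ψ : ℝ → ℝ, Continuous ψ ∧ (∀ t, deriv γ t = Complex.exp ((ψ t : ℂ) * Complex.I)) ∧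
    HasDerivAt ψ k s

/-- `Φ(s) = 2π ∫₀ˢ φ`. -/
def bigPhi (φ : ℝ → ℝ) (s : ℝ) : ℝ :=
  2 * Real.pi * ∫ σ in (0 : ℝ)..s, φ σ

/-- The principal value, over one period of length `L`, of the integral of
`cot ((Φ(s) - Φ(σ)) / 2) (log φ)'(σ)` exists and equals `J`. An arc of length `ε` is removed on
each side of the singular point `σ = s`. -/
def HasCotPV (φ : ℝ → ℝ) (L s J : ℝ) : Prop :=
  Tendsto
    (fun ε : ℝ => ∫ σ in (s + ε)..(s + L - ε),
      Real.cot ((bigPhi φ s - bigPhi φ σ) / 2) * deriv (fun x => Real.log (φ x)) σ)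
    (𝓝[>] 0) (𝓝 J)

end

open scoped ComplexConjugate

noncomputable section

/-! On the simply connected domain the Green's function is `U = -(1/2π) log |f|` with `f` a
conformal map onto the unit disc. Since `U` vanishes on the boundary, the assumed limit of the
normal derivative forces a limit of the whole gradient: `f'/f` tends to `2πφ i · conj γ'` at `γ(s)`.
Hence `f(γ(s)) = ζ(s) = e^{i(Φ(s)+θ)}`. Hopf's lemma gives `φ > 0`, so `f'` is bounded away from
zero, the inverse map `g` extends continuously, and `k = log g'` is holomorphic in the disc and
continuous up to the circle (`exists_boundary_log`), with `γ' = e^{k(ζ)} · 2πφ i ζ`.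

Let `u` and `v` be the real and imaginary parts of `k` on the circle, as functions of the angle `t =
Φ(s) + θ`. The modulus of the last identity says `u = -log(2πφ)`; the argument says that the tangent
angle is `v + t + π/2`. Therefore `κ` exists at `s` exactly when `v` is differentiable at `t`, and
then `κ = 2πφ(1 + v'(t))`. What remains is to express `v'` by `u'`, that is, by the derivative of
`log φ`.

Cauchy's theorem and an integration by parts show that the conjugate Poisson integral of `u'` is the
angular derivative of the Poisson integral of `v` (`integral_conjPoisson_mul_deriv`). If `v` is
differentiable at the single point `t`, Fatou's argument gives the limit of the right side as `r →
1`. As `u'` is continuous, the left side differs by `o(1)` from the cotangent integral truncated at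
`1 - r`. So the principal value exists and equals `-2π v'(t)`
(`tendsto_integral_cot_half_of_hasDerivAt`). Cuts symmetric in arclength are asymptotically
symmetric in the angle, which suffices after the change of variables (`hasCotPV_of_tendsto`).

When `φ'` is Hölder, so is `u'`. The conjugate Poisson integrals then converge uniformly, hence `v`
is differentiable everywhere (`exists_hasDerivAt_im_circle`) and the curvature exists at every
point. -/

/-! ### Primitives on simply connected open sets -/

/-- The complex plane with the discrete topology, the fibre of the covering of local primitives. -/
@[ext]
structure DiscretePlane : Type where
  /-- The underlying complex number. -/
  val : ℂ

instance : TopologicalSpace DiscretePlane := ⊥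

instance : DiscreteTopology DiscretePlane := ⟨rfl⟩

/-- The covering space of germs of primitives of a function with local primitives `P x` on the
balls `ball x (r x)`. -/
def primitiveCovering (s : Set ℂ) (r : s → ℝ) (hr : ∀ x, 0 < r x) (F : ℂ → ℂ) (P : s → ℂ → ℂ)
    (hP : ∀ x : s, ∀ z ∈ Metric.ball (x : ℂ) (r x), HasDerivAt (P x) (F z) z) :
    FiberBundleCore s s DiscretePlane where
  baseSet x := (↑) ⁻¹' Metric.ball (x : ℂ) (r x)
  isOpen_baseSet x := Metric.isOpen_ball.preimage continuous_subtype_val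
  indexAt x := x
  mem_baseSet_at x := Metric.mem_ball_self (hr x)
  -- A fibre value `v` in chart `x` stands for the germ at `b` of the primitive `P x + v`; rewriting
  -- it as `P y` plus a constant gives this formula.
  coordChange x y b v := ⟨v.val + P x b - P y b⟩
  coordChange_self x b _ v := by
    ext
    simp
  continuousOn_coordChange x y := by
    -- The intersection of two balls is convex, so two primitives differ there by a single constant.
    -- This makes the transition maps continuous for the discrete fibre.
    have hconst : ∀ b ∈ Metric.ball (x : ℂ) (r x) ∩ Metric.ball (y : ℂ) (r y),
        ∀ b' ∈ Metric.ball (x : ℂ) (r x) ∩ Metric.ball (y : ℂ) (r y),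
          P x b - P y b = P x b' - P y b' := by
      intro b hb b' hb'
      have hconv : Convex ℝ (Metric.ball (x : ℂ) (r x) ∩ Metric.ball (y : ℂ) (r y)) :=
        (convex_ball _ _).inter (convex_ball _ _)
      have := hconv.norm_image_sub_le_of_norm_hasDerivWithin_le (f := fun z => P x z - P y z)
        (f' := fun _ => 0) (C := 0)
        (fun z hz => by
          have := (hP x z hz.1).sub (hP y z hz.2)
          rw [sub_self] at this
          exact this.hasDerivWithinAt)
        (by simp) hb' hb
      simpa [sub_eq_zero] using this
    rintro ⟨b, v⟩ ⟨hb, -⟩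
    refine tendsto_nhds_of_eventually_eq ?_
    filter_upwards [self_mem_nhdsWithin, mem_nhdsWithin_of_mem_nhds
      (((isOpen_discrete ({v} : Set DiscretePlane)).preimage continuous_snd).mem_nhds
        (show ((b, v) : s × DiscretePlane).2 ∈ ({v} : Set DiscretePlane) from rfl))] with p hp hp2
    have hp1 := hp.1
    replace hp2 : p.2 = v := hp2
    have := hconst _ hp1 _ hb
    ext
    change p.2.val + P x p.1 - P y p.1 = v.val + P x b - P y b
    rw [hp2, add_sub_assoc, add_sub_assoc, this]
  coordChange_comp x y z b _ v := by
    ext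
    change v.val + P x b - P y b + P y b - P z b = v.val + P x b - P z b
    ring

/-- A holomorphic function on a simply connected open set has a primitive. -/
theorem DifferentiableOn.isExactOn_of_isSimplyConnected {s : Set ℂ} (hs : IsOpen s)
    (hsc : IsSimplyConnected s) {F : ℂ → ℂ} (hF : DifferentiableOn ℂ F s) :
    Complex.IsExactOn F s := by
  classical
  have hex : ∀ x : s, ∃ r > 0, Metric.ball (x : ℂ) r ⊆ s := fun x =>
    Metric.isOpen_iff.1 hs x x.2
  choose r hr hrs using hex
  choose P hP using fun x : s => (hF.mono (hrs x)).isExactOn_ball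
  let Z := primitiveCovering s r hr F P hP
  have hcov : IsCoveringMap (Bundle.TotalSpace.proj : Bundle.TotalSpace DiscretePlane Z.Fiber → s) :=
    FiberBundle.isCoveringMap
  have := hsc.simplyConnectedSpace
  have := hs.locallyPathConnectedSpace
  obtain ⟨x₀, hx₀⟩ := hsc.nonempty
  -- Monodromy: over a simply connected base the identity lifts, and the lift is a coherent global
  -- choice of germs.
  obtain ⟨σ, ⟨-, hσ⟩, -⟩ := hcov.existsUnique_continuousMap_lifts (ContinuousMap.id s) ⟨x₀, hx₀⟩
    ⟨⟨x₀, hx₀⟩, ⟨0⟩⟩ rfl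
  have hσ1 : ∀ b : s, (σ b).1 = b := fun b => congrFun hσ b
  have hcc : ∀ (x y b : s) (v : DiscretePlane), (Z.coordChange x y b v).val =
      v.val + P x b - P y b := fun _ _ _ _ => rfl
  -- Evaluate the chosen germ at its own base point; near any `x` this is `P x` plus a constant.
  let G' : s → ℂ := fun b => (Z.localTriv b (σ b)).2.val + P b b
  refine ⟨fun z => if h : z ∈ s then G' ⟨z, h⟩ else 0, fun z hz => ?_⟩
  set x : s := ⟨z, hz⟩
  have hcont : ContinuousAt (fun b : s => (Z.localTriv x (σ b)).2) x := by
    have h1 : ContinuousAt (Z.localTriv x) (σ x) := by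
      refine (Z.localTriv x).continuousAt ?_
      rw [FiberBundleCore.mem_localTriv_source, hσ1]
      exact Metric.mem_ball_self (hr x)
    exact continuous_snd.continuousAt.comp (h1.comp σ.continuous.continuousAt)
  have hev : ∀ᶠ b : s in 𝓝 x, (Z.localTriv x (σ b)).2 = (Z.localTriv x (σ x)).2 :=
    hcont.eventually ((isOpen_discrete ({(Z.localTriv x (σ x)).2})).mem_nhds rfl)
  have hev2 : ∀ᶠ w in 𝓝 z, ∀ h : w ∈ s, (Z.localTriv x (σ ⟨w, h⟩)).2 = (Z.localTriv x (σ x)).2 := by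
    have := (hs.isOpenEmbedding_subtypeVal.map_nhds_eq x)
    rw [show z = ((x : s) : ℂ) from rfl, ← this, eventually_map]
    filter_upwards [hev] with b hb h using hb
  have hG : ∀ᶠ w in 𝓝 z, (if h : w ∈ s then G' ⟨w, h⟩ else 0) =
      P x w + (Z.localTriv x (σ x)).2.val := by
    filter_upwards [hev2, hs.mem_nhds hz] with w hw hws
    rw [dif_pos hws, ← hw hws]
    set b : s := ⟨w, hws⟩
    have e : ∀ y : s, (Z.localTriv y (σ b)).2.val = DiscretePlane.val (σ b).2 + P (σ b).1 b - P y b := by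
      intro y
      rw [FiberBundleCore.localTriv_apply]
      exact (hcc _ y _ _).trans (congrArg (fun t : s => DiscretePlane.val (σ b).2 +
        P (σ b).1 t - P y t) (hσ1 b))
    change (Z.localTriv b (σ b)).2.val + P b b = P x w + (Z.localTriv x (σ b)).2.val
    erw [e b, e x]
    change _ = P x b + _
    ring
  exact ((hP x z (Metric.mem_ball_self (hr x))).add_const _).congr_of_eventuallyEq hG

/-! ### Proper holomorphic maps onto the disc -/

/-- Near a critical point a nonconstant holomorphic function takes every nearby value twice. -/
theorem AnalyticAt.eventually_exists_two_preimages {f : ℂ → ℂ} {z : ℂ} (hf : AnalyticAt ℂ f z)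
    (hne : ¬ ∀ᶠ x in 𝓝 z, f x = f z) (hd : deriv f z = 0) {N : Set ℂ} (hN : N ∈ 𝓝 z) :
    ∀ᶠ w in 𝓝[≠] (f z), ∃ x₁ ∈ N, ∃ x₂ ∈ N, x₁ ≠ x₂ ∧ f x₁ = w ∧ f x₂ = w := by
  have hf' : AnalyticAt ℂ (fun x => f x - f z) z := hf.sub analyticAt_const
  obtain ⟨n, g, hg, hgz, hfg⟩ := hf'.exists_eventuallyEq_pow_smul_nonzero_iff.2
    (by simpa [sub_eq_zero] using hne)
  have hn0 : n ≠ 0 := by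
    rintro rfl
    have := hfg.self_of_nhds
    simp [hgz.symm] at this
  have hn1 : n ≠ 1 := by
    rintro rfl
    have h1 : HasDerivAt (fun x => f x - f z) 0 z := by
      simpa [hd] using hf.differentiableAt.hasDerivAt.sub_const (f z)
    have h2 : HasDerivAt (fun x => (x - z) ^ 1 • g x) (g z) z := by
      have := ((hasDerivAt_id z).sub_const z).mul hg.differentiableAt.hasDerivAt
      simpa [Pi.mul_def] using this
    exact hgz ((h2.congr_of_eventuallyEq hfg).unique h1)
  have hnC : (n : ℂ) ≠ 0 := by exact_mod_cast hn0
  obtain ⟨a, ha⟩ := IsAlgClosed.exists_pow_nat_eq (g z) (Nat.pos_of_ne_zero hn0)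
  have ha0 : a ≠ 0 := by
    rintro rfl
    rw [zero_pow hn0] at ha
    exact hgz ha.symm
  -- A local `n`-th root of `f - f z`. It has derivative `a ≠ 0`, hence is open at `z`; as `n ≥ 2`,
  -- the points `η` and `ζη` with `ζ` a primitive `n`-th root of unity give two preimages of the
  -- same value.
  let k : ℂ → ℂ := fun x => (x - z) * (a * Complex.exp (Complex.log (g x / g z) / n))
  have hq : AnalyticAt ℂ (fun x => Complex.exp (Complex.log (g x / g z) / n)) z := by
    have h1 : AnalyticAt ℂ (fun x => g x / g z) z := hg.div analyticAt_const hgz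
    have h2 : AnalyticAt ℂ (fun x => Complex.log (g x / g z)) z := h1.clog (by simp [hgz])
    exact (h2.div analyticAt_const hnC).cexp
  have hk : HasStrictDerivAt k a z := by
    have h1 : AnalyticAt ℂ k z :=
      (analyticAt_id.sub analyticAt_const).mul (analyticAt_const.mul hq)
    have h2 : HasDerivAt k a z := by
      have := ((hasDerivAt_id z).sub_const z).mul
        (hq.differentiableAt.hasDerivAt.const_mul a)
      simpa [hgz, Pi.mul_def] using this
    simpa [h2.deriv] using h1.hasStrictDerivAt
  have hkf : ∀ᶠ x in 𝓝 z, f x = f z + k x ^ n := by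
    filter_upwards [hfg, hg.continuousAt.eventually_ne hgz] with x hx hgx
    have : Complex.exp (Complex.log (g x / g z) / n) ^ n = g x / g z := by
      rw [← Complex.exp_nat_mul, mul_div_cancel₀ _ hnC, Complex.exp_log (div_ne_zero hgx hgz)]
    simp only [k, mul_pow, this, ha]
    rw [mul_div_cancel₀ _ hgz, ← smul_eq_mul, ← hx]
    ring
  have himg : k '' (N ∩ {x | f x = f z + k x ^ n}) ∈ 𝓝 (0 : ℂ) := by
    have h0 : k z = 0 := by simp [k]
    rw [← h0, ← hk.map_nhds_eq ha0]
    exact image_mem_map (inter_mem hN hkf)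
  obtain ⟨δ, hδ, hball⟩ := Metric.mem_nhds_iff.1 himg
  have hζ := Complex.isPrimitiveRoot_exp n hn0
  set ζ := Complex.exp (2 * Real.pi * Complex.I / n)
  have hζn : ‖ζ‖ = 1 := hζ.norm'_eq_one hn0
  have hζ1 : ζ ≠ 1 := hζ.ne_one (by omega)
  have hmem : {w | ‖w - f z‖ < δ ^ n} ∈ 𝓝[≠] (f z) := by
    refine mem_nhdsWithin_of_mem_nhds ?_
    refine (isOpen_lt (by fun_prop) continuous_const).mem_nhds ?_
    simpa using pow_pos hδ n
  filter_upwards [hmem, self_mem_nhdsWithin] with w hw hwne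
  obtain ⟨η, hη⟩ := IsAlgClosed.exists_pow_nat_eq (w - f z) (Nat.pos_of_ne_zero hn0)
  have hη0 : η ≠ 0 := by
    rintro rfl
    rw [zero_pow hn0] at hη
    exact hwne (sub_eq_zero.1 hη.symm)
  have hηδ : ‖η‖ < δ := by
    refine lt_of_pow_lt_pow_left₀ n hδ.le ?_
    rw [← norm_pow, hη]
    exact hw
  obtain ⟨x₁, hx₁, hk₁⟩ := hball (show η ∈ Metric.ball (0 : ℂ) δ by simpa using hηδ)
  obtain ⟨x₂, hx₂, hk₂⟩ := hball (show ζ * η ∈ Metric.ball (0 : ℂ) δ by simpa [hζn] using hηδ)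
  refine ⟨x₁, hx₁.1, x₂, hx₂.1, ?_, ?_, ?_⟩
  · rintro rfl
    rw [hk₁] at hk₂
    exact hζ1 (mul_right_cancel₀ hη0 (by rw [one_mul]; exact hk₂.symm))
  · have : f x₁ = f z + k x₁ ^ n := hx₁.2
    rw [this, hk₁, hη]
    ring
  · have : f x₂ = f z + k x₂ ^ n := hx₂.2
    rw [this, hk₂, mul_pow, hζ.pow_eq_one, one_mul, hη]
    ring

/-- A proper holomorphic map from a domain to the unit disc, with a single simple zero, is
biholomorphic. -/
theorem bijOn_ball_of_isCompact_preimage {Ω : Set ℂ} (hΩ : IsOpen Ω) (hconn : IsPreconnected Ω)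
    {f : ℂ → ℂ} (hf : DifferentiableOn ℂ f Ω) (hmaps : MapsTo f Ω (Metric.ball 0 1))
    (hproper : ∀ r < 1, IsCompact {z | z ∈ Ω ∧ ‖f z‖ ≤ r}) {c : ℂ} (hc : c ∈ Ω)
    (hzero : ∀ z ∈ Ω, f z = 0 ↔ z = c) (hderiv : deriv f c ≠ 0) :
    BijOn f Ω (Metric.ball 0 1) ∧ ∀ z ∈ Ω, deriv f z ≠ 0 := by
  have hfa : AnalyticOnNhd ℂ f Ω := hf.analyticOnNhd hΩ
  have hnc : ∀ z ∈ Ω, ¬ ∀ᶠ x in 𝓝 z, f x = f z := by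
    intro z hz h
    have h1 := hfa.eqOn_of_preconnected_of_eventuallyEq analyticOnNhd_const hconn hz h
    have h2 : f =ᶠ[𝓝 c] fun _ => f z := by
      filter_upwards [hΩ.mem_nhds hc] with x hx using h1 hx
    exact hderiv (by rw [h2.deriv_eq]; simp)
  have hopen : ∀ z ∈ Ω, 𝓝 (f z) ≤ map f (𝓝 z) := by
    intro z hz
    exact (hfa z hz).eventually_constant_or_nhds_le_map_nhds.resolve_left (hnc z hz)
  -- preimages of a convergent sequence of values subconverge
  have hsub : ∀ w ∈ Metric.ball (0 : ℂ) 1, ∀ x : ℕ → ℂ, (∀ n, x n ∈ Ω) →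
      Tendsto (fun n => f (x n)) atTop (𝓝 w) →
      ∃ z ∈ Ω, f z = w ∧ ∃ θ : ℕ → ℕ, StrictMono θ ∧ Tendsto (x ∘ θ) atTop (𝓝 z) := by
    intro w hw x hx hlim
    rw [mem_ball_zero_iff] at hw
    obtain ⟨r, hwr, hr⟩ := exists_between hw
    have hev : ∀ᶠ n in atTop, x n ∈ {z | z ∈ Ω ∧ ‖f z‖ ≤ r} := by
      filter_upwards [hlim.norm.eventually_lt_const hwr] with n hn using ⟨hx n, hn.le⟩
    obtain ⟨z, hz, θ, hθ, hθz⟩ := (hproper r hr).tendsto_subseq' hev.frequently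
    refine ⟨z, hz.1, ?_, θ, hθ, hθz⟩
    exact tendsto_nhds_unique
      (((hfa z hz.1).continuousAt.tendsto.comp hθz)) (hlim.comp hθ.tendsto_atTop)
  -- Values taken exactly once, at a noncritical point. This set contains `0` and is open and closed
  -- relative to the disc, so it is all of it.
  let W : Set ℂ := {w | ∃ z ∈ Ω, f z = w ∧ deriv f z ≠ 0 ∧ ∀ z' ∈ Ω, f z' = w → z' = z}
  have hWopen : ∀ w ∈ W, w ∈ Metric.ball (0 : ℂ) 1 → W ∈ 𝓝 w := by
    rintro w ⟨z, hz, rfl, hdz, huniq⟩ hw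
    by_contra hcon
    have hd : ContinuousAt (deriv f) z := (hfa z hz).deriv.continuousAt
    have hstrict := (hfa z hz).hasStrictDerivAt
    obtain ⟨N, hN, hNinj⟩ : ∃ N ∈ 𝓝 z, InjOn f N := by
      let e := hstrict.hasStrictFDerivAt_equiv hdz |>.toOpenPartialHomeomorph f
      refine ⟨e.source, e.open_source.mem_nhds
        (hstrict.hasStrictFDerivAt_equiv hdz).mem_toOpenPartialHomeomorph_source, e.injOn⟩
    have hN' : N ∩ {x | x ∈ Ω ∧ deriv f x ≠ 0} ∈ 𝓝 z :=
      inter_mem hN (inter_mem (hΩ.mem_nhds hz) (hd.eventually_ne hdz))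
    have himg : f '' (N ∩ {x | x ∈ Ω ∧ deriv f x ≠ 0}) ∈ 𝓝 (f z) :=
      hopen z hz (image_mem_map hN')
    have hfreq : ∃ᶠ w in 𝓝 (f z), w ∉ W ∧ w ∈ f '' (N ∩ {x | x ∈ Ω ∧ deriv f x ≠ 0}) :=
      (not_eventually.1 (show ¬ ∀ᶠ w in 𝓝 (f z), w ∈ W from hcon)).and_eventually himg
    obtain ⟨y, hylim, hy⟩ := exists_seq_forall_of_frequently hfreq
    -- A value outside `W` with a noncritical preimage in `N` must have another preimage, which
    -- injectivity on `N` pushes outside `N`. By properness these extra preimages subconverge to a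
    -- preimage of `f z`, which can only be `z`.
    have hbad : ∀ n, ∃ x ∈ Ω, f x = y n ∧ x ∉ N := by
      intro n
      obtain ⟨hnW, z₁, ⟨hz₁N, hz₁Ω, hdz₁⟩, hz₁⟩ := hy n
      by_contra! hall
      exact hnW ⟨z₁, hz₁Ω, hz₁, hdz₁, fun z' hz' hfz' =>
        hNinj (hall z' hz' hfz') hz₁N (hfz'.trans hz₁.symm)⟩
    choose x hxΩ hxy hxN using hbad
    obtain ⟨z', hz', hfz', θ, hθ, hθz⟩ := hsub (f z) hw x hxΩ (by simpa [hxy] using hylim)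
    rw [huniq z' hz' hfz'] at hθz
    obtain ⟨n, hn⟩ := (hθz.eventually hN).exists
    exact hxN _ hn
  have hWclosed : ∀ w ∈ Metric.ball (0 : ℂ) 1, w ∈ closure W → w ∈ W := by
    intro w hw hcl
    obtain ⟨y, hyW, hylim⟩ := mem_closure_iff_seq_limit.1 hcl
    choose x hxΩ hxy hdx hux using hyW
    obtain ⟨z, hz, hfz, θ, hθ, hθz⟩ := hsub w hw x hxΩ (by simpa [hxy] using hylim)
    -- By openness of `f`, a second preimage of the limit would have preimages of the approximating
    -- values near it, while the unique ones converge to `z`.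
    have huniq : ∀ z' ∈ Ω, f z' = w → z' = z := by
      intro z' hz' hfz'
      by_contra hne
      obtain ⟨A, B, hA, hB, hzA, hzB, hAB⟩ := t2_separation hne
      have h1 : f '' (A ∩ Ω) ∈ 𝓝 w := by
        rw [← hfz']
        exact hopen z' hz' (image_mem_map (inter_mem (hA.mem_nhds hzA) (hΩ.mem_nhds hz')))
      have h2 := (hylim.comp hθ.tendsto_atTop).eventually h1
      obtain ⟨n, ⟨t, ht, hft⟩, hn2⟩ := (h2.and (hθz.eventually (hB.mem_nhds hzB))).exists
      have := hux (θ n) t ht.2 hft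
      subst this
      exact hAB.le_bot ⟨ht.1, hn2⟩
    refine ⟨z, hz, hfz, fun hd0 => ?_, huniq⟩
    have h2 := (hfa z hz).eventually_exists_two_preimages (hnc z hz) hd0 (hΩ.mem_nhds hz)
    rw [eventually_nhdsWithin_iff, hfz] at h2
    obtain ⟨n, hn, hnc'⟩ := ((hylim.eventually h2).and (Eventually.of_forall fun n => hdx n)).exists
    have hyne : y n ≠ w := by
      intro h
      have := huniq (x n) (hxΩ n) ((hxy n).trans h)
      exact hnc' (by rw [this, hd0])
    obtain ⟨x₁, hx₁, x₂, hx₂, hne, h₁, h₂⟩ := hn hyne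
    exact hne ((hux n x₁ hx₁ h₁).trans (hux n x₂ hx₂ h₂).symm)
  have hall : Metric.ball (0 : ℂ) 1 ⊆ W := by
    have h1 : IsPreconnected (Metric.ball (0 : ℂ) 1) := (convex_ball _ _).isPreconnected
    have h2 := h1.subset_of_closure_inter_subset (u := W ∩ Metric.ball 0 1) ?_ ?_ ?_
    · exact fun w hw => (h2 hw).1
    · rw [isOpen_iff_mem_nhds]
      exact fun w hw => inter_mem (hWopen w hw.1 hw.2) (Metric.isOpen_ball.mem_nhds hw.2)
    · have h0 : (0 : ℂ) ∈ Metric.ball (0 : ℂ) 1 := Metric.mem_ball_self one_pos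
      refine ⟨0, h0, ⟨c, hc, (hzero c hc).2 rfl, hderiv, fun z' hz' h => (hzero z' hz').1 h⟩, h0⟩
    · rintro w ⟨hcl, hw⟩
      exact ⟨hWclosed w hw (closure_mono inter_subset_left hcl), hw⟩
  refine ⟨⟨hmaps, ?_, ?_⟩, ?_⟩
  · intro z hz z' hz' h
    obtain ⟨x, -, -, -, hu⟩ := hall (hmaps hz)
    rw [hu z hz rfl, hu z' hz' h.symm]
  · intro w hw
    obtain ⟨x, hx, hfx, -⟩ := hall hw
    exact ⟨x, hx, hfx⟩
  · intro z hz
    obtain ⟨x, -, -, hd, hu⟩ := hall (hmaps hz)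
    rwa [hu z hz rfl]

/-! ### The Green's function and the conformal map -/

/-- On a simply connected open set a harmonic function is the real part of a holomorphic one. -/
theorem InnerProductSpace.HarmonicOnNhd.exists_differentiableOn_re_eq {s : Set ℂ} (hs : IsOpen s)
    (hsc : IsSimplyConnected s) {h : ℂ → ℝ} (hh : InnerProductSpace.HarmonicOnNhd h s) :
    ∃ H : ℂ → ℂ, DifferentiableOn ℂ H s ∧ ∀ z ∈ s, (H z).re = h z := by
  obtain ⟨c, hc⟩ := hsc.nonempty
  -- The function `h_x - i h_y` is holomorphic, and it is the derivative of the holomorphic function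
  -- sought.
  have hg : DifferentiableOn ℂ (fun z => (fderiv ℝ h z 1 : ℂ) - Complex.I * fderiv ℝ h z Complex.I)
      s := fun x hx => (HarmonicAt.differentiableAt_complex_partial (hh x hx)).differentiableWithinAt
  obtain ⟨H, hHc, hH⟩ := (hg.isExactOn_of_isSimplyConnected hs hsc).with_val_at c (h c)
  have hHd : DifferentiableOn ℂ H s := fun x hx => (hH x hx).differentiableAt.differentiableWithinAt
  refine ⟨H, hHd, ?_⟩
  have hder : ∀ z ∈ s, HasFDerivAt (fun z => (H z).re) (fderiv ℝ h z) z := by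
    intro z hz
    have h1 : HasFDerivAt H _ z := ((hH z hz).hasFDerivAt).restrictScalars ℝ
    have h2 := Complex.reCLM.hasFDerivAt.comp z h1
    refine h2.congr_fderiv ?_
    ext a
    symm
    nth_rw 1 [(by simp : a = a.re • (1 : ℂ) + a.im • (Complex.I : ℂ))]
    rw [map_add, map_smul, map_smul]
    simp
  refine hs.eqOn_of_fderiv_eq (𝕜 := ℝ) hsc.isPathConnected.isConnected.isPreconnected
    (fun z hz => (hder z hz).differentiableAt.differentiableWithinAt)
    (fun z hz => ((hh z hz).1.differentiableAt two_ne_zero).differentiableWithinAt)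
    (fun z hz => (hder z hz).fderiv) hc (by simp [hHc])

/-- Locally `log |f|` is a constant plus the real part of `log (f / f z)`; the quotient is near `1`,
away from the branch cut. -/
theorem HasDerivAt.hasFDerivAt_log_norm {f : ℂ → ℂ} {f' z : ℂ} (hf : HasDerivAt f f' z)
    (hz : f z ≠ 0) :
    HasFDerivAt (fun x => Real.log ‖f x‖)
      (Complex.reCLM.comp ((ContinuousLinearMap.mul ℂ ℂ (f' / f z)).restrictScalars ℝ)) z := by
  have h1 : HasDerivAt (fun x => Complex.log (f x / f z)) (f' / f z) z := by
    have := (hf.div_const (f z)).clog (by simp [hz])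
    simpa [hz] using this
  have h2 := Complex.reCLM.hasFDerivAt.comp z (h1.hasFDerivAt.restrictScalars ℝ)
  have h3 : (fun x => Real.log ‖f x‖) =ᶠ[𝓝 z]
      fun x => (Complex.reCLM ∘ fun x => Complex.log (f x / f z)) x + Real.log ‖f z‖ := by
    filter_upwards [hf.continuousAt.eventually_ne hz] with x hx
    simp [Complex.log_re, Real.log_div, hx, hz]
  refine ((h2.add_const _).congr_of_eventuallyEq h3).congr_fderiv ?_
  ext a
  simp [mul_comm]

/-- The Green's function of a bounded simply connected domain is `-(1/2π) log ‖f‖` for a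
biholomorphic map `f` onto the unit disc. -/
theorem IsGreenFunction.exists_bijOn_ball {Ω : Set ℂ} {c : ℂ} {U : ℂ → ℝ} (hU : IsGreenFunction Ω c U)
    (hΩ : IsOpen Ω) (hsc : IsSimplyConnected Ω) (hb : Bornology.IsBounded Ω) (hc : c ∈ Ω) :
    ∃ f : ℂ → ℂ, DifferentiableOn ℂ f Ω ∧ BijOn f Ω (Metric.ball 0 1) ∧
      (∀ z ∈ Ω, deriv f z ≠ 0) ∧ f c = 0 ∧
      (∀ p ∈ frontier Ω, Tendsto (fun z => ‖f z‖) (𝓝[Ω] p) (𝓝 1)) ∧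
      ∀ z ∈ Ω, z ≠ c → U z = -(1 / (2 * Real.pi)) * Real.log ‖f z‖ := by
  classical
  obtain ⟨h, hh, hUh⟩ := hU.pole
  obtain ⟨H, hH, hHh⟩ := hh.exists_differentiableOn_re_eq hΩ hsc
  have hconn := hsc.isPathConnected.isConnected.isPreconnected
  have hpi : (2 * Real.pi) ≠ 0 := by positivity
  -- With `H` completing the regular part of `U`, this gives `-(1/2π) log |f| = U`, and `c` is
  -- visibly the only zero and a simple one.
  let f : ℂ → ℂ := fun z => (z - c) * Complex.exp (-(2 * Real.pi) * H z)
  have hf : DifferentiableOn ℂ f Ω :=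
    (differentiableOn_id.sub_const c).mul ((hH.const_mul _).cexp)
  have hfc : f c = 0 := by simp [f]
  have hf0 : ∀ z, f z = 0 ↔ z = c := fun z => by simp [f, sub_eq_zero]
  have hnorm : ∀ z, ‖f z‖ = ‖z - c‖ * Real.exp (-(2 * Real.pi) * (H z).re) := by
    intro z
    simp [f, Complex.norm_exp]
  have hUf : ∀ z ∈ Ω, z ≠ c → U z = -(1 / (2 * Real.pi)) * Real.log ‖f z‖ := by
    intro z hz hzc
    have : ‖z - c‖ ≠ 0 := by simpa [sub_eq_zero] using hzc
    rw [hUh z hz hzc, hnorm, Real.log_mul this (Real.exp_ne_zero _), Real.log_exp, hHh z hz]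
    field_simp
    ring
  have hUf' : ∀ z ∈ Ω, z ≠ c → ‖f z‖ = Real.exp (-(2 * Real.pi) * U z) := by
    intro z hz hzc
    have : 0 < ‖f z‖ := norm_pos_iff.2 (by simpa [hf0] using hzc)
    rw [hUf z hz hzc]
    field_simp
    rw [Real.exp_log this]
  have hderiv : deriv f c ≠ 0 := by
    have h1 : HasDerivAt f (Complex.exp (-(2 * Real.pi) * H c)) c := by
      have h2 : DifferentiableAt ℂ (fun z => Complex.exp (-(2 * Real.pi) * H z)) c :=
        (((hH.differentiableAt (hΩ.mem_nhds hc)).const_mul _).cexp)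
      have := ((hasDerivAt_id c).sub_const c).fun_mul h2.hasDerivAt
      simp only [id, sub_self, zero_mul, one_mul, add_zero] at this
      exact this
    rw [h1.deriv]
    exact Complex.exp_ne_zero _
  have hfr : ∀ p ∈ frontier Ω, p ∉ Ω := fun p hp hpΩ => by
    rw [hΩ.frontier_eq] at hp
    exact hp.2 hpΩ
  -- Setting `|f| = 1` off `Ω` yields a continuous function on the compact closure, since it equals
  -- `exp(-2πU)` away from `c`. Both the maximum principle and properness are read off from it.
  let M : ℂ → ℝ := fun z => if z ∈ Ω then ‖f z‖ else 1
  have hMΩ : ∀ z ∈ Ω, M z = ‖f z‖ := fun z hz => if_pos hz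
  have hM1 : ∀ z ∉ Ω, M z = 1 := fun z hz => if_neg hz
  have hMU : ∀ z ∈ closure Ω \ {c}, M z = Real.exp (-(2 * Real.pi) * U z) := by
    rintro z ⟨hz, hzc⟩
    by_cases hzΩ : z ∈ Ω
    · rw [hMΩ z hzΩ, hUf' z hzΩ hzc]
    · rw [hM1 z hzΩ, hU.boundary z (by rw [hΩ.frontier_eq]; exact ⟨hz, hzΩ⟩)]
      simp
  have hMcont : ContinuousOn M (closure Ω) := by
    intro z hz
    by_cases hzΩ : z ∈ Ω
    · refine ContinuousAt.continuousWithinAt ?_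
      refine (hf.continuousOn.continuousAt (hΩ.mem_nhds hzΩ)).norm.congr ?_
      filter_upwards [hΩ.mem_nhds hzΩ] with x hx using (hMΩ x hx).symm
    · have hzc : z ≠ c := fun h => hzΩ (h ▸ hc)
      have h1 : ContinuousWithinAt (fun z => Real.exp (-(2 * Real.pi) * U z)) (closure Ω \ {c}) z :=
        ((continuousWithinAt_const.mul (hU.continuousOn z ⟨hz, hzc⟩))).rexp
      have h2 : ContinuousWithinAt M (closure Ω \ {c}) z :=
        h1.congr hMU (hMU z ⟨hz, hzc⟩)
      refine h2.mono_of_mem_nhdsWithin ?_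
      exact inter_mem self_mem_nhdsWithin (mem_nhdsWithin_of_mem_nhds (isOpen_ne.mem_nhds hzc))
  have hcomp : IsCompact (closure Ω) := hb.isCompact_closure
  have hfr_ne : ∃ p, p ∈ closure Ω ∧ p ∉ Ω := by
    by_contra! hcl
    have hclopen : IsClopen Ω := ⟨isClosed_of_closure_subset hcl, hΩ⟩
    rcases isClopen_iff.1 hclopen with h | h
    · rw [h] at hc; exact hc
    · rw [h] at hb; exact NormedSpace.unbounded_univ ℝ ℂ hb
  have hlt : ∀ z ∈ Ω, ‖f z‖ < 1 := by
    obtain ⟨w, hw, hmax⟩ := hcomp.exists_isMaxOn ⟨c, subset_closure hc⟩ hMcont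
    obtain ⟨p, hp, hpΩ⟩ := hfr_ne
    have hw1 : 1 ≤ M w := by
      have := hmax hp
      simpa [hM1 p hpΩ] using this
    -- An interior maximum would make `|f|` constant, hence zero because `f c = 0`, although the
    -- maximum is at least `1`.
    have hno : ∀ z ∈ Ω, M z ≠ M w := by
      intro z hz hzw
      have hmz : IsMaxOn (norm ∘ f) Ω z := by
        intro x hx
        have : M x ≤ M w := hmax (subset_closure hx)
        rw [← hzw, hMΩ x hx, hMΩ z hz] at this
        exact this
      have := Complex.norm_eqOn_of_isPreconnected_of_isMaxOn hconn hΩ hf hz hmz hc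
      simp only [Function.comp_apply, hfc, norm_zero, Function.const_apply] at this
      rw [← hzw, hMΩ z hz, ← this] at hw1
      linarith
    have hw2 : w ∉ Ω := fun hw => hno w hw rfl
    intro z hz
    have h1 : M z ≤ M w := hmax (subset_closure hz)
    have h2 := lt_of_le_of_ne h1 (hno z hz)
    rwa [hMΩ z hz, hM1 w hw2] at h2
  have hproper : ∀ r < 1, IsCompact {z | z ∈ Ω ∧ ‖f z‖ ≤ r} := by
    intro r hr
    have : {z | z ∈ Ω ∧ ‖f z‖ ≤ r} = closure Ω ∩ M ⁻¹' Iic r := by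
      ext z
      constructor
      · rintro ⟨h1, h2⟩
        exact ⟨subset_closure h1, by simpa [hMΩ z h1] using h2⟩
      · rintro ⟨h1, h2⟩
        by_cases hz : z ∈ Ω
        · exact ⟨hz, by simpa [hMΩ z hz] using h2⟩
        · simp only [mem_preimage, hM1 z hz, mem_Iic] at h2
          linarith
    rw [this]
    exact hcomp.of_isClosed_subset (hMcont.preimage_isClosed_of_isClosed isClosed_closure isClosed_Iic)
      inter_subset_left
  obtain ⟨hbij, hdne⟩ := bijOn_ball_of_isCompact_preimage hΩ hconn hf
    (fun z hz => by simpa using hlt z hz) hproper hc (fun z _ => hf0 z) hderiv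
  refine ⟨f, hf, hbij, hdne, hfc, fun p hp => ?_, hUf⟩
  have h1 := (hMcont p (frontier_subset_closure hp)).tendsto.mono_left
    (nhdsWithin_mono p subset_closure)
  rw [hM1 p (hfr p hp)] at h1
  refine h1.congr' ?_
  filter_upwards [self_mem_nhdsWithin] with z hz using hMΩ z hz

/-! ### Defining functions of the boundary -/

/-- Near `p`, the set `Ω` is `{ρ > 0}` for a function `ρ` which is strictly differentiable at `p`,
with gradient the unit vector `n`. -/
structure IsDefiningAt (Ω : Set ℂ) (p n : ℂ) (ρ : ℂ → ℝ) : Prop where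
  norm_eq_one : ‖n‖ = 1
  zero : ρ p = 0
  approx : ∀ ε > 0, ∃ δ > 0, ∀ z ∈ Metric.ball p δ, ∀ z' ∈ Metric.ball p δ,
    |ρ z - ρ z' - (conj n * (z - z')).re| ≤ ε * ‖z - z'‖
  mem_iff : ∃ δ > 0, ∀ z ∈ Metric.ball p δ, (z ∈ Ω ↔ 0 < ρ z)

namespace IsDefiningAt

variable {Ω : Set ℂ} {p n : ℂ} {ρ : ℂ → ℝ}

theorem conj_mul_self (h : IsDefiningAt Ω p n ρ) : conj n * n = 1 := by
  rw [Complex.conj_mul', h.norm_eq_one]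
  simp

theorem exists_radius (h : IsDefiningAt Ω p n ρ) {ε : ℝ} (hε : 0 < ε) :
    ∃ δ > 0, (∀ z ∈ Metric.ball p δ, ∀ z' ∈ Metric.ball p δ,
      |ρ z - ρ z' - (conj n * (z - z')).re| ≤ ε * ‖z - z'‖) ∧
      ∀ z ∈ Metric.ball p δ, (z ∈ Ω ↔ 0 < ρ z) := by
  obtain ⟨δ₁, h₁, h₁'⟩ := h.approx ε hε
  obtain ⟨δ₂, h₂, h₂'⟩ := h.mem_iff
  refine ⟨min δ₁ δ₂, lt_min h₁ h₂, fun z hz z' hz' => h₁' z ?_ z' ?_, fun z hz => h₂' z ?_⟩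
  · exact Metric.ball_subset_ball (min_le_left _ _) hz
  · exact Metric.ball_subset_ball (min_le_left _ _) hz'
  · exact Metric.ball_subset_ball (min_le_right _ _) hz

theorem norm_conj_mul (h : IsDefiningAt Ω p n ρ) (v : ℂ) : ‖conj n * v‖ = ‖v‖ := by
  rw [norm_mul, RCLike.norm_conj, h.norm_eq_one, one_mul]

theorem continuousOn_of_approx {δ ε : ℝ} (hn : ‖n‖ = 1)
    (h : ∀ z ∈ Metric.ball p δ, ∀ z' ∈ Metric.ball p δ,
      |ρ z - ρ z' - (conj n * (z - z')).re| ≤ ε * ‖z - z'‖) :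
    ContinuousOn ρ (Metric.ball p δ) := by
  intro z hz
  rw [ContinuousWithinAt, tendsto_iff_dist_tendsto_zero]
  have h1 : Tendsto (fun x => (ε + 1) * ‖x - z‖) (𝓝[Metric.ball p δ] z) (𝓝 0) := by
    have : Continuous fun x : ℂ => (ε + 1) * ‖x - z‖ := by fun_prop
    simpa using (this.tendsto z).mono_left nhdsWithin_le_nhds
  refine squeeze_zero' (Eventually.of_forall fun _ => dist_nonneg) ?_ h1
  filter_upwards [self_mem_nhdsWithin] with x hx
  have h2 := h x hx z hz
  have h3 : |(conj n * (x - z)).re| ≤ ‖x - z‖ := by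
    refine (Complex.abs_re_le_norm _).trans_eq ?_
    rw [norm_mul, RCLike.norm_conj, hn, one_mul]
  rw [Real.dist_eq]
  have h4 := abs_add_le (ρ x - ρ z - (conj n * (x - z)).re) (conj n * (x - z)).re
  rw [sub_add_cancel] at h4
  linarith

/-- The defining function vanishes on the boundary. -/
theorem eq_zero_of_mem_frontier {δ ε : ℝ} (hn : ‖n‖ = 1) (hΩ : IsOpen Ω)
    (h : ∀ z ∈ Metric.ball p δ, ∀ z' ∈ Metric.ball p δ,
      |ρ z - ρ z' - (conj n * (z - z')).re| ≤ ε * ‖z - z'‖)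
    (hmem : ∀ z ∈ Metric.ball p δ, (z ∈ Ω ↔ 0 < ρ z)) {q : ℂ} (hq : q ∈ frontier Ω)
    (hqδ : q ∈ Metric.ball p δ) : ρ q = 0 := by
  rw [hΩ.frontier_eq] at hq
  by_contra hne
  have hlt : ρ q < 0 := lt_of_le_of_ne (not_lt.1 fun h0 => hq.2 ((hmem q hqδ).2 h0)) hne
  have hcont := (continuousOn_of_approx hn h).continuousAt (Metric.isOpen_ball.mem_nhds hqδ)
  have hev : ∀ᶠ x in 𝓝 q, x ∉ Ω := by
    filter_upwards [hcont.eventually_lt_const hlt, Metric.isOpen_ball.mem_nhds hqδ] with x hx hxδ hxΩ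
    exact absurd ((hmem x hxδ).1 hxΩ) (not_lt.2 hx.le)
  obtain ⟨x, hx1, hx2⟩ := (mem_closure_iff_frequently.1 hq.1).and_eventually hev |>.exists
  exact hx2 hx1

theorem hasFDerivAt (h : IsDefiningAt Ω p n ρ) :
    HasFDerivAt ρ (Complex.reCLM.comp ((ContinuousLinearMap.mul ℂ ℂ (conj n)).restrictScalars ℝ))
      p := by
  rw [hasFDerivAt_iff_isLittleO, Asymptotics.isLittleO_iff]
  intro ε hε
  obtain ⟨δ, hδ, h'⟩ := h.approx ε hε
  filter_upwards [Metric.ball_mem_nhds p hδ] with z hz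
  simpa using h' z hz p (Metric.mem_ball_self hδ)

end IsDefiningAt

/-- The gradient of a defining function is the interior normal. -/
theorem IsBoundaryParam.normal_eq {Ω : Set ℂ} {b : ℂ} {L : ℝ} {γ : ℝ → ℂ}
    (hγ : IsBoundaryParam Ω b L γ) (hΩ : IsOpen Ω) {s : ℝ} {n : ℂ} {ρ : ℂ → ℝ}
    (h : IsDefiningAt Ω (γ s) n ρ) : n = Complex.I * deriv γ s := by
  have hγd : HasDerivAt γ (deriv γ s) s :=
    (hγ.contDiff.differentiable one_ne_zero s).hasDerivAt
  obtain ⟨δ, hδ, happ, hmem⟩ := h.exists_radius one_pos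
  have h1 : HasDerivAt (ρ ∘ γ) ((conj n * deriv γ s).re) s := by
    simpa using h.hasFDerivAt.comp_hasDerivAt s hγd
  -- Since `ρ` vanishes along the boundary, `n` is orthogonal to `γ'`. The sign is settled below by
  -- `hγ.left`: moving along `iγ'` enters `Ω`, where `ρ > 0`.
  have h2 : (ρ ∘ γ) =ᶠ[𝓝 s] fun _ => 0 := by
    filter_upwards [hγd.continuousAt (Metric.ball_mem_nhds _ hδ)] with t ht
    exact IsDefiningAt.eq_zero_of_mem_frontier h.norm_eq_one hΩ happ hmem
      (hγ.range_eq ▸ mem_range_self t) ht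
  have hre : (conj n * deriv γ s).re = 0 :=
    (h1.congr_of_eventuallyEq h2.symm).unique (hasDerivAt_const s (0 : ℝ))
  have h3 : HasDerivAt (fun t : ℝ => γ s + (t : ℂ) * (Complex.I * deriv γ s))
      (Complex.I * deriv γ s) 0 := by
    have : HasDerivAt (fun t : ℝ => (t : ℂ)) 1 0 := Complex.ofRealCLM.hasDerivAt
    simpa using (this.mul_const (Complex.I * deriv γ s)).const_add (γ s)
  have h4 : HasDerivAt (fun t : ℝ => ρ (γ s + (t : ℂ) * (Complex.I * deriv γ s)))
      ((conj n * (Complex.I * deriv γ s)).re) 0 := by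
    have h5 : HasFDerivAt ρ
        (Complex.reCLM.comp ((ContinuousLinearMap.mul ℂ ℂ (conj n)).restrictScalars ℝ)) (γ s + ((0 : ℝ) : ℂ) * (Complex.I * deriv γ s)) := by
      simpa using h.hasFDerivAt
    exact h5.comp_hasDerivAt (0 : ℝ) h3
  have hnonneg : 0 ≤ (conj n * (Complex.I * deriv γ s)).re := by
    have hslope := (hasDerivWithinAt_iff_tendsto_slope' (s := Ioi (0 : ℝ)) (by simp)).1
      (h4.hasDerivWithinAt (s := Ioi 0))
    refine ge_of_tendsto hslope ?_
    have hball : ∀ᶠ t : ℝ in 𝓝[>] 0,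
        γ s + (t : ℂ) * (Complex.I * deriv γ s) ∈ Metric.ball (γ s) δ := by
      have hc : Tendsto (fun t : ℝ => γ s + (t : ℂ) * (Complex.I * deriv γ s)) (𝓝 0) (𝓝 (γ s)) := by
        simpa using h3.continuousAt.tendsto
      exact (hc.eventually (Metric.ball_mem_nhds (γ s) hδ)).filter_mono nhdsWithin_le_nhds
    filter_upwards [hγ.left s, hball, self_mem_nhdsWithin] with t ht htδ ht0
    rw [slope_def_field]
    have := (hmem _ htδ).1 ht
    have ht0' : (0 : ℝ) < t := ht0
    simp only [Complex.ofReal_zero, zero_mul, add_zero, h.zero, sub_zero]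
    positivity
  have hnorm : ‖conj n * deriv γ s‖ = 1 := by rw [h.norm_conj_mul, hγ.unit_speed]
  have him : (conj n * deriv γ s).im = -1 := by
    have e1 : (conj n * (Complex.I * deriv γ s)).re = -(conj n * deriv γ s).im := by
      rw [show conj n * (Complex.I * deriv γ s) = Complex.I * (conj n * deriv γ s) by ring]
      simp
    have e2 : (conj n * deriv γ s).im ^ 2 = 1 := by
      have := Complex.sq_norm (conj n * deriv γ s)
      rw [hnorm, Complex.normSq_apply, hre] at this
      nlinarith
    rcases mul_eq_zero.1 (show ((conj n * deriv γ s).im - 1) * ((conj n * deriv γ s).im + 1) = 0 by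
      linear_combination e2) with h | h <;> linarith
  have heq : conj n * deriv γ s = -Complex.I := Complex.ext (by simp [hre]) (by simp [him])
  have : n * (conj n * deriv γ s) = n * -Complex.I := by rw [heq]
  rw [← mul_assoc, mul_comm n (conj n), h.conj_mul_self, one_mul] at this
  rw [this]
  linear_combination n * Complex.I_mul_I

/-- A domain of class `C^{1,α}` has a defining function at each boundary point, which moreover
agrees with its linear part to order `1 + α`. -/
theorem IsC1HolderDomain.exists_isDefiningAt {α : ℝ≥0} {Ω : Set ℂ} (hΩ : IsC1HolderDomain α Ω)
    {p : ℂ} (hp : p ∈ frontier Ω) :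
    ∃ n ρ, IsDefiningAt Ω p n ρ ∧ ∃ C : ℝ, 0 ≤ C ∧ ∀ z,
      |ρ z - (conj n * (z - p)).re| ≤ C * (‖z - p‖ ^ (α : ℝ) * ‖z - p‖) := by
  obtain ⟨u, r, g, C, hu, hr, hg, hgC, hmem⟩ := hΩ.local_graph p hp
  set m := deriv g 0
  set κ := Real.sqrt (1 + m ^ 2)
  have hκ1 : 1 ≤ κ := Real.one_le_sqrt.2 (by nlinarith [sq_nonneg m])
  have hκ0 : 0 < κ := by linarith
  have hκsq : κ ^ 2 = 1 + m ^ 2 := Real.sq_sqrt (by positivity)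
  let w : ℂ → ℂ := fun z => conj u * (z - p)
  have huu : u * conj u = 1 := by
    rw [Complex.mul_conj', hu]; simp
  have hw : ∀ z, z = p + u * (((w z).re : ℂ) + ((w z).im : ℂ) * Complex.I) := by
    intro z
    rw [Complex.re_add_im]
    simp only [w]
    linear_combination (-(z - p)) * huu
  have hwn : ∀ z, ‖w z‖ = ‖z - p‖ := fun z => by simp [w, hu]
  have hmem' : ∀ z ∈ Metric.ball p r, (z ∈ Ω ↔ g (w z).re < (w z).im) := by
    intro z hz
    rw [mem_ball_iff_norm, ← hwn] at hz
    conv_lhs => rw [hw z]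
    exact hmem _ _ ((Complex.abs_re_le_norm _).trans_lt hz) ((Complex.abs_im_le_norm _).trans_lt hz)
  have hgd : ∀ x, HasDerivAt g (deriv g x) x := fun x =>
    (hg.differentiable one_ne_zero x).hasDerivAt
  have hwp : w p = 0 := by simp [w]
  have hg0 : g 0 = 0 := by
    have hp' := hp
    rw [hΩ.isOpen.frontier_eq] at hp'
    have h1 : ¬ g 0 < 0 := by
      have := hmem' p (Metric.mem_ball_self hr)
      rw [hwp] at this
      exact fun h => hp'.2 (this.2 h)
    by_contra hne
    have hpos : 0 < g 0 := lt_of_le_of_ne (not_lt.1 h1) (Ne.symm hne)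
    have hcont : Continuous fun z => g (w z).re - (w z).im := by
      have : Continuous g := hg.continuous
      fun_prop
    have hev : ∀ᶠ z in 𝓝 p, z ∉ Ω := by
      have h2 : ∀ᶠ z in 𝓝 p, 0 < g (w z).re - (w z).im :=
        hcont.continuousAt.eventually_const_lt (by simpa [hwp] using hpos)
      filter_upwards [h2, Metric.ball_mem_nhds p hr] with z hz hzr hzΩ
      have := (hmem' z hzr).1 hzΩ
      linarith
    obtain ⟨x, hx1, hx2⟩ := (mem_closure_iff_frequently.1 hp'.1).and_eventually hev |>.exists
    exact hx2 hx1
  -- The gradient of `y - g(x)` at the base point, rotated by `u` and divided by its length `κ = √(1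
  -- + g'(0)²)`.
  let n : ℂ := u * (-m + Complex.I) / κ
  have hconj : ∀ v, (conj n * v).re = ((conj u * v).im - m * (conj u * v).re) / κ := by
    intro v
    have : conj n * v = (conj u * v) * (-m - Complex.I) / κ := by
      simp only [n, map_div₀, map_mul, map_add, map_neg, Complex.conj_ofReal, Complex.conj_I]
      ring
    rw [this, Complex.div_ofReal_re]
    congr 1
    simp
    ring
  have hn : ‖n‖ = 1 := by
    have : ‖(-m + Complex.I : ℂ)‖ = κ := by
      rw [Complex.norm_def, Complex.normSq_apply]
      congr 1
      simp
      ring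
    simp only [n, norm_div, norm_mul, hu, this, one_mul, Complex.norm_real, Real.norm_eq_abs,
      abs_of_pos hκ0]
    exact div_self hκ0.ne'
  refine ⟨n, fun z => ((w z).im - g (w z).re) / κ, ⟨hn, by simp [hwp, hg0], ?_, r, hr, ?_⟩,
    C, C.2, ?_⟩
  · intro ε hε
    -- Strict differentiability, which `C¹` provides, is what yields an estimate for pairs of points
    -- rather than only against `p`.
    have hst : HasStrictDerivAt g m 0 := hg.contDiffAt.hasStrictDerivAt one_ne_zero
    have h1 := hst.hasStrictFDerivAt.isLittleO
    rw [Asymptotics.isLittleO_iff] at h1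
    have h2 := h1 hε
    rw [Metric.eventually_nhds_iff] at h2
    obtain ⟨δ, hδ, h3⟩ := h2
    refine ⟨δ, hδ, fun z hz z' hz' => ?_⟩
    rw [mem_ball_iff_norm, ← hwn] at hz hz'
    have h4 := @h3 ((w z).re, (w z').re) (by
      rw [Prod.dist_eq, Real.dist_eq, Real.dist_eq, sub_zero, sub_zero]
      exact max_lt ((Complex.abs_re_le_norm _).trans_lt hz) ((Complex.abs_re_le_norm _).trans_lt hz'))
    have hwsub : conj u * (z - z') = w z - w z' := by simp only [w]; ring
    have hwsubn : ‖w z - w z'‖ = ‖z - z'‖ := by rw [← hwsub]; simp [hu]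
    rw [hconj, hwsub]
    have e : ((w z).im - g (w z).re) / κ - ((w z').im - g (w z').re) / κ -
        ((w z - w z').im - m * (w z - w z').re) / κ =
        -((g (w z).re - g (w z').re - m * (w z - w z').re)) / κ := by
      simp only [Complex.sub_im]
      ring
    rw [e, abs_div, abs_neg, abs_of_pos hκ0, div_le_iff₀ hκ0]
    have h5 : |g (w z).re - g (w z').re - m * (w z - w z').re| ≤ ε * |(w z - w z').re| := by
      simpa [mul_comm] using h4
    have h6 : |(w z - w z').re| ≤ ‖z - z'‖ := hwsubn ▸ Complex.abs_re_le_norm _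
    calc _ ≤ ε * |(w z - w z').re| := h5
      _ ≤ ε * ‖z - z'‖ := by gcongr
      _ ≤ ε * ‖z - z'‖ * κ := le_mul_of_one_le_right (by positivity) hκ1
  · intro z hz
    rw [hmem' z hz]
    rw [div_pos_iff_of_pos_right hκ0, sub_pos]
  · intro z
    -- The derivative of `g - m x` is at most `C|x|^α` between `0` and `x`; the mean value
    -- inequality adds one power of `|x|`.
    have h1 : ∀ x : ℝ, |g x - m * x| ≤ C * (|x| ^ (α : ℝ) * |x|) := by
      intro x
      have h2 : ∀ y ∈ uIcc 0 x, HasDerivWithinAt (fun y => g y - m * y) (deriv g y - m)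
          (uIcc 0 x) y := fun y _ => by
        have := (hgd y).sub ((hasDerivAt_id y).const_mul m)
        simp only [mul_one] at this
        exact this.hasDerivWithinAt
      have h3 : ∀ y ∈ uIcc 0 x, ‖deriv g y - m‖ ≤ C * |x| ^ (α : ℝ) := by
        intro y hy
        rw [← dist_eq_norm]
        refine (hgC.dist_le y 0).trans ?_
        gcongr
        rw [Real.dist_eq, sub_zero]
        rcases mem_uIcc.1 hy with h | h <;> rw [abs_le] <;> constructor <;>
          cases abs_cases x <;> linarith
      have h4 := (convex_uIcc 0 x).norm_image_sub_le_of_norm_hasDerivWithin_le h2 h3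
        left_mem_uIcc right_mem_uIcc
      simpa [hg0, mul_assoc] using h4
    rw [hconj]
    have e : ((w z).im - g (w z).re) / κ - ((conj u * (z - p)).im - m * (conj u * (z - p)).re) / κ =
        -(g (w z).re - m * (w z).re) / κ := by
      simp only [w]
      ring
    rw [e, abs_div, abs_neg, abs_of_pos hκ0, div_le_iff₀ hκ0]
    have h6 : |(w z).re| ≤ ‖z - p‖ := hwn z ▸ Complex.abs_re_le_norm _
    have hC : (0 : ℝ) ≤ C := C.2
    calc _ ≤ C * (|(w z).re| ^ (α : ℝ) * |(w z).re|) := h1 _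
      _ ≤ C * (‖z - p‖ ^ (α : ℝ) * ‖z - p‖) := by gcongr
      _ ≤ _ := le_mul_of_one_le_right (by positivity) hκ1

/-! ### Boundary limits of the gradient -/

/-- Gradient estimate for the real part of a holomorphic function. -/
theorem Complex.norm_deriv_le_of_abs_re_le {G : ℂ → ℂ} {z₀ : ℂ} {R M : ℝ} (hR : 0 < R) (hM : 0 < M)
    (hG : DifferentiableOn ℂ G (Metric.ball z₀ R)) (hre : ∀ z ∈ Metric.ball z₀ R, |(G z).re| ≤ M) :
    ‖deriv G z₀‖ ≤ 2 * Real.exp 2 * M / R := by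
  have hsub : Metric.closedBall z₀ (R / 2) ⊆ Metric.ball z₀ R :=
    Metric.closedBall_subset_ball (by linarith)
  -- Exponentiation turns the bound on the real part into a bound on the modulus, to which Cauchy's
  -- estimate on the half ball applies; `|E z₀| ≥ e⁻¹` allows the passage back to `G'`.
  let E : ℂ → ℂ := fun z => Complex.exp (G z / M)
  have hE : DifferentiableOn ℂ E (Metric.ball z₀ R) := (hG.div_const _).cexp
  have hEd : DiffContOnCl ℂ E (Metric.ball z₀ (R / 2)) :=
    (hE.mono (closure_ball z₀ (by positivity : R / 2 ≠ 0) ▸ hsub)).diffContOnCl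
  have hnorm : ∀ z, ‖E z‖ = Real.exp ((G z).re / M) := fun z => by
    simp [E, Complex.norm_exp]
  have h1 : ‖deriv E z₀‖ ≤ Real.exp 1 / (R / 2) := by
    refine Complex.norm_deriv_le_of_forall_mem_sphere_norm_le (by positivity) hEd fun z hz => ?_
    rw [hnorm]
    gcongr
    rw [div_le_one hM]
    exact (le_abs_self _).trans (hre z (hsub (Metric.sphere_subset_closedBall hz)))
  have hz₀ : z₀ ∈ Metric.ball z₀ R := Metric.mem_ball_self hR
  have h2 : deriv E z₀ = E z₀ * (deriv G z₀ / M) := by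
    have := (hG.differentiableAt (Metric.isOpen_ball.mem_nhds hz₀)).hasDerivAt.div_const (M : ℂ)
    exact this.cexp.deriv
  have h3 : Real.exp (-1) ≤ ‖E z₀‖ := by
    rw [hnorm]
    gcongr
    rw [le_div_iff₀ hM, neg_one_mul]
    exact neg_le_of_abs_le (hre z₀ hz₀)
  rw [h2, norm_mul, norm_div, Complex.norm_real, Real.norm_of_nonneg hM.le] at h1
  have h4 : Real.exp (-1) * (‖deriv G z₀‖ / M) ≤ Real.exp 1 / (R / 2) :=
    (mul_le_mul_of_nonneg_right h3 (by positivity)).trans h1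
  have h5 : ‖deriv G z₀‖ / M ≤ Real.exp 2 * 2 / R := by
    have e : Real.exp 2 = Real.exp 1 * Real.exp 1 := by rw [← Real.exp_add]; norm_num
    calc ‖deriv G z₀‖ / M = Real.exp 1 * (Real.exp (-1) * (‖deriv G z₀‖ / M)) := by
          rw [← mul_assoc, ← Real.exp_add]; norm_num
      _ ≤ Real.exp 1 * (Real.exp 1 / (R / 2)) := by gcongr
      _ = _ := by rw [e]; field_simp
  rw [div_le_iff₀ hM] at h5
  calc _ ≤ _ := h5
    _ = _ := by ring

/-- A function with vanishing boundary values and with continuous normal derivative at a boundary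
point is asymptotic there to a multiple of the defining function. -/
theorem IsDefiningAt.abs_sub_le {Ω : Set ℂ} {p n : ℂ} {ρ : ℂ → ℝ} (h : IsDefiningAt Ω p n ρ)
    (hΩ : IsOpen Ω) {V : Set ℂ} (hV : V ∈ 𝓝 p) {U : ℂ → ℝ} {F : ℂ → ℂ}
    (hU : ∀ z ∈ Ω ∩ V, HasFDerivAt U
      (Complex.reCLM.comp ((ContinuousLinearMap.mul ℂ ℂ (F z)).restrictScalars ℝ)) z)
    (hcont : ContinuousOn U (closure Ω ∩ V)) (h0 : ∀ z ∈ frontier Ω ∩ V, U z = 0) {φ₀ : ℝ}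
    (hlim : Tendsto (fun z => (F z * n).re) (𝓝[Ω] p) (𝓝 φ₀)) {ε : ℝ} (hε : 0 < ε) (hε4 : ε ≤ 1 / 4) :
    ∃ δ > 0, ∀ z ∈ Ω ∩ Metric.ball p δ, |U z - φ₀ * ρ z| ≤ 2 * (1 + |φ₀|) * ε * ρ z := by
  obtain ⟨δ₁, hδ₁, happ, hmem⟩ := h.exists_radius hε
  obtain ⟨δ₂, hδ₂, hlim'⟩ : ∃ δ₂ > 0, ∀ z ∈ Ω ∩ Metric.ball p δ₂, |(F z * n).re - φ₀| ≤ ε := by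
    have := (Metric.tendsto_nhds.1 hlim ε hε)
    rw [eventually_nhdsWithin_iff, Metric.eventually_nhds_iff] at this
    obtain ⟨δ, hδ, h'⟩ := this
    exact ⟨δ, hδ, fun z hz => (h' hz.2 hz.1).le⟩
  obtain ⟨δ₃, hδ₃, hV'⟩ := Metric.mem_nhds_iff.1 hV
  set δ₀ := min δ₁ (min δ₂ δ₃)
  have hδ₀ : 0 < δ₀ := lt_min hδ₁ (lt_min hδ₂ hδ₃)
  have hb1 : Metric.ball p δ₀ ⊆ Metric.ball p δ₁ := Metric.ball_subset_ball (min_le_left _ _)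
  have hb2 : Metric.ball p δ₀ ⊆ Metric.ball p δ₂ :=
    Metric.ball_subset_ball ((min_le_right _ _).trans (min_le_left _ _))
  have hb3 : Metric.ball p δ₀ ⊆ V :=
    (Metric.ball_subset_ball ((min_le_right _ _).trans (min_le_right _ _))).trans hV'
  refine ⟨δ₀ / 4, by positivity, ?_⟩
  rintro z ⟨hz, hzδ⟩
  have hzp : ‖z - p‖ < δ₀ / 4 := by rwa [mem_ball_iff_norm] at hzδ
  have hz0 : z ∈ Metric.ball p δ₀ := Metric.ball_subset_ball (by linarith) hzδ
  have hρz : 0 < ρ z := (hmem z (hb1 hz0)).1 hz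
  have hρz' : ρ z ≤ (1 + ε) * ‖z - p‖ := by
    have h1 := happ z (hb1 hz0) p (Metric.mem_ball_self hδ₁)
    rw [h.zero, sub_zero] at h1
    have h2 : (conj n * (z - p)).re ≤ ‖z - p‖ := (Complex.re_le_norm _).trans_eq (h.norm_conj_mul _)
    linarith [le_of_abs_le h1]
  -- Moving from `z` along `-n`, `ρ` decreases at rate at least `1 - ε`, so the boundary is met by
  -- time `T`.
  set T := ρ z / (1 - ε)
  have h1ε : 0 < 1 - ε := by linarith
  have hT0 : 0 < T := div_pos hρz h1ε
  have hT : T < δ₀ / 2 := by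
    rw [div_lt_iff₀ h1ε]
    nlinarith [norm_nonneg (z - p)]
  let x : ℝ → ℂ := fun t => z - t * n
  have hx : ∀ t ∈ Icc 0 T, x t ∈ Metric.ball p δ₀ := by
    intro t ht
    rw [mem_ball_iff_norm]
    calc ‖x t - p‖ = ‖(z - p) - t * n‖ := by simp only [x]; ring_nf
      _ ≤ ‖z - p‖ + ‖(t : ℂ) * n‖ := norm_sub_le _ _
      _ = ‖z - p‖ + t := by simp [h.norm_eq_one, abs_of_nonneg ht.1]
      _ < δ₀ := by linarith [ht.2]
  have hxd : ∀ t, HasDerivAt x (-n) t := by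
    intro t
    have : HasDerivAt (fun t : ℝ => (t : ℂ)) 1 t := Complex.ofRealCLM.hasDerivAt
    simpa using (this.mul_const n).const_sub z
  have hxc : Continuous x := continuous_iff_continuousAt.2 fun t => (hxd t).continuousAt
  have hψ : ∀ t ∈ Icc 0 T, ∀ t' ∈ Icc 0 T, |ρ (x t) - ρ (x t') + (t - t')| ≤ ε * |t - t'| := by
    intro t ht t' ht'
    have h1 := happ _ (hb1 (hx t ht)) _ (hb1 (hx t' ht'))
    have e1 : x t - x t' = -((t - t' : ℝ) : ℂ) * n := by simp only [x]; push_cast; ring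
    have e2 : (conj n * (x t - x t')).re = -(t - t') := by
      rw [e1, show conj n * (-((t - t' : ℝ) : ℂ) * n) = (conj n * n) * (-((t - t' : ℝ) : ℂ)) by ring,
        h.conj_mul_self, one_mul, ← Complex.ofReal_neg, Complex.ofReal_re]
    rw [e2, e1, norm_mul, h.norm_eq_one, mul_one, norm_neg, Complex.norm_real, sub_neg_eq_add] at h1
    exact h1
  have h0T : (0 : ℝ) ∈ Icc 0 T := ⟨le_rfl, hT0.le⟩
  have hTT : T ∈ Icc 0 T := ⟨hT0.le, le_rfl⟩
  have hx0 : x 0 = z := by simp [x]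
  have hψc : ContinuousOn (fun t => ρ (x t)) (Icc 0 T) :=
    (continuousOn_of_approx h.norm_eq_one happ).comp hxc.continuousOn fun t ht => hb1 (hx t ht)
  have hψT : ρ (x T) ≤ 0 := by
    have h1 := hψ T hTT 0 h0T
    rw [hx0, sub_zero, abs_of_pos hT0] at h1
    have h2 := le_of_abs_le h1
    have h3 : T * (1 - ε) = ρ z := div_mul_cancel₀ _ h1ε.ne'
    linarith
  obtain ⟨t, ht, htz⟩ : (0 : ℝ) ∈ (fun t => ρ (x t)) '' Icc 0 T :=
    intermediate_value_Icc' hT0.le hψc ⟨hψT, by simpa only [hx0] using hρz.le⟩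
  simp only at htz
  have ht0 : 0 < t := by
    refine lt_of_le_of_ne ht.1 fun h => ?_
    rw [← h, hx0] at htz
    exact hρz.ne' htz
  have hpos : ∀ r ∈ Ico 0 t, x r ∈ Ω := by
    intro r hr
    have hrT : r ∈ Icc 0 T := ⟨hr.1, hr.2.le.trans ht.2⟩
    rw [hmem _ (hb1 (hx r hrT))]
    have h1 := hψ r hrT t ht
    rw [htz, sub_zero, abs_of_neg (sub_neg.2 hr.2)] at h1
    have h2 := neg_le_of_abs_le h1
    nlinarith [sub_pos.2 hr.2]
  have hq : x t ∈ frontier Ω := by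
    rw [hΩ.frontier_eq]
    refine ⟨?_, fun hq => ?_⟩
    · have h1 : Tendsto x (𝓝[<] t) (𝓝 (x t)) := hxc.continuousAt.mono_left nhdsWithin_le_nhds
      refine mem_closure_of_tendsto h1 ?_
      filter_upwards [Ioo_mem_nhdsLT ht0] with r hr using hpos r ⟨hr.1.le, hr.2⟩
    · have := (hmem _ (hb1 (hx t ht))).1 hq
      exact this.ne' htz
  have hUc : ContinuousOn (fun r => U (x r)) (Icc 0 t) := by
    refine hcont.comp hxc.continuousOn fun r hr => ⟨?_, hb3 (hx r ⟨hr.1, hr.2.trans ht.2⟩)⟩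
    rcases hr.2.eq_or_lt with rfl | hlt
    · exact frontier_subset_closure hq
    · exact subset_closure (hpos r ⟨hr.1, hlt⟩)
  have hUd : ∀ r ∈ Ioo 0 t, HasDerivAt (fun r => U (x r)) (-(F (x r) * n).re) r := by
    intro r hr
    have h1 := (hU (x r) ⟨hpos r ⟨hr.1.le, hr.2⟩,
      hb3 (hx r ⟨hr.1.le, hr.2.le.trans ht.2⟩)⟩).comp_hasDerivAt r (hxd r)
    refine h1.congr_deriv ?_
    simp only [ContinuousLinearMap.comp_apply, ContinuousLinearMap.coe_restrictScalars',
      ContinuousLinearMap.mul_apply', Complex.reCLM_apply, mul_neg, Complex.neg_re]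
  -- The mean value theorem on the segment from `z` to the boundary writes `U z` as a normal
  -- derivative, close to `φ₀`, times the length `t`; and `t` agrees with `ρ z` up to a factor close
  -- to `1`.
  obtain ⟨ξ, hξ, hξe⟩ := exists_hasDerivAt_eq_slope _ _ ht0 hUc hUd
  rw [hx0, h0 _ ⟨hq, hb3 (hx t ht)⟩, sub_zero, zero_sub, eq_div_iff ht0.ne'] at hξe
  have hFξ := hlim' (x ξ) ⟨hpos ξ ⟨hξ.1.le, hξ.2⟩, hb2 (hx ξ ⟨hξ.1.le, hξ.2.le.trans ht.2⟩)⟩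
  have hUz : U z = (F (x ξ) * n).re * t := by linarith
  have htρ : |ρ z - t| ≤ ε * t := by
    have h1 := hψ 0 h0T t ht
    rw [hx0, htz] at h1
    simpa [abs_of_pos ht0, sub_eq_add_neg] using h1
  have ht2 : t ≤ 2 * ρ z := by
    have := neg_le_of_abs_le htρ
    nlinarith
  have e : U z - φ₀ * ρ z = ((F (x ξ) * n).re - φ₀) * t - φ₀ * (ρ z - t) := by
    rw [hUz]
    ring
  rw [e]
  calc _ ≤ |((F (x ξ) * n).re - φ₀) * t| + |φ₀ * (ρ z - t)| := abs_sub _ _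
    _ ≤ ε * t + |φ₀| * (ε * t) := by
      rw [abs_mul, abs_mul, abs_of_pos ht0]
      gcongr
    _ = (1 + |φ₀|) * ε * t := by ring
    _ ≤ (1 + |φ₀|) * ε * (2 * ρ z) := by gcongr
    _ = _ := by ring

/-- A function harmonic in `Ω`, with vanishing boundary values and with continuous normal derivative
at a boundary point, has continuous gradient there. -/
theorem IsDefiningAt.tendsto_gradient {Ω : Set ℂ} {p n : ℂ} {ρ : ℂ → ℝ} (h : IsDefiningAt Ω p n ρ)
    (hΩ : IsOpen Ω) {V : Set ℂ} (hV : V ∈ 𝓝 p) {U : ℂ → ℝ} {F : ℂ → ℂ}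
    (hF : ∀ z ∈ Ω ∩ V, DifferentiableAt ℂ F z)
    (hU : ∀ z ∈ Ω ∩ V, HasFDerivAt U
      (Complex.reCLM.comp ((ContinuousLinearMap.mul ℂ ℂ (F z)).restrictScalars ℝ)) z)
    (hcont : ContinuousOn U (closure Ω ∩ V)) (h0 : ∀ z ∈ frontier Ω ∩ V, U z = 0) {φ₀ : ℝ}
    (hlim : Tendsto (fun z => (F z * n).re) (𝓝[Ω] p) (𝓝 φ₀)) :
    Tendsto F (𝓝[Ω] p) (𝓝 (φ₀ * conj n)) := by
  set B : ℝ := 20 * Real.exp 2 * (1 + |φ₀|)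
  have hB : 0 < B := by positivity
  have key : ∀ ε > 0, ε ≤ 1 / 4 → ∀ᶠ z in 𝓝[Ω] p, ‖F z - φ₀ * conj n‖ ≤ B * ε := by
    intro ε hε hε4
    obtain ⟨δ₁, hδ₁, happ, hmem⟩ := h.exists_radius hε
    obtain ⟨δ₂, hδ₂, hUρ⟩ := h.abs_sub_le hΩ hV hU hcont h0 hlim hε hε4
    obtain ⟨δ₃, hδ₃, hV'⟩ := Metric.mem_nhds_iff.1 hV
    set δ₀ := min δ₁ (min δ₂ δ₃)
    have hδ₀ : 0 < δ₀ := lt_min hδ₁ (lt_min hδ₂ hδ₃)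
    have hb1 : Metric.ball p δ₀ ⊆ Metric.ball p δ₁ := Metric.ball_subset_ball (min_le_left _ _)
    have hb2 : Metric.ball p δ₀ ⊆ Metric.ball p δ₂ :=
      Metric.ball_subset_ball ((min_le_right _ _).trans (min_le_left _ _))
    have hb3 : Metric.ball p δ₀ ⊆ V :=
      (Metric.ball_subset_ball ((min_le_right _ _).trans (min_le_right _ _))).trans hV'
    filter_upwards [self_mem_nhdsWithin,
      mem_nhdsWithin_of_mem_nhds (Metric.ball_mem_nhds p (half_pos hδ₀))] with z₀ hz₀ hz₀δ
    have hz₀p : ‖z₀ - p‖ < δ₀ / 2 := by rwa [mem_ball_iff_norm] at hz₀δ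
    have hz₀' : z₀ ∈ Metric.ball p δ₀ := Metric.ball_subset_ball (by linarith) hz₀δ
    have hρ : 0 < ρ z₀ := (hmem z₀ (hb1 hz₀')).1 hz₀
    have hρz' : ρ z₀ ≤ (1 + ε) * ‖z₀ - p‖ := by
      have h1 := happ z₀ (hb1 hz₀') p (Metric.mem_ball_self hδ₁)
      rw [h.zero, sub_zero] at h1
      have h2 : (conj n * (z₀ - p)).re ≤ ‖z₀ - p‖ :=
        (Complex.re_le_norm _).trans_eq (h.norm_conj_mul _)
      linarith [le_of_abs_le h1]
    -- Comparable to the distance to the boundary, yet small enough for the ball to stay in `Ω`.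
    set R := ρ z₀ / 2
    have hR : 0 < R := by positivity
    have hball : ∀ z ∈ Metric.ball z₀ R, z ∈ Metric.ball p δ₀ := by
      intro z hz
      rw [mem_ball_iff_norm] at hz ⊢
      have : ‖z - p‖ ≤ ‖z - z₀‖ + ‖z₀ - p‖ := by
        simpa using norm_add_le (z - z₀) (z₀ - p)
      have : R = ρ z₀ / 2 := rfl
      nlinarith [norm_nonneg (z₀ - p)]
    have hest : ∀ z ∈ Metric.ball z₀ R, |ρ z - ρ z₀ - (conj n * (z - z₀)).re| ≤ ε * R ∧
        ‖z - z₀‖ < R := by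
      intro z hz
      have h1 := happ z (hb1 (hball z hz)) z₀ (hb1 hz₀')
      rw [mem_ball_iff_norm] at hz
      exact ⟨h1.trans (by gcongr), hz⟩
    have hρball : ∀ z ∈ Metric.ball z₀ R, 0 < ρ z ∧ ρ z ≤ 2 * ρ z₀ := by
      intro z hz
      obtain ⟨h1, h2⟩ := hest z hz
      have h3 : |(conj n * (z - z₀)).re| ≤ ‖z - z₀‖ :=
        (Complex.abs_re_le_norm _).trans_eq (h.norm_conj_mul _)
      have h4 := abs_le.1 h1
      have h5 := abs_le.1 h3
      have : R = ρ z₀ / 2 := rfl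
      constructor <;> nlinarith
    have hΩball : ∀ z ∈ Metric.ball z₀ R, z ∈ Ω ∩ V := fun z hz =>
      ⟨(hmem z (hb1 (hball z hz))).2 (hρball z hz).1, hb3 (hball z hz)⟩
    have hFd : DifferentiableOn ℂ F (Metric.ball z₀ R) := fun z hz =>
      (hF z (hΩball z hz)).differentiableWithinAt
    obtain ⟨W, hW₀, hW⟩ := hFd.isExactOn_ball.with_val_at z₀ (U z₀)
    have hz₀R : z₀ ∈ Metric.ball z₀ R := Metric.mem_ball_self hR
    have hWd : ∀ z ∈ Metric.ball z₀ R, HasFDerivAt (fun z => (W z).re)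
        (Complex.reCLM.comp ((ContinuousLinearMap.mul ℂ ℂ (F z)).restrictScalars ℝ)) z := by
      intro z hz
      have h2 := Complex.reCLM.hasFDerivAt.comp z ((hW z hz).hasFDerivAt.restrictScalars ℝ)
      refine h2.congr_fderiv ?_
      ext a
      simp [mul_comm]
    have hWU : ∀ z ∈ Metric.ball z₀ R, (W z).re = U z := by
      refine Metric.isOpen_ball.eqOn_of_fderiv_eq (𝕜 := ℝ) (convex_ball _ _).isPreconnected
        (fun z hz => (hWd z hz).differentiableAt.differentiableWithinAt)
        (fun z hz => (hU z (hΩball z hz)).differentiableAt.differentiableWithinAt)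
        (fun z hz => ?_) hz₀R (by simp [hW₀])
      rw [(hWd z hz).fderiv, (hU z (hΩball z hz)).fderiv]
    -- Subtracting the affine approximation of `φ₀ρ` leaves a real part of size `ε · ρ z₀` on a ball
    -- of radius `ρ z₀ / 2`, so the interior estimate bounds `F z₀ - φ₀ conj n` by a multiple of
    -- `ε`. Control of the normal derivative thereby becomes control of the full gradient.
    let G : ℂ → ℂ := fun z => W z - φ₀ * (ρ z₀ + conj n * (z - z₀))
    have hG : ∀ z ∈ Metric.ball z₀ R, HasDerivAt G (F z - φ₀ * conj n) z := by
      intro z hz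
      have h1 : HasDerivAt (fun z => (φ₀ : ℂ) * (ρ z₀ + conj n * (z - z₀))) (φ₀ * (conj n * 1)) z :=
        ((((hasDerivAt_id z).sub_const z₀).const_mul (conj n)).const_add _).const_mul _
      rw [mul_one] at h1
      exact (hW z hz).sub h1
    have hM : ∀ z ∈ Metric.ball z₀ R, |(G z).re| ≤ 5 * (1 + |φ₀|) * ε * ρ z₀ := by
      intro z hz
      have e : (G z).re = (U z - φ₀ * ρ z) + φ₀ * (ρ z - ρ z₀ - (conj n * (z - z₀)).re) := by
        simp only [G, Complex.sub_re, hWU z hz, Complex.re_ofReal_mul, Complex.add_re,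
          Complex.ofReal_re]
        ring
      have h1 := hUρ z ⟨(hΩball z hz).1, hb2 (hball z hz)⟩
      have h2 := (hest z hz).1
      rw [e]
      calc _ ≤ |U z - φ₀ * ρ z| + |φ₀ * (ρ z - ρ z₀ - (conj n * (z - z₀)).re)| := abs_add_le _ _
        _ ≤ 2 * (1 + |φ₀|) * ε * ρ z + |φ₀| * (ε * R) := by
          rw [abs_mul]
          gcongr
        _ ≤ 2 * (1 + |φ₀|) * ε * (2 * ρ z₀) + (1 + |φ₀|) * (ε * ρ z₀) := by
          gcongr
          · exact (hρball z hz).2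
          · linarith
          · exact half_le_self hρ.le
        _ = _ := by ring
    have hgrad := Complex.norm_deriv_le_of_abs_re_le hR (by positivity)
      (fun z hz => (hG z hz).differentiableAt.differentiableWithinAt) hM
    rw [(hG z₀ hz₀R).deriv] at hgrad
    refine hgrad.trans_eq ?_
    simp only [R, B]
    field_simp
    ring
  rw [tendsto_iff_norm_sub_tendsto_zero, Metric.tendsto_nhds]
  intro η hη
  have h1 := key (min (1 / 4) (η / (2 * B))) (by positivity) (min_le_left _ _)
  filter_upwards [h1] with z hz
  rw [dist_zero_right, norm_norm]
  calc _ ≤ B * min (1 / 4) (η / (2 * B)) := hz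
    _ ≤ B * (η / (2 * B)) := by gcongr; exact min_le_right _ _
    _ = η / 2 := by field_simp
    _ < η := half_lt_self hη

/-! ### Boundary values of holomorphic functions with bounded derivative -/

theorem norm_sub_le_of_segment_subset {G G' : ℂ → ℂ} {a b : ℂ} {ε : ℝ}
    (h : ∀ x ∈ segment ℝ a b, HasDerivAt G (G' x) x ∧ ‖G' x‖ ≤ ε) :
    ‖G b - G a‖ ≤ ε * ‖b - a‖ :=
  (convex_segment a b).norm_image_sub_le_of_norm_hasDerivWithin_le
    (fun x hx => (h x hx).1.hasDerivWithinAt) (fun x hx => (h x hx).2)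
    (left_mem_segment ℝ a b) (right_mem_segment ℝ a b)

/-- A domain with a defining function is quasiconvex near the boundary point, so that a bound on the
derivative of a holomorphic function is a Lipschitz bound. -/
theorem IsDefiningAt.exists_norm_sub_le {Ω : Set ℂ} {p n : ℂ} {ρ : ℂ → ℝ}
    (h : IsDefiningAt Ω p n ρ) :
    ∃ r₁ > 0, ∀ r, 0 < r → r ≤ r₁ → ∀ (G G' : ℂ → ℂ) (ε : ℝ),
      (∀ x ∈ Ω ∩ Metric.ball p r, HasDerivAt G (G' x) x ∧ ‖G' x‖ ≤ ε) →
      ∀ z ∈ Ω ∩ Metric.ball p (r / 16), ∀ z' ∈ Ω ∩ Metric.ball p (r / 16),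
        ‖G z - G z'‖ ≤ 7 * ε * ‖z - z'‖ := by
  obtain ⟨r₁, hr₁, happ, hmem⟩ := h.exists_radius (show (0 : ℝ) < 1 / 4 by norm_num)
  refine ⟨r₁, hr₁, fun r hr hrr G G' ε hG z hz z' hz' => ?_⟩
  have hbr : Metric.ball p r ⊆ Metric.ball p r₁ := Metric.ball_subset_ball hrr
  set d := ‖z - z'‖
  have hd0 : 0 ≤ d := norm_nonneg _
  have hzp : ‖z - p‖ < r / 16 := mem_ball_iff_norm.1 hz.2
  have hzp' : ‖z' - p‖ < r / 16 := mem_ball_iff_norm.1 hz'.2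
  have hd : d < r / 8 := by
    have : d ≤ ‖z - p‖ + ‖z' - p‖ := by
      calc d = ‖(z - p) - (z' - p)‖ := by simp [d]
        _ ≤ _ := norm_sub_le _ _
    linarith
  -- Interior cone condition: a step whose component along `n` is at least a quarter of its length
  -- increases `ρ`, because `ρ` deviates from its linear part by at most that quarter.
  have hin : ∀ y ∈ Ω ∩ Metric.ball p (r / 16), ∀ v : ℂ, ‖v‖ ≤ 4 * d →
      1 / 4 * ‖v‖ ≤ (conj n * v).re → y + v ∈ Ω ∩ Metric.ball p r := by
    intro y hy v hv hre
    have hyp : ‖y - p‖ < r / 16 := mem_ball_iff_norm.1 hy.2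
    have hyr : y ∈ Metric.ball p r := by
      rw [mem_ball_iff_norm]
      linarith
    have hyv : y + v ∈ Metric.ball p r := by
      rw [mem_ball_iff_norm]
      calc ‖y + v - p‖ = ‖(y - p) + v‖ := by ring_nf
        _ ≤ ‖y - p‖ + ‖v‖ := norm_add_le _ _
        _ < r := by linarith
    refine ⟨(hmem _ (hbr hyv)).2 ?_, hyv⟩
    have h1 := happ _ (hbr hyv) y (hbr hyr)
    rw [add_sub_cancel_left] at h1
    have h2 := (hmem y (hbr hyr)).1 hy.1
    have h3 := neg_le_of_abs_le h1
    linarith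
  have hnt : ∀ t : ℝ, (conj n * ((t : ℂ) * n)).re = t := by
    intro t
    rw [show conj n * ((t : ℂ) * n) = conj n * n * t by ring, h.conj_mul_self, one_mul,
      Complex.ofReal_re]
  -- The path from `z` to `z'` climbs `3d` along `n`, crosses a distance `d`, and descends `3d`.
  -- This is the source of the factor `7 = 3 + 1 + 3`; at height `3d` the crossing keeps normal
  -- component at least `2d` and length at most `4d`, seen from `z'`.
  have hup : ∀ y ∈ Ω ∩ Metric.ball p (r / 16),
      ‖G (y + ((3 * d : ℝ) : ℂ) * n) - G y‖ ≤ ε * (3 * d) := by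
    intro y hy
    have := norm_sub_le_of_segment_subset (G := G) (G' := G') (a := y)
      (b := y + ((3 * d : ℝ) : ℂ) * n) (ε := ε) ?_
    · rwa [add_sub_cancel_left, norm_mul, h.norm_eq_one, mul_one, Complex.norm_real,
        Real.norm_of_nonneg (by positivity)] at this
    · intro x hx
      rw [segment_eq_image'] at hx
      obtain ⟨θ, hθ, rfl⟩ := hx
      refine hG _ ?_
      have e : θ • (y + ((3 * d : ℝ) : ℂ) * n - y) = ((θ * (3 * d) : ℝ) : ℂ) * n := by
        rw [add_sub_cancel_left, Complex.real_smul]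
        push_cast
        ring
      have hθd : 0 ≤ θ * (3 * d) := mul_nonneg hθ.1 (by positivity)
      have hnv : ‖((θ * (3 * d) : ℝ) : ℂ) * n‖ = θ * (3 * d) := by
        rw [norm_mul, h.norm_eq_one, mul_one, Complex.norm_real, Real.norm_of_nonneg hθd]
      change y + θ • (y + ((3 * d : ℝ) : ℂ) * n - y) ∈ _
      rw [e]
      refine hin y hy _ ?_ ?_
      · rw [hnv]
        nlinarith [hθ.2]
      · rw [hnv, hnt]
        linarith
  have hacross : ‖G (z + ((3 * d : ℝ) : ℂ) * n) - G (z' + ((3 * d : ℝ) : ℂ) * n)‖ ≤ ε * d := by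
    have := norm_sub_le_of_segment_subset (G := G) (G' := G') (a := z' + ((3 * d : ℝ) : ℂ) * n)
      (b := z + ((3 * d : ℝ) : ℂ) * n) (ε := ε) ?_
    · rwa [add_sub_add_right_eq_sub] at this
    · intro x hx
      rw [segment_eq_image'] at hx
      obtain ⟨θ, hθ, rfl⟩ := hx
      refine hG _ ?_
      have e : z' + ((3 * d : ℝ) : ℂ) * n + θ • (z + ((3 * d : ℝ) : ℂ) * n -
          (z' + ((3 * d : ℝ) : ℂ) * n)) = z' + (((3 * d : ℝ) : ℂ) * n + θ * (z - z')) := by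
        rw [add_sub_add_right_eq_sub, Complex.real_smul]
        ring
      change z' + ((3 * d : ℝ) : ℂ) * n + θ • (z + ((3 * d : ℝ) : ℂ) * n -
          (z' + ((3 * d : ℝ) : ℂ) * n)) ∈ _
      rw [e]
      have hθn : ‖(θ : ℂ) * (z - z')‖ ≤ d := by
        rw [norm_mul, Complex.norm_real, Real.norm_of_nonneg hθ.1]
        exact mul_le_of_le_one_left hd0 hθ.2
      have hn3 : ‖((3 * d : ℝ) : ℂ) * n‖ = 3 * d := by
        rw [norm_mul, h.norm_eq_one, mul_one, Complex.norm_real,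
          Real.norm_of_nonneg (by positivity)]
      have hnv : ‖((3 * d : ℝ) : ℂ) * n + θ * (z - z')‖ ≤ 4 * d := by
        refine (norm_add_le _ _).trans ?_
        rw [hn3]
        linarith
      refine hin z' hz' _ hnv ?_
      rw [mul_add, Complex.add_re, hnt]
      have h1 : -‖(θ : ℂ) * (z - z')‖ ≤ (conj n * ((θ : ℂ) * (z - z'))).re := by
        rw [← h.norm_conj_mul]
        exact neg_le_of_abs_le (Complex.abs_re_le_norm _)
      linarith
  have e : G z - G z' = -(G (z + ((3 * d : ℝ) : ℂ) * n) - G z) +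
      (G (z + ((3 * d : ℝ) : ℂ) * n) - G (z' + ((3 * d : ℝ) : ℂ) * n)) +
      (G (z' + ((3 * d : ℝ) : ℂ) * n) - G z') := by ring
  rw [e]
  refine (norm_add₃_le).trans ?_
  rw [norm_neg]
  have h1 := hup z hz
  have h2 := hup z' hz'
  linarith

/-- A holomorphic function with bounded derivative near a boundary point has a limit there. -/
theorem IsDefiningAt.exists_tendsto {Ω : Set ℂ} {p n : ℂ} {ρ : ℂ → ℝ} (h : IsDefiningAt Ω p n ρ)
    (hΩ : IsOpen Ω) {f : ℂ → ℂ} (hf : DifferentiableOn ℂ f Ω) {K : ℝ}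
    (hK : ∀ᶠ z in 𝓝[Ω] p, ‖deriv f z‖ ≤ K) : ∃ l, Tendsto f (𝓝[Ω] p) (𝓝 l) := by
  obtain ⟨r₁, hr₁, hqc⟩ := h.exists_norm_sub_le
  rw [eventually_nhdsWithin_iff, Metric.eventually_nhds_iff] at hK
  obtain ⟨δ, hδ, hK⟩ := hK
  set r := min r₁ δ
  have hr : 0 < r := lt_min hr₁ hδ
  have hlip := hqc r hr (min_le_left _ _) f (deriv f) K fun x hx =>
    ⟨(hf.differentiableAt (hΩ.mem_nhds hx.1)).hasDerivAt,
      hK (lt_of_lt_of_le hx.2 (min_le_right _ _)) hx.1⟩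
  have hlip' : LipschitzOnWith (7 * K).toNNReal f (Ω ∩ Metric.ball p (r / 16)) := by
    refine LipschitzOnWith.of_dist_le_mul fun z hz z' hz' => ?_
    rw [dist_eq_norm, dist_eq_norm]
    exact (hlip z hz z' hz').trans (by gcongr; exact Real.le_coe_toNNReal _)
  obtain ⟨g, hg, hfg⟩ := hlip'.extend_finite_dimension
  refine ⟨g p, ((hg.continuous.tendsto p).mono_left nhdsWithin_le_nhds).congr' ?_⟩
  filter_upwards [self_mem_nhdsWithin,
    mem_nhdsWithin_of_mem_nhds (Metric.ball_mem_nhds p (by positivity : 0 < r / 16))] with z hz hz'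
  exact (hfg ⟨hz, hz'⟩).symm

/-- If the derivative of a holomorphic function has a limit at a boundary point, then its boundary
values are differentiable there. -/
theorem IsDefiningAt.hasDerivAt_boundary {Ω : Set ℂ} {n : ℂ} {ρ : ℂ → ℝ} {γ : ℝ → ℂ} {s : ℝ} {τ : ℂ}
    (h : IsDefiningAt Ω (γ s) n ρ) (hΩ : IsOpen Ω) {f : ℂ → ℂ} (hf : DifferentiableOn ℂ f Ω)
    {E : ℂ} (hE : Tendsto (deriv f) (𝓝[Ω] (γ s)) (𝓝 E)) (hγ : HasDerivAt γ τ s)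
    (hcl : ∀ t, γ t ∈ closure Ω) {a : ℝ → ℂ} (ha : ∀ t, Tendsto f (𝓝[Ω] (γ t)) (𝓝 (a t))) :
    HasDerivAt a (E * τ) s := by
  obtain ⟨r₁, hr₁, hqc⟩ := h.exists_norm_sub_le
  have hlo : (fun t => a t - a s - E * (γ t - γ s)) =o[𝓝 s] fun t => γ t - γ s := by
    rw [Asymptotics.isLittleO_iff]
    intro ε hε
    have h1 := Metric.tendsto_nhds.1 hE (ε / 7) (by positivity)
    rw [eventually_nhdsWithin_iff, Metric.eventually_nhds_iff] at h1
    obtain ⟨δ, hδ, h1⟩ := h1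
    set r := min r₁ δ
    have hr : 0 < r := lt_min hr₁ hδ
    -- After the limit `E` of the derivative is removed, the Lipschitz constant is `7 · ε/7 = ε`;
    -- the estimate persists when both points tend to the boundary.
    have hlip := hqc r hr (min_le_left _ _) (fun z => f z - E * z) (fun z => deriv f z - E) (ε / 7)
      fun x hx => by
        refine ⟨(hf.differentiableAt (hΩ.mem_nhds hx.1)).hasDerivAt.sub ?_, ?_⟩
        · simpa using (hasDerivAt_id x).const_mul E
        · exact (dist_eq_norm (deriv f x) E ▸
            h1 (lt_of_lt_of_le hx.2 (min_le_right _ _)) hx.1).le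
    have hball : Metric.ball (γ s) (r / 16) ∈ 𝓝 (γ s) := Metric.ball_mem_nhds _ (by positivity)
    filter_upwards [hγ.continuousAt hball] with t ht
    have hne1 : (𝓝[Ω] (γ t)).NeBot := mem_closure_iff_nhdsWithin_neBot.1 (hcl t)
    have hne2 : (𝓝[Ω] (γ s)).NeBot := mem_closure_iff_nhdsWithin_neBot.1 (hcl s)
    have hT : Tendsto (fun q : ℂ × ℂ => ‖f q.1 - f q.2 - E * (q.1 - q.2)‖ - ε * ‖q.1 - q.2‖)
        (𝓝[Ω] (γ t) ×ˢ 𝓝[Ω] (γ s))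
        (𝓝 (‖a t - a s - E * (γ t - γ s)‖ - ε * ‖γ t - γ s‖)) := by
      have i1 : Tendsto (fun q : ℂ × ℂ => q.1) (𝓝[Ω] (γ t) ×ˢ 𝓝[Ω] (γ s)) (𝓝 (γ t)) :=
        tendsto_fst.mono_right nhdsWithin_le_nhds
      have i2 : Tendsto (fun q : ℂ × ℂ => q.2) (𝓝[Ω] (γ t) ×ˢ 𝓝[Ω] (γ s)) (𝓝 (γ s)) :=
        tendsto_snd.mono_right nhdsWithin_le_nhds
      exact (((((ha t).comp tendsto_fst).sub ((ha s).comp tendsto_snd)).sub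
        ((i1.sub i2).const_mul E)).norm).sub ((i1.sub i2).norm.const_mul ε)
    have := le_of_tendsto hT (b := 0) ?_
    · linarith
    · have m1 : Ω ∩ Metric.ball (γ s) (r / 16) ∈ 𝓝[Ω] (γ t) :=
        inter_mem self_mem_nhdsWithin (mem_nhdsWithin_of_mem_nhds (Metric.isOpen_ball.mem_nhds ht))
      have m2 : Ω ∩ Metric.ball (γ s) (r / 16) ∈ 𝓝[Ω] (γ s) :=
        inter_mem self_mem_nhdsWithin (mem_nhdsWithin_of_mem_nhds hball)
      filter_upwards [prod_mem_prod m1 m2] with q hq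
      have := hlip q.1 hq.1 q.2 hq.2
      rw [show f q.1 - E * q.1 - (f q.2 - E * q.2) = f q.1 - f q.2 - E * (q.1 - q.2) by ring,
        mul_div_cancel₀ ε (by norm_num : (7 : ℝ) ≠ 0)] at this
      linarith
  rw [hasDerivAt_iff_isLittleO]
  have h1 := hlo.trans_isBigO hγ.isBigO_sub
  have h2 := (hasDerivAt_iff_isLittleO.1 hγ).const_mul_left E
  refine (h1.add h2).congr_left fun t => ?_
  rw [Complex.real_smul, Complex.real_smul]
  ring

/-! ### Hopf's lemma by a conformal barrier -/

/-- A consequence of the Schwarz–Pick lemma: a holomorphic self-map of the unit disc does not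
increase the distance to the circle by more than a constant factor. -/
theorem Complex.exists_mul_one_sub_norm_le {f : ℂ → ℂ}
    (hf : DifferentiableOn ℂ f (Metric.ball 0 1)) (hmaps : MapsTo f (Metric.ball 0 1)
      (Metric.ball 0 1)) :
    ∃ c > 0, ∀ w ∈ Metric.ball (0 : ℂ) 1, c * (1 - ‖w‖) ≤ 1 - ‖f w‖ := by
  set a := f 0
  have ha : ‖a‖ < 1 := by simpa using hmaps (Metric.mem_ball_self one_pos)
  have hid : ∀ x : ℂ, ‖1 - conj a * x‖ ^ 2 - ‖x - a‖ ^ 2 = (1 - ‖a‖ ^ 2) * (1 - ‖x‖ ^ 2) := by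
    intro x
    simp only [Complex.sq_norm, Complex.normSq_apply, Complex.sub_re, Complex.sub_im, Complex.mul_re,
      Complex.mul_im, Complex.conj_re, Complex.conj_im, Complex.one_re, Complex.one_im]
    ring
  have hlow : ∀ x : ℂ, ‖x‖ < 1 → 1 - ‖a‖ ≤ ‖1 - conj a * x‖ := by
    intro x hx
    have h1 := norm_sub_norm_le (1 : ℂ) (conj a * x)
    rw [norm_one, norm_mul, RCLike.norm_conj] at h1
    nlinarith [norm_nonneg a]
  have hne : ∀ x : ℂ, ‖x‖ < 1 → 1 - conj a * x ≠ 0 := fun x hx => by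
    rw [← norm_pos_iff]
    linarith [hlow x hx]
  -- A Möbius map moves `f 0` to the origin so that the Schwarz lemma applies; `hid` converts the
  -- result back to a bound on `1 - |f w|`.
  let G : ℂ → ℂ := fun w => (f w - a) / (1 - conj a * f w)
  have hnf : ∀ w ∈ Metric.ball (0 : ℂ) 1, ‖f w‖ < 1 := fun w hw => by simpa using hmaps hw
  have hG : DifferentiableOn ℂ G (Metric.ball 0 1) :=
    (hf.sub_const a).div ((hf.const_mul _).const_sub 1) fun w hw => hne _ (hnf w hw)
  have hGm : MapsTo G (Metric.ball 0 1) (Metric.closedBall 0 1) := by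
    intro w hw
    have h1 := hnf w hw
    rw [mem_closedBall_zero_iff, norm_div, div_le_one (norm_pos_iff.2 (hne _ h1))]
    refine le_of_sq_le_sq ?_ (norm_nonneg _)
    have := hid (f w)
    have : 0 ≤ (1 - ‖a‖ ^ 2) * (1 - ‖f w‖ ^ 2) :=
      mul_nonneg (by nlinarith [norm_nonneg a]) (by nlinarith [norm_nonneg (f w)])
    linarith
  refine ⟨(1 - ‖a‖) ^ 2 / 2, by have : 0 < 1 - ‖a‖ := by linarith
                                positivity, fun w hw => ?_⟩
  have h1 := hnf w hw
  have hw1 : ‖w‖ < 1 := by simpa using hw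
  have h2 : ‖G w‖ ≤ ‖w‖ := Complex.norm_le_norm_of_mapsTo_ball hG hGm (by simp [G, a]) hw1
  rw [norm_div, div_le_iff₀ (norm_pos_iff.2 (hne _ h1))] at h2
  have h3 := hid (f w)
  have h4 := hlow _ h1
  have h5 : ‖f w - a‖ ^ 2 ≤ ‖w‖ ^ 2 * ‖1 - conj a * f w‖ ^ 2 := by
    rw [← mul_pow]
    gcongr
  have h6 : (1 - ‖a‖) ^ 2 ≤ ‖1 - conj a * f w‖ ^ 2 := by
    have : 0 ≤ 1 - ‖a‖ := by linarith
    gcongr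
  have h7 : (1 - ‖w‖ ^ 2) * (1 - ‖a‖) ^ 2 ≤ 1 - ‖f w‖ ^ 2 := by
    calc (1 - ‖w‖ ^ 2) * (1 - ‖a‖) ^ 2 ≤ (1 - ‖w‖ ^ 2) * ‖1 - conj a * f w‖ ^ 2 := by
          gcongr
          nlinarith [norm_nonneg w]
      _ ≤ (1 - ‖a‖ ^ 2) * (1 - ‖f w‖ ^ 2) := by linarith
      _ ≤ 1 * (1 - ‖f w‖ ^ 2) := by
          gcongr
          · nlinarith [norm_nonneg (f w)]
          · nlinarith [norm_nonneg a]
      _ = _ := one_mul _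
  have h8 : (1 - ‖w‖) * (1 - ‖a‖) ^ 2 ≤ (1 - ‖w‖ ^ 2) * (1 - ‖a‖) ^ 2 := by
    gcongr
    nlinarith [norm_nonneg w]
  nlinarith [norm_nonneg (f w)]

/-- For suitable `K`, the map `ω ↦ ω - K ω^(1+α)` sends small points of the right half-plane into
the region above the graph of `C |·|^(1+α)`. -/
theorem exists_cpow_bend {α C : ℝ} (hα : 0 < α) (hα₁ : α ≤ 1) (hC : 0 ≤ C) :
    ∃ K : ℝ, 0 ≤ K ∧ ∃ r > 0, ∀ ω : ℂ, 0 < ω.re → ‖ω‖ < r →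
      ‖ω - K * ω ^ ((1 + α : ℝ) : ℂ)‖ ≤ 2 * ‖ω‖ ∧
      C * (‖ω - K * ω ^ ((1 + α : ℝ) : ℂ)‖ ^ α * ‖ω - K * ω ^ ((1 + α : ℝ) : ℂ)‖) <
        (ω - K * ω ^ ((1 + α : ℝ) : ℂ)).re := by
  have hpi := Real.pi_pos
  set σ := Real.sin (α * (Real.pi / 4))
  have hσ : 0 < σ := Real.sin_pos_of_pos_of_lt_pi (by positivity) (by nlinarith)
  -- With `q = |ω|^α`, the bound `|χ| ≤ 2|ω|` makes the left side at most `4Cq|ω|`. For `|arg ω| ≥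
  -- π/4` the bend gains at least `Kσq/2` times `|ω|`, and this `K` makes the gain exactly `4Cq|ω|`.
  set K := 8 * C / σ
  have hK : 0 ≤ K := by positivity
  have hKσ : K * σ = 8 * C := div_mul_cancel₀ _ hσ.ne'
  -- Ensures `(4C + K)q < 1/2`, which settles the directions with `|arg ω| ≤ π/4`, where `cos (arg
  -- ω) ≥ 1/2`.
  set q₀ := 1 / (2 * (4 * C + K + 1))
  have hq₀ : 0 < q₀ := by positivity
  refine ⟨K, hK, q₀ ^ (1 / α), by positivity, fun ω hω hωr => ?_⟩
  have hω0 : ω ≠ 0 := by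
    rintro rfl
    simp at hω
  set R := ‖ω‖
  have hR : 0 < R := norm_pos_iff.2 hω0
  set q := R ^ α
  have hq : 0 < q := by positivity
  have hqq : q < q₀ := by
    have := Real.rpow_lt_rpow hR.le hωr hα
    rwa [← Real.rpow_mul hq₀.le, one_div_mul_cancel hα.ne', Real.rpow_one] at this
  have hq1 : q * (2 * (4 * C + K + 1)) < 1 := by
    rwa [lt_div_iff₀ (by positivity)] at hqq
  have hRq : R ^ (1 + α) = R * q := by rw [Real.rpow_add hR, Real.rpow_one]
  set χ := ω - K * ω ^ ((1 + α : ℝ) : ℂ)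
  have hKq : K * q ≤ 1 := by nlinarith
  have hcn : ‖ω ^ ((1 + α : ℝ) : ℂ)‖ = R * q := by
    rw [Complex.norm_cpow_real, hRq]
  have hχn : ‖χ‖ ≤ 2 * R := by
    calc ‖χ‖ ≤ ‖ω‖ + ‖(K : ℂ) * ω ^ ((1 + α : ℝ) : ℂ)‖ := norm_sub_le _ _
      _ = R + K * (R * q) := by rw [norm_mul, hcn, Complex.norm_real, Real.norm_of_nonneg hK]
      _ ≤ 2 * R := by nlinarith
  refine ⟨hχn, ?_⟩
  have h1 : C * (‖χ‖ ^ α * ‖χ‖) ≤ R * (4 * C * q) := by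
    calc C * (‖χ‖ ^ α * ‖χ‖) ≤ C * ((2 * R) ^ α * (2 * R)) := by gcongr
      _ = C * ((2 : ℝ) ^ α * q * (2 * R)) := by rw [Real.mul_rpow (by norm_num) hR.le]
      _ ≤ C * ((2 : ℝ) ^ (1 : ℝ) * q * (2 * R)) := by
        gcongr
        norm_num
      _ = R * (4 * C * q) := by rw [Real.rpow_one]; ring
  set η := |Complex.arg ω|
  have hη0 : 0 ≤ η := abs_nonneg _
  have hη2 : η ≤ Real.pi / 2 := Complex.abs_arg_le_pi_div_two_iff.2 hω.le
  have hre : χ.re = R * (Real.cos η - K * q * Real.cos ((1 + α) * η)) := by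
    have e1 : ω.re = R * Real.cos η := by
      rw [Real.cos_abs, Complex.norm_mul_cos_arg]
    have e2 : (ω ^ ((1 + α : ℝ) : ℂ)).re = R * q * Real.cos ((1 + α) * η) := by
      rw [Complex.cpow_ofReal_re, hRq, ← Real.cos_abs (Complex.arg ω * (1 + α)), abs_mul,
        abs_of_pos (by positivity : 0 < 1 + α), mul_comm (1 + α)]
    simp only [χ, Complex.sub_re, Complex.re_ofReal_mul, e1, e2]
    ring
  rw [hre]
  refine h1.trans_lt (mul_lt_mul_of_pos_left ?_ hR)
  have hcos : 0 < Real.cos η := by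
    have e1 : ω.re = R * Real.cos η := by
      rw [Real.cos_abs, Complex.norm_mul_cos_arg]
    rw [e1] at hω
    exact pos_of_mul_pos_right hω hR.le
  rcases le_total (Real.pi / 4) η with hη | hη
  · have hs1 : 1 / 2 ≤ Real.sin η := by
      have : Real.sin (Real.pi / 4) ≤ Real.sin η :=
        Real.sin_le_sin_of_le_of_le_pi_div_two (by linarith) hη2 hη
      rw [Real.sin_pi_div_four] at this
      have : (1 : ℝ) ≤ Real.sqrt 2 := Real.one_le_sqrt.2 (by norm_num)
      linarith
    have hs2 : σ ≤ Real.sin (α * η) :=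
      Real.sin_le_sin_of_le_of_le_pi_div_two (by nlinarith) (by nlinarith) (by nlinarith)
    -- Multiplying the argument by `1 + α` lowers the cosine by at least `sin η · sin(αη) ≥ σ/2`;
    -- near the imaginary axis this compensates for the small `cos η`.
    have hc : Real.cos ((1 + α) * η) ≤ Real.cos η - σ / 2 := by
      rw [show (1 + α) * η = η + α * η by ring, Real.cos_add]
      have := Real.cos_le_one (α * η)
      nlinarith
    have hcc := mul_le_mul_of_nonneg_left hc (mul_nonneg hK hq.le)
    have : K * q < 1 := by nlinarith
    nlinarith
  · have hc1 : 1 / 2 ≤ Real.cos η := by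
      have : Real.cos (Real.pi / 4) ≤ Real.cos η :=
        Real.cos_le_cos_of_nonneg_of_le_pi hη0 (by linarith) hη
      rw [Real.cos_pi_div_four] at this
      have : (1 : ℝ) ≤ Real.sqrt 2 := Real.one_le_sqrt.2 (by norm_num)
      linarith
    have hc2 := mul_le_mul_of_nonneg_left (Real.cos_le_one ((1 + α) * η)) (mul_nonneg hK hq.le)
    nlinarith

/-- Hopf's lemma for the Green's function of a domain of class `C^{1,α}`. -/
theorem IsDefiningAt.normal_derivative_pos {Ω : Set ℂ} {p n : ℂ} {ρ : ℂ → ℝ}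
    (h : IsDefiningAt Ω p n ρ) (hΩ : IsOpen Ω) {α C : ℝ} (hα : 0 < α) (hα₁ : α ≤ 1) (hC : 0 ≤ C)
    (hρ : ∀ z, |ρ z - (conj n * (z - p)).re| ≤ C * (‖z - p‖ ^ α * ‖z - p‖))
    {V : Set ℂ} (hV : V ∈ 𝓝 p) {U : ℂ → ℝ} {F f : ℂ → ℂ}
    (hU : ∀ z ∈ Ω ∩ V, HasFDerivAt U
      (Complex.reCLM.comp ((ContinuousLinearMap.mul ℂ ℂ (F z)).restrictScalars ℝ)) z)
    (hcont : ContinuousOn U (closure Ω ∩ V)) (h0 : ∀ z ∈ frontier Ω ∩ V, U z = 0) {φ₀ : ℝ}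
    (hlim : Tendsto (fun z => (F z * n).re) (𝓝[Ω] p) (𝓝 φ₀))
    (hf : DifferentiableOn ℂ f Ω) (hf1 : ∀ z ∈ Ω, ‖f z‖ < 1)
    (hUf : ∀ z ∈ Ω ∩ V, f z ≠ 0 ∧ U z = -(1 / (2 * Real.pi)) * Real.log ‖f z‖) : 0 < φ₀ := by
  obtain ⟨K, hK, r, hr, hbend⟩ := exists_cpow_bend hα hα₁ hC
  obtain ⟨δ, hδ, hmem⟩ := h.mem_iff
  set χ : ℂ → ℂ := fun ω => ω - K * ω ^ ((1 + α : ℝ) : ℂ)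
  set R := min (r / 2) (δ / 4)
  have hR : 0 < R := lt_min (by positivity) (by positivity)
  have hRr : 2 * R ≤ r := by have := min_le_left (r / 2) (δ / 4); linarith
  have hRδ : 4 * R ≤ δ := by have := min_le_right (r / 2) (δ / 4); linarith
  have hχΩ : ∀ ω : ℂ, 0 < ω.re → ‖ω‖ < 2 * R → p + n * χ ω ∈ Ω := by
    intro ω hω hωR
    obtain ⟨h1, h2⟩ := hbend ω hω (hωR.trans_le hRr)
    have hn : ‖n * χ ω‖ = ‖χ ω‖ := by rw [norm_mul, h.norm_eq_one, one_mul]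
    have h3 := hρ (p + n * χ ω)
    rw [add_sub_cancel_left, hn, ← mul_assoc, h.conj_mul_self, one_mul] at h3
    refine (hmem _ ?_).2 ?_
    · rw [mem_ball_iff_norm, add_sub_cancel_left, hn]
      exact h1.trans_lt (by linarith)
    · have h4 := neg_le_of_abs_le h3
      change C * (‖χ ω‖ ^ α * ‖χ ω‖) < (χ ω).re at h2
      linarith
  have hhalf : ∀ w ∈ Metric.ball (0 : ℂ) 1, 0 < ((R : ℂ) + R * w).re ∧ ‖(R : ℂ) + R * w‖ < 2 * R := by
    intro w hw
    have hw1 : ‖w‖ < 1 := by simpa using hw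
    constructor
    · have := neg_le_of_abs_le (Complex.abs_re_le_norm w)
      simp only [Complex.add_re, Complex.ofReal_re, Complex.re_ofReal_mul]
      nlinarith
    · calc ‖(R : ℂ) + R * w‖ ≤ ‖(R : ℂ)‖ + ‖(R : ℂ) * w‖ := norm_add_le _ _
        _ = R + R * ‖w‖ := by rw [norm_mul, Complex.norm_real, Real.norm_of_nonneg hR.le]
        _ < 2 * R := by nlinarith
  -- The disc of centre `R` and radius `R` touches the imaginary axis at `0`, and the bend carries
  -- it into `Ω` with `0` sent to `p`. Schwarz–Pick for the pulled-back `f` gives `1 - |f| ≥ c t /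
  -- R` at the image of real `t`, so `U` grows at least linearly away from `p`.
  obtain ⟨c, hc, hsp⟩ := Complex.exists_mul_one_sub_norm_le
    (f := fun w => f (p + n * χ ((R : ℂ) + R * w))) (by
      refine hf.comp ?_ fun w hw => hχΩ _ (hhalf w hw).1 (hhalf w hw).2
      intro w hw
      have hd : DifferentiableAt ℂ (fun w : ℂ => (R : ℂ) + R * w) w := by fun_prop
      have hd2 : DifferentiableAt ℂ (fun w : ℂ => ((R : ℂ) + R * w) ^ ((1 + α : ℝ) : ℂ)) w :=
        hd.cpow_const (Or.inl (hhalf w hw).1)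
      exact (((hd.sub (hd2.const_mul _)).const_mul n).const_add p).differentiableWithinAt)
    (fun w hw => by
      simpa using hf1 _ (hχΩ _ (hhalf w hw).1 (hhalf w hw).2))
  by_contra! hφ
  set c' := c / (2 * Real.pi * R)
  have hpi := Real.pi_pos
  have hc' : 0 < c' := by positivity
  -- If `φ₀ ≤ 0`, then `U ≤ 2(1 + |φ₀|)ερ` with `ρ ≤ 3t`; this `ε` makes that at most `(3/4) c' t`,
  -- contradicting `U ≥ c' t`.
  set ε := min (1 / 4) (c' / (8 * (1 + |φ₀|)))
  have hε : 0 < ε := lt_min (by norm_num) (by positivity)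
  have hε4 : ε ≤ 1 / 4 := min_le_left _ _
  have hεc : 8 * (1 + |φ₀|) * ε ≤ c' := by
    have := min_le_right (1 / 4) (c' / (8 * (1 + |φ₀|)))
    rwa [le_div_iff₀ (by positivity), mul_comm] at this
  obtain ⟨δ₁, hδ₁, hUρ⟩ := h.abs_sub_le hΩ hV hU hcont h0 hlim hε hε4
  obtain ⟨δ₂, hδ₂, happ⟩ := h.approx ε hε
  obtain ⟨δ₃, hδ₃, hV'⟩ := Metric.mem_nhds_iff.1 hV
  obtain ⟨t, ht0, ht⟩ := exists_between (show 0 < min R (min (δ₁ / 2) (min (δ₂ / 2) (δ₃ / 2))) by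
    positivity)
  simp only [lt_min_iff] at ht
  obtain ⟨htR, ht1, ht2, ht3⟩ := ht
  have htre : 0 < (t : ℂ).re := by simpa using ht0
  have htn : ‖(t : ℂ)‖ = t := by rw [Complex.norm_real, Real.norm_of_nonneg ht0.le]
  have htΩ := hχΩ t htre (by rw [htn]; linarith)
  set z := p + n * χ t
  have hχt := (hbend t htre (by rw [htn]; linarith)).1
  change ‖χ t‖ ≤ _ at hχt
  rw [htn] at hχt
  have hzp : ‖z - p‖ = ‖χ t‖ := by
    simp only [z]
    rw [add_sub_cancel_left, norm_mul, h.norm_eq_one, one_mul]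
  have hlow : c' * t ≤ U z := by
    obtain ⟨hfz, hUz⟩ := hUf z ⟨htΩ, hV' (by rw [mem_ball_iff_norm, hzp]; linarith)⟩
    have hw : ‖((t - R) / R : ℂ)‖ = 1 - t / R := by
      rw [← Complex.ofReal_sub, ← Complex.ofReal_div, Complex.norm_real, Real.norm_eq_abs,
        abs_div, abs_of_pos hR, abs_of_neg (by linarith)]
      field_simp
      ring
    have h1 := hsp ((t - R) / R) (by
      rw [mem_ball_zero_iff, hw]
      have : 0 < t / R := by positivity
      linarith)
    have e1 : (R : ℂ) + R * ((t - R) / R) = t := by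
      have : (R : ℂ) ≠ 0 := by exact_mod_cast hR.ne'
      field_simp
      ring
    rw [e1, hw] at h1
    have h2 := Real.log_le_sub_one_of_pos (norm_pos_iff.2 hfz)
    rw [hUz]
    change c * (1 - (1 - t / R)) ≤ 1 - ‖f z‖ at h1
    have h3 : c * (t / R) ≤ -Real.log ‖f z‖ := by linarith
    calc c' * t = 1 / (2 * Real.pi) * (c * (t / R)) := by simp only [c']; field_simp
      _ ≤ 1 / (2 * Real.pi) * -Real.log ‖f z‖ := by gcongr
      _ = _ := by ring
  have hup := le_of_abs_le (hUρ z ⟨htΩ, by rw [mem_ball_iff_norm, hzp]; linarith⟩)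
  have hρpos : 0 < ρ z := (hmem z (by rw [mem_ball_iff_norm, hzp]; linarith)).1 htΩ
  have hρz : ρ z ≤ 4 * t - 2 * t * (1 - 2 * ε) := by
    have h1 := happ z (by rw [mem_ball_iff_norm, hzp]; linarith) p (Metric.mem_ball_self hδ₂)
    rw [h.zero, sub_zero, hzp] at h1
    have h2 : (conj n * (z - p)).re ≤ ‖χ t‖ :=
      (Complex.re_le_norm _).trans_eq ((h.norm_conj_mul _).trans hzp)
    nlinarith [le_of_abs_le h1]
  have h1 : φ₀ * ρ z ≤ 0 := mul_nonpos_of_nonpos_of_nonneg hφ hρpos.le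
  have h2 : 2 * (1 + |φ₀|) * ε * ρ z ≤ 2 * (1 + |φ₀|) * ε * (3 * t) := by
    gcongr
    nlinarith
  have h3 : 2 * (1 + |φ₀|) * ε * (3 * t) ≤ (3 / 4) * (c' * t) := by
    have := mul_le_mul_of_nonneg_right hεc ht0.le
    linarith
  have : 0 < c' * t := by positivity
  linarith

/-! ### The conformal map on the boundary -/

theorem IsBoundaryParam.mem_frontier {Ω : Set ℂ} {b : ℂ} {L : ℝ} {γ : ℝ → ℂ}
    (hγ : IsBoundaryParam Ω b L γ) (s : ℝ) : γ s ∈ frontier Ω :=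
  hγ.range_eq ▸ mem_range_self s

theorem IsBoundaryParam.neBot {Ω : Set ℂ} {b : ℂ} {L : ℝ} {γ : ℝ → ℂ}
    (hγ : IsBoundaryParam Ω b L γ) (s : ℝ) : (𝓝[Ω] (γ s)).NeBot :=
  mem_closure_iff_nhdsWithin_neBot.1 (frontier_subset_closure (hγ.mem_frontier s))

theorem IsBoundaryParam.hasDerivAt {Ω : Set ℂ} {b : ℂ} {L : ℝ} {γ : ℝ → ℂ}
    (hγ : IsBoundaryParam Ω b L γ) (s : ℝ) : HasDerivAt γ (deriv γ s) s :=
  (hγ.contDiff.differentiable one_ne_zero s).hasDerivAt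

theorem IsBoundaryParam.conj_mul_deriv {Ω : Set ℂ} {b : ℂ} {L : ℝ} {γ : ℝ → ℂ}
    (hγ : IsBoundaryParam Ω b L γ) (s : ℝ) : conj (deriv γ s) * deriv γ s = 1 := by
  rw [Complex.conj_mul', hγ.unit_speed]
  simp

/-- The conformal map associated with the Green's function has a continuous nonvanishing logarithmic
derivative up to the boundary. -/
theorem IsGreenFunction.exists_conformal {α : ℝ≥0} (hα₀ : 0 < α) (hα₁ : α < 1) {Ω : Set ℂ}
    {c b : ℂ} (hΩ : IsC1HolderDomain α Ω) (hc : c ∈ Ω) {L : ℝ} {γ : ℝ → ℂ}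
    (hγ : IsBoundaryParam Ω b L γ) {U : ℂ → ℝ} (hU : IsGreenFunction Ω c U) {φ : ℝ → ℝ}
    (hφ : IsNormalDerivative Ω γ U φ) :
    (∀ s, 0 < φ s) ∧ ∃ f : ℂ → ℂ, DifferentiableOn ℂ f Ω ∧ BijOn f Ω (Metric.ball 0 1) ∧
      (∀ z ∈ Ω, deriv f z ≠ 0) ∧ (∀ s, Tendsto (fun z => ‖f z‖) (𝓝[Ω] (γ s)) (𝓝 1)) ∧
      ∀ s, Tendsto (fun z => deriv f z / f z) (𝓝[Ω] (γ s))
        (𝓝 (2 * Real.pi * φ s * Complex.I * conj (deriv γ s))) := by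
  obtain ⟨f, hf, hbij, hd, hfc, hf1, hUf⟩ :=
    hU.exists_bijOn_ball hΩ.isOpen hΩ.isSimplyConnected hΩ.isBounded hc
  have hpi := Real.pi_pos
  have hf0 : ∀ z ∈ Ω ∩ {c}ᶜ, f z ≠ 0 := by
    rintro z ⟨hz, hzc⟩ h
    exact hzc (hbij.injOn hz hc (h.trans hfc.symm))
  -- The complex gradient of `U`, in the sense `dU = Re(F dz)`; it is holomorphic away from the
  -- pole.
  let F : ℂ → ℂ := fun z => -(1 / (2 * Real.pi) : ℝ) * (deriv f z / f z)
  have hopen : IsOpen (Ω ∩ {c}ᶜ) := hΩ.isOpen.inter isOpen_compl_singleton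
  have hfd : ∀ z ∈ Ω, HasDerivAt f (deriv f z) z := fun z hz =>
    (hf.differentiableAt (hΩ.isOpen.mem_nhds hz)).hasDerivAt
  have hUd : ∀ z ∈ Ω ∩ {c}ᶜ, HasFDerivAt U
      (Complex.reCLM.comp ((ContinuousLinearMap.mul ℂ ℂ (F z)).restrictScalars ℝ)) z := by
    intro z hz
    have h1 := ((hfd z hz.1).hasFDerivAt_log_norm (hf0 z hz)).const_mul (-(1 / (2 * Real.pi)))
    refine (h1.congr_of_eventuallyEq ?_).congr_fderiv ?_
    · filter_upwards [hopen.mem_nhds hz] with x hx using hUf x hx.1 hx.2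
    · ext v
      simp only [F, smul_apply, ContinuousLinearMap.comp_apply,
        ContinuousLinearMap.coe_restrictScalars', ContinuousLinearMap.mul_apply',
        Complex.reCLM_apply, smul_eq_mul]
      rw [mul_assoc, ← Complex.ofReal_neg, Complex.re_ofReal_mul]
  have hFd : ∀ z ∈ Ω ∩ {c}ᶜ, DifferentiableAt ℂ F z := by
    intro z hz
    have h1 : DifferentiableAt ℂ (deriv f) z :=
      (hf.deriv hΩ.isOpen).differentiableAt (hΩ.isOpen.mem_nhds hz.1)
    exact (h1.div (hfd z hz.1).differentiableAt (hf0 z hz)).const_mul _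
  have hmain : ∀ s, 0 < φ s ∧ Tendsto (fun z => deriv f z / f z) (𝓝[Ω] (γ s))
        (𝓝 (2 * Real.pi * φ s * Complex.I * conj (deriv γ s))) := by
    intro s
    have hp := hγ.mem_frontier s
    have hpc : γ s ≠ c := by
      rintro h
      rw [hΩ.isOpen.frontier_eq] at hp
      exact hp.2 (h ▸ hc)
    have hV : ({c}ᶜ : Set ℂ) ∈ 𝓝 (γ s) := isOpen_compl_singleton.mem_nhds hpc
    obtain ⟨n, ρ, hdef, C, hC, hρ⟩ := hΩ.exists_isDefiningAt hp
    have hn := hγ.normal_eq hΩ.isOpen hdef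
    have hcont : ContinuousOn U (closure Ω ∩ {c}ᶜ) := hU.continuousOn
    have h0 : ∀ z ∈ frontier Ω ∩ {c}ᶜ, U z = 0 := fun z hz => hU.boundary z hz.1
    have hlim : Tendsto (fun z => (F z * n).re) (𝓝[Ω] (γ s)) (𝓝 (φ s)) := by
      refine (hφ s).congr' ?_
      filter_upwards [self_mem_nhdsWithin, mem_nhdsWithin_of_mem_nhds hV] with z hz hz'
      rw [(hUd z ⟨hz, hz'⟩).fderiv, hn]
      rfl
    refine ⟨hdef.normal_derivative_pos hΩ.isOpen (α := (α : ℝ)) (by exact_mod_cast hα₀)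
      (by exact_mod_cast hα₁.le) hC hρ hV hUd hcont h0 hlim hf
      (fun z hz => by simpa using hbij.mapsTo hz)
      (fun z hz => ⟨hf0 z hz, hUf z hz.1 hz.2⟩), ?_⟩
    have h1 := (hdef.tendsto_gradient hΩ.isOpen hV hFd hUd hcont h0 hlim).const_mul
      (-(2 * Real.pi : ℝ) : ℂ)
    have hpi' : (Real.pi : ℂ) ≠ 0 := by exact_mod_cast hpi.ne'
    have e : (-(2 * Real.pi : ℝ) : ℂ) * (φ s * conj n) =
        2 * Real.pi * φ s * Complex.I * conj (deriv γ s) := by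
      rw [hn, map_mul, Complex.conj_I]
      push_cast
      ring
    rw [e] at h1
    refine h1.congr fun z => ?_
    simp only [F]
    push_cast
    field_simp
  exact ⟨fun s => (hmain s).1, f, hf, hbij, hd, fun s => hf1 _ (hγ.mem_frontier s),
    fun s => (hmain s).2⟩

theorem hasDerivAt_bigPhi {φ : ℝ → ℝ} (hφ : Continuous φ) (s : ℝ) :
    HasDerivAt (bigPhi φ) (2 * Real.pi * φ s) s :=
  (intervalIntegral.integral_hasDerivAt_right (hφ.intervalIntegrable _ _)
    hφ.aestronglyMeasurable.stronglyMeasurableAtFilter hφ.continuousAt).const_mul _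

theorem bigPhi_zero (φ : ℝ → ℝ) : bigPhi φ 0 = 0 := by simp [bigPhi]

theorem IsBoundaryParam.periodic_deriv {Ω : Set ℂ} {b : ℂ} {L : ℝ} {γ : ℝ → ℂ}
    (hγ : IsBoundaryParam Ω b L γ) : Function.Periodic (deriv γ) L := fun s => by
  rw [← deriv_comp_add_const]
  congr 1
  funext t
  exact hγ.periodic t

theorem IsNormalDerivative.periodic {Ω : Set ℂ} {b : ℂ} {L : ℝ} {γ : ℝ → ℂ}
    (hγ : IsBoundaryParam Ω b L γ) {U : ℂ → ℝ} {φ : ℝ → ℝ} (hφ : IsNormalDerivative Ω γ U φ) :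
    Function.Periodic φ L := fun s => by
  have h1 := hφ (s + L)
  rw [hγ.periodic s, hγ.periodic_deriv s] at h1
  have := hγ.neBot s
  exact tendsto_nhds_unique h1 (hφ s)

theorem bigPhi_add_period {φ : ℝ → ℝ} {L : ℝ} (hφ : Continuous φ) (hper : Function.Periodic φ L)
    (s : ℝ) : bigPhi φ (s + L) = bigPhi φ s + bigPhi φ L := by
  have h1 := hper.intervalIntegral_add_eq s 0
  rw [zero_add] at h1
  rw [bigPhi, bigPhi, bigPhi, ← h1, ← mul_add,
    intervalIntegral.integral_add_adjacent_intervals (hφ.intervalIntegrable _ _)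
    (hφ.intervalIntegrable _ _)]

theorem strictMono_bigPhi {φ : ℝ → ℝ} (hφ : Continuous φ) (hpos : ∀ s, 0 < φ s) :
    StrictMono (bigPhi φ) :=
  strictMono_of_deriv_pos fun s => by
    rw [(hasDerivAt_bigPhi hφ s).deriv]
    have := hpos s
    positivity

theorem continuous_bigPhi {φ : ℝ → ℝ} (hφ : Continuous φ) : Continuous (bigPhi φ) :=
  continuous_iff_continuousAt.2 fun s => (hasDerivAt_bigPhi hφ s).continuousAt

/-- The boundary values of the conformal map are `e^{i(Φ(s) + θ)}`, for a constant `θ`. -/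
theorem exists_boundary_values {α : ℝ≥0} {Ω : Set ℂ} {b : ℂ} (hΩ : IsC1HolderDomain α Ω) {L : ℝ}
    {γ : ℝ → ℂ} (hγ : IsBoundaryParam Ω b L γ) {φ : ℝ → ℝ} (hφc : Continuous φ) {f : ℂ → ℂ}
    (hf : DifferentiableOn ℂ f Ω) (hf1 : ∀ s, Tendsto (fun z => ‖f z‖) (𝓝[Ω] (γ s)) (𝓝 1))
    (hlog : ∀ s, Tendsto (fun z => deriv f z / f z) (𝓝[Ω] (γ s))
        (𝓝 (2 * Real.pi * φ s * Complex.I * conj (deriv γ s)))) :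
    ∃ θ : ℝ, ∀ s, Tendsto f (𝓝[Ω] (γ s))
      (𝓝 (Complex.exp (((bigPhi φ s + θ : ℝ) : ℂ) * Complex.I))) := by
  have hdef : ∀ s, ∃ n ρ, IsDefiningAt Ω (γ s) n ρ := fun s => by
    obtain ⟨n, ρ, h, -⟩ := hΩ.exists_isDefiningAt (hγ.mem_frontier s)
    exact ⟨n, ρ, h⟩
  have hfne : ∀ s, ∀ᶠ z in 𝓝[Ω] (γ s), f z ≠ 0 := fun s => by
    filter_upwards [(hf1 s).eventually_ne one_ne_zero] with z hz
    simpa using hz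
  have hder : ∀ s, (fun z => deriv f z / f z * f z) =ᶠ[𝓝[Ω] (γ s)] deriv f := fun s => by
    filter_upwards [hfne s] with z hz
    field_simp
  have hex : ∀ s, ∃ l, Tendsto f (𝓝[Ω] (γ s)) (𝓝 l) := by
    intro s
    obtain ⟨n, ρ, h⟩ := hdef s
    have h1 := (hlog s).norm.mul (hf1 s)
    obtain ⟨K, hK⟩ := h1.isBoundedUnder_le
    rw [eventually_map] at hK
    refine h.exists_tendsto hΩ.isOpen hf (K := K) ?_
    filter_upwards [hK, hder s] with z hz hz'
    rwa [← hz', norm_mul]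
  choose a ha using hex
  have hnorm : ∀ s, ‖a s‖ = 1 := fun s => by
    have := hγ.neBot s
    exact tendsto_nhds_unique (ha s).norm (hf1 s)
  -- The factor `conj γ'` in the limit of `f'/f` cancels against `γ'`, leaving the linear equation
  -- `a' = 2πφ i a`.
  have had : ∀ s, HasDerivAt a (2 * Real.pi * φ s * Complex.I * a s) s := by
    intro s
    obtain ⟨n, ρ, h⟩ := hdef s
    have h1 := h.hasDerivAt_boundary hΩ.isOpen hf (((hlog s).mul (ha s)).congr' (hder s))
      (hγ.hasDerivAt s) (fun t => frontier_subset_closure (hγ.mem_frontier t)) ha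
    refine h1.congr_deriv ?_
    linear_combination (2 * Real.pi * φ s * Complex.I * a s) * hγ.conj_mul_deriv s
  have hconst : ∀ s, a s * Complex.exp (-(bigPhi φ s : ℂ) * Complex.I) = a 0 := by
    have hd : ∀ s, HasDerivAt (fun s => a s * Complex.exp (-(bigPhi φ s : ℂ) * Complex.I)) 0 s := by
      intro s
      have h1 := ((hasDerivAt_bigPhi hφc s).ofReal_comp.neg.mul_const Complex.I).cexp
      refine ((had s).mul h1).congr_deriv ?_
      push_cast
      simp only [Pi.neg_apply]
      ring
    intro s
    have := is_const_of_deriv_eq_zero (fun s => (hd s).differentiableAt) (fun s => (hd s).deriv) s 0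
    simpa [bigPhi_zero] using this
  refine ⟨Complex.arg (a 0), fun s => ?_⟩
  have e : Complex.exp (((bigPhi φ s + Complex.arg (a 0) : ℝ) : ℂ) * Complex.I) = a s := by
    have h0 := Complex.norm_mul_exp_arg_mul_I (a 0)
    rw [hnorm, Complex.ofReal_one, one_mul] at h0
    rw [Complex.ofReal_add, add_mul, Complex.exp_add, h0, ← hconst s, mul_left_comm,
      ← Complex.exp_add, neg_mul, add_neg_cancel, Complex.exp_zero, mul_one]
  rw [e]
  exact ha s

/-! ### Logarithms and inverses up to the boundary -/

/-- A continuous logarithm of a holomorphic function is holomorphic. -/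
theorem DifferentiableAt.of_exp_comp {k h : ℂ → ℂ} {w : ℂ} (hk : ContinuousAt k w)
    (hh : DifferentiableAt ℂ h w) (hkh : ∀ᶠ x in 𝓝 w, Complex.exp (k x) = h x) :
    DifferentiableAt ℂ k w := by
  have hw := hkh.self_of_nhds
  have hw0 : h w ≠ 0 := hw ▸ Complex.exp_ne_zero _
  have h1 : DifferentiableAt ℂ (fun x => Complex.log (h x / h w) + k w) w :=
    ((hh.div_const _).clog (by simp [hw0])).add_const _
  refine h1.congr_of_eventuallyEq ?_
  -- Within imaginary distance `1 < π` the principal logarithm recovers `k x - k w`.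
  have h2 : ∀ᶠ x in 𝓝 w, ‖k x - k w‖ < 1 := by
    have : ContinuousAt (fun x => ‖k x - k w‖) w := (hk.sub continuousAt_const).norm
    exact this.eventually_lt_const (by simp)
  filter_upwards [h2, hkh] with x hx hx'
  have him : |(k x - k w).im| < 1 := (Complex.abs_im_le_norm _).trans_lt hx
  have hpi := Real.pi_gt_three
  rw [← hx', ← hw, ← Complex.exp_sub, Complex.log_exp]
  · ring
  · linarith [(abs_lt.1 him).1]
  · linarith [(abs_lt.1 him).2]

/-- A nonvanishing function on the closed unit disc, holomorphic inside, has a logarithm. -/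
theorem exists_continuous_log {E : ℂ → ℂ} (hE : ContinuousOn E (Metric.closedBall 0 1))
    (hE0 : ∀ w ∈ Metric.closedBall (0 : ℂ) 1, E w ≠ 0)
    (hEd : DifferentiableOn ℂ E (Metric.ball 0 1)) :
    ∃ k : ℂ → ℂ, Continuous k ∧ DifferentiableOn ℂ k (Metric.ball 0 1) ∧
      ∀ w ∈ Metric.closedBall (0 : ℂ) 1, Complex.exp (k w) = E w := by
  -- The radial retraction onto the closed disc: `E ∘ π` is continuous and nonvanishing on the whole
  -- plane, so it has a continuous logarithm there.
  let π : ℂ → ℂ := fun w => w / ((max 1 ‖w‖ : ℝ) : ℂ)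
  have hmax : ∀ w : ℂ, (0 : ℝ) < max 1 ‖w‖ := fun w => lt_max_of_lt_left one_pos
  have hπ : Continuous π := by
    refine continuous_id.div ?_ fun w => by exact_mod_cast (hmax w).ne'
    fun_prop
  have hπm : ∀ w, π w ∈ Metric.closedBall (0 : ℂ) 1 := by
    intro w
    rw [mem_closedBall_zero_iff, norm_div, Complex.norm_real, Real.norm_of_nonneg (hmax w).le,
      div_le_one (hmax w)]
    exact le_max_right _ _
  have hπi : ∀ w ∈ Metric.closedBall (0 : ℂ) 1, π w = w := by
    intro w hw
    rw [mem_closedBall_zero_iff] at hw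
    simp [π, max_eq_left hw]
  have hsc : IsSimplyConnected (univ : Set ℂ) := by
    rw [isSimplyConnected_iff_exists_homotopy_refl_forall_mem]
    refine ⟨isPathConnected_univ, fun x p _ => ?_⟩
    obtain ⟨F⟩ := SimplyConnectedSpace.paths_homotopic p (Path.refl x)
    exact ⟨F, fun _ => mem_univ _⟩
  obtain ⟨k, hk, hkE⟩ := Complex.exists_continuousOn_eqOn_exp_comp hsc isOpen_univ
    (g := fun w => E (π w)) (hE.comp_continuous hπ hπm).continuousOn
    (by rintro ⟨w, -, hw⟩; exact hE0 _ (hπm w) hw)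
  have hkE' : ∀ w ∈ Metric.closedBall (0 : ℂ) 1, Complex.exp (k w) = E w := by
    intro w hw
    have := hkE (mem_univ w)
    simp only [Function.comp_apply, hπi w hw] at this
    exact this
  have hkc : Continuous k := continuousOn_univ.1 hk
  refine ⟨k, hkc, fun w hw => ?_, hkE'⟩
  refine (DifferentiableAt.of_exp_comp hkc.continuousAt
    (hEd.differentiableAt (Metric.isOpen_ball.mem_nhds hw)) ?_).differentiableWithinAt
  filter_upwards [Metric.isOpen_ball.mem_nhds hw] with x hx
  exact hkE' x (Metric.ball_subset_closedBall hx)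

/-- A biholomorphic map onto the disc whose derivative is bounded away from zero has a Lipschitz
inverse, extended here to the plane. -/
theorem exists_continuous_leftInverse {Ω : Set ℂ} (hΩ : IsOpen Ω) {f : ℂ → ℂ}
    (hf : DifferentiableOn ℂ f Ω) (hbij : BijOn f Ω (Metric.ball 0 1)) {m : ℝ} (hm : 0 < m)
    (hd : ∀ z ∈ Ω, m ≤ ‖deriv f z‖) :
    ∃ g : ℂ → ℂ, Continuous g ∧ DifferentiableOn ℂ g (Metric.ball 0 1) ∧
      MapsTo g (Metric.ball 0 1) Ω ∧ (∀ w ∈ Metric.ball (0 : ℂ) 1, f (g w) = w) ∧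
      ∀ z ∈ Ω, g (f z) = z := by
  have hinv := hbij.invOn_invFunOn
  set g := Function.invFunOn f Ω
  have hgm : MapsTo g (Metric.ball 0 1) Ω := hbij.surjOn.mapsTo_invFunOn
  have hdne : ∀ z ∈ Ω, deriv f z ≠ 0 := fun z hz => norm_pos_iff.1 (hm.trans_le (hd z hz))
  have hgd : ∀ w ∈ Metric.ball (0 : ℂ) 1, HasDerivAt g (deriv f (g w))⁻¹ w := by
    intro w hw
    have hz := hgm hw
    have hs : HasStrictDerivAt f (deriv f (g w)) (g w) :=
      ((hf.analyticOnNhd hΩ) _ hz).hasStrictDerivAt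
    have hE := hs.hasStrictFDerivAt_equiv (hdne _ hz)
    have h1 := (hs.to_localInverse (hdne _ hz)).hasDerivAt
    rw [hinv.2 hw] at h1
    refine h1.congr_of_eventuallyEq ?_
    have h2 := hE.eventually_right_inverse
    have h3 : ∀ᶠ x in 𝓝 w, hE.localInverse f _ _ x ∈ Ω := by
      have h4 := hE.localInverse_continuousAt
      rw [ContinuousAt, hE.localInverse_apply_image, hinv.2 hw] at h4
      exact h4 (hΩ.mem_nhds hz)
    rw [hinv.2 hw] at h2
    filter_upwards [h2, h3] with x hx hx'
    have := hinv.1 hx'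
    rw [hx] at this
    exact this
  have hlip : LipschitzOnWith m⁻¹.toNNReal g (Metric.ball 0 1) := by
    refine (convex_ball (0 : ℂ) 1).lipschitzOnWith_of_nnnorm_hasDerivWithin_le
      (fun w hw => (hgd w hw).hasDerivWithinAt) fun w hw => ?_
    rw [← NNReal.coe_le_coe, coe_nnnorm, norm_inv, Real.coe_toNNReal _ (by positivity)]
    exact inv_anti₀ hm (hd _ (hgm hw))
  obtain ⟨G, hG, hgG⟩ := hlip.extend_finite_dimension
  refine ⟨G, hG.continuous, fun w hw => ?_, fun w hw => hgG hw ▸ hgm hw,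
    fun w hw => hgG hw ▸ hinv.2 hw, fun z hz => ?_⟩
  · refine DifferentiableAt.differentiableWithinAt ?_
    refine (hgd w hw).differentiableAt.congr_of_eventuallyEq ?_
    filter_upwards [Metric.isOpen_ball.mem_nhds hw] with x hx using (hgG hx).symm
  · rw [← hgG (hbij.mapsTo hz)]
    exact hinv.1 hz

/-- By compactness, a sequence along which `f'` tends to zero would accumulate either at an interior
point, where `f'` is continuous and nonzero, or at a boundary point, where the limit of `|f'|` is
nonzero. -/
theorem exists_pos_le_norm_deriv {Ω : Set ℂ} (hΩ : IsOpen Ω) (hb : Bornology.IsBounded Ω)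
    {f : ℂ → ℂ} (hf : DifferentiableOn ℂ f Ω) (hd : ∀ z ∈ Ω, deriv f z ≠ 0)
    (hfr : ∀ p ∈ frontier Ω, ∃ l ≠ 0, Tendsto (fun z => ‖deriv f z‖) (𝓝[Ω] p) (𝓝 l)) :
    ∃ m > 0, ∀ z ∈ Ω, m ≤ ‖deriv f z‖ := by
  by_contra! hcon
  choose x hxΩ hx using fun n : ℕ => hcon (1 / ((n : ℝ) + 1)) (by positivity)
  obtain ⟨z, hz, θ, hθ, hθz⟩ := hb.isCompact_closure.tendsto_subseq
    (fun n => subset_closure (hxΩ n))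
  have hlim : Tendsto (fun n => ‖deriv f (x (θ n))‖) atTop (𝓝 0) :=
    squeeze_zero (fun _ => norm_nonneg _) (fun n => (hx (θ n)).le)
      (tendsto_one_div_add_atTop_nhds_zero_nat.comp hθ.tendsto_atTop)
  have hw : Tendsto (x ∘ θ) atTop (𝓝[Ω] z) :=
    tendsto_nhdsWithin_iff.2 ⟨hθz, Eventually.of_forall fun n => hxΩ _⟩
  by_cases hzΩ : z ∈ Ω
  · have h1 : ContinuousAt (deriv f) z :=
      ((hf.deriv hΩ).differentiableAt (hΩ.mem_nhds hzΩ)).continuousAt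
    have h2 := tendsto_nhds_unique (h1.norm.tendsto.comp hθz) hlim
    exact hd z hzΩ (norm_eq_zero.1 h2)
  · obtain ⟨l, hl, hlt⟩ := hfr z (by rw [hΩ.frontier_eq]; exact ⟨hz, hzΩ⟩)
    exact hl (tendsto_nhds_unique (hlt.comp hw) hlim)

/-! ### The angular coordinate `Φ` and the logarithm of the inverse map -/

/-- Periodicity makes the total angle a positive multiple of `2π`. More than one turn would bring
the boundary value back to its start before `L`, against injectivity. -/
theorem bigPhi_eq_two_pi {φ : ℝ → ℝ} {L θ : ℝ} (hL : 0 < L) (hφ : Continuous φ)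
    (hpos : ∀ s, 0 < φ s)
    (hper : Complex.exp (((bigPhi φ L + θ : ℝ) : ℂ) * Complex.I) =
      Complex.exp (((bigPhi φ 0 + θ : ℝ) : ℂ) * Complex.I))
    (hinj : InjOn (fun s => Complex.exp (((bigPhi φ s + θ : ℝ) : ℂ) * Complex.I)) (Ico 0 L)) :
    bigPhi φ L = 2 * Real.pi := by
  have hmono := strictMono_bigPhi hφ hpos
  have hLpos : 0 < bigPhi φ L := by
    have := hmono hL
    rwa [bigPhi_zero] at this
  obtain ⟨k, hk⟩ := Complex.exp_eq_exp_iff_exists_int.1 hper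
  rw [bigPhi_zero, zero_add] at hk
  have hk' : bigPhi φ L = k * (2 * Real.pi) := by
    have h1 : ((bigPhi φ L : ℝ) : ℂ) * Complex.I = ((k * (2 * Real.pi) : ℝ) : ℂ) * Complex.I := by
      push_cast at hk ⊢
      linear_combination hk
    exact_mod_cast mul_right_cancel₀ Complex.I_ne_zero h1
  have hpi := Real.pi_pos
  have hk0 : 0 < k := by
    rw [hk'] at hLpos
    exact_mod_cast pos_of_mul_pos_left hLpos (by positivity)
  rcases (show 1 ≤ k by omega).eq_or_lt with h | h
  · rw [hk', ← h]
    simp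
  · exfalso
    have hlt : 2 * Real.pi < bigPhi φ L := by
      rw [hk']
      have : (1 : ℝ) < k := by exact_mod_cast h
      nlinarith
    obtain ⟨s, hs, hse⟩ := intermediate_value_Icc hL.le (continuous_bigPhi hφ).continuousOn
      (show 2 * Real.pi ∈ Icc (bigPhi φ 0) (bigPhi φ L) by
        rw [bigPhi_zero]; exact ⟨by positivity, hlt.le⟩)
    have hsL : s ∈ Ico 0 L := by
      refine ⟨hs.1, lt_of_le_of_ne hs.2 ?_⟩
      rintro rfl
      linarith
    have := hinj hsL ⟨le_rfl, hL⟩ (by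
      simp only
      rw [hse, bigPhi_zero, zero_add]
      push_cast
      rw [add_mul, Complex.exp_add, Complex.exp_two_pi_mul_I, one_mul])
    rw [this, bigPhi_zero] at hse
    linarith

theorem exists_pos_le_of_periodic {φ : ℝ → ℝ} {L : ℝ} (hL : 0 < L) (hφ : Continuous φ)
    (hpos : ∀ s, 0 < φ s) (hper : Function.Periodic φ L) : ∃ m > 0, ∀ s, m ≤ φ s := by
  obtain ⟨s₀, -, hs₀⟩ := isCompact_Icc.exists_isMinOn (nonempty_Icc.2 hL.le) hφ.continuousOn
  refine ⟨φ s₀, hpos s₀, fun s => ?_⟩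
  obtain ⟨t, ht, hst⟩ := hper.exists_mem_Ico₀ hL s
  rw [hst]
  exact hs₀ ⟨ht.1, ht.2.le⟩

/-- A positive periodic continuous density is bounded below, so `Φ` grows at least linearly in both
directions. -/
theorem surjective_bigPhi {φ : ℝ → ℝ} {L : ℝ} (hL : 0 < L) (hφ : Continuous φ)
    (hpos : ∀ s, 0 < φ s) (hper : Function.Periodic φ L) : Function.Surjective (bigPhi φ) := by
  obtain ⟨m, hm, hmφ⟩ := exists_pos_le_of_periodic hL hφ hpos hper
  have hpi := Real.pi_pos
  have hmono : Monotone fun s => bigPhi φ s - 2 * Real.pi * m * s := by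
    refine monotone_of_deriv_nonneg (fun s => ?_) fun s => ?_
    · exact ((hasDerivAt_bigPhi hφ s).sub ((hasDerivAt_id s).const_mul _)).differentiableAt
    · have := ((hasDerivAt_bigPhi hφ s).sub ((hasDerivAt_id s).const_mul (2 * Real.pi * m))).deriv
      simp only [mul_one] at this
      refine le_of_le_of_eq ?_ this.symm
      have := hmφ s
      nlinarith
  have h2 : 0 < 2 * Real.pi * m := by positivity
  refine (continuous_bigPhi hφ).surjective ?_ ?_
  · refine tendsto_atTop_mono' _ ?_ (tendsto_id.const_mul_atTop h2)
    filter_upwards [eventually_ge_atTop 0] with s hs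
    have := hmono hs
    simp only [bigPhi_zero, mul_zero, sub_zero] at this
    simp only [id]
    linarith
  · refine tendsto_atBot_mono' _ ?_ (tendsto_id.const_mul_atBot h2)
    filter_upwards [eventually_le_atBot 0] with s hs
    have := hmono hs
    simp only [bigPhi_zero, mul_zero, sub_zero] at this
    simp only [id]
    linarith

/-- The boundary behaviour of the conformal map: with `k` the logarithm of the derivative of the
inverse map, `γ' = e^{k(ζ)} dζ/ds` for `ζ = e^{i(Φ(s) + θ)}`. -/
theorem exists_boundary_log {α : ℝ≥0} (hα₀ : 0 < α) (hα₁ : α < 1) {Ω : Set ℂ}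
    {c b : ℂ} (hΩ : IsC1HolderDomain α Ω) (hc : c ∈ Ω) {L : ℝ} {γ : ℝ → ℂ}
    (hγ : IsBoundaryParam Ω b L γ) {U : ℂ → ℝ} (hU : IsGreenFunction Ω c U) {φ : ℝ → ℝ}
    (hφ : IsNormalDerivative Ω γ U φ) (hφc : Continuous φ) :
    (∀ s, 0 < φ s) ∧ bigPhi φ L = 2 * Real.pi ∧ ∃ (k : ℂ → ℂ) (θ : ℝ), Continuous k ∧
      DifferentiableOn ℂ k (Metric.ball 0 1) ∧
      ∀ s, deriv γ s = Complex.exp (k (Complex.exp (((bigPhi φ s + θ : ℝ) : ℂ) * Complex.I))) *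
        (2 * Real.pi * φ s * Complex.I *
          Complex.exp (((bigPhi φ s + θ : ℝ) : ℂ) * Complex.I)) := by
  obtain ⟨hpos, f, hf, hbij, hd, hf1, hlog⟩ := hU.exists_conformal hα₀ hα₁ hΩ hc hγ hφ
  obtain ⟨θ, hθ⟩ := exists_boundary_values hΩ hγ hφc hf hf1 hlog
  set a : ℝ → ℂ := fun s => Complex.exp (((bigPhi φ s + θ : ℝ) : ℂ) * Complex.I)
  have hpi := Real.pi_pos
  have hne : ∀ s, (2 * Real.pi * φ s * Complex.I * conj (deriv γ s) : ℂ) ≠ 0 := by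
    intro s h
    have h1 := congrArg norm h
    rw [norm_mul, RCLike.norm_conj, hγ.unit_speed] at h1
    have : φ s ≠ 0 := (hpos s).ne'
    simp [this, hpi.ne'] at h1
  -- Hopf's lemma enters here: the boundary limits of `|f'|` are `2πφ`, hence nonzero.
  obtain ⟨m, hm, hmd⟩ := exists_pos_le_norm_deriv hΩ.isOpen hΩ.isBounded hf hd (by
    rw [← hγ.range_eq]
    rintro _ ⟨s, rfl⟩
    refine ⟨_, ?_, ((hlog s).norm.mul (hf1 s)).congr' ?_⟩
    · rw [mul_one]
      exact norm_ne_zero_iff.2 (hne s)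
    · filter_upwards [(hf1 s).eventually_ne one_ne_zero] with z hz
      have : f z ≠ 0 := by simpa using hz
      rw [← norm_mul]
      field_simp)
  obtain ⟨g, hgc, hgd, hgm, hfg, hgf⟩ := exists_continuous_leftInverse hΩ.isOpen hf hbij hm hmd
  have hga : ∀ s, g (a s) = γ s := by
    intro s
    have := hγ.neBot s
    have h1 : Tendsto (fun z => g (f z)) (𝓝[Ω] (γ s)) (𝓝 (g (a s))) :=
      (hgc.tendsto _).comp (hθ s)
    have h2 : Tendsto (fun z => z) (𝓝[Ω] (γ s)) (𝓝 (γ s)) := nhdsWithin_le_nhds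
    refine tendsto_nhds_unique (h1.congr' ?_) h2
    filter_upwards [self_mem_nhdsWithin] with z hz using hgf z hz
  have hperiod : bigPhi φ L = 2 * Real.pi := by
    refine bigPhi_eq_two_pi (θ := θ) hγ.pos hφc hpos ?_ ?_
    · have := hγ.neBot 0
      have h1 := hθ L
      have h2 : γ L = γ 0 := by simpa using hγ.periodic 0
      rw [h2] at h1
      exact tendsto_nhds_unique h1 (hθ 0)
    · intro s hs t ht hst
      refine hγ.injOn hs ht ?_
      rw [← hga s, ← hga t]
      exact congrArg g hst
  have hsurj := surjective_bigPhi hγ.pos hφc hpos (hφ.periodic hγ)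
  have hsphere : ∀ w : ℂ, ‖w‖ = 1 → ∃ s, a s = w := by
    intro w hw
    obtain ⟨s, hs⟩ := hsurj (Complex.arg w - θ)
    refine ⟨s, ?_⟩
    simp only [a]
    rw [hs, sub_add_cancel]
    have := Complex.norm_mul_exp_arg_mul_I w
    rwa [hw, Complex.ofReal_one, one_mul] at this
  have hnorma : ∀ s, ‖a s‖ = 1 := fun s => Complex.norm_exp_ofReal_mul_I _
  have hdd : DifferentiableOn ℂ (fun w => deriv f (g w)) (Metric.ball 0 1) :=
    (hf.deriv hΩ.isOpen).comp hgd hgm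
  have hcl : ∀ w ∈ Metric.closedBall (0 : ℂ) 1, w ∈ closure (Metric.ball (0 : ℂ) 1) := by
    intro w hw
    rwa [closure_ball _ one_ne_zero]
  have hlimb : ∀ w ∈ Metric.ball (0 : ℂ) 1,
      Tendsto (fun w => deriv f (g w)) (𝓝[Metric.ball 0 1] w) (𝓝 (deriv f (g w))) :=
    fun w hw => hdd.continuousOn w hw
  have hlims : ∀ s, Tendsto (fun w => deriv f (g w)) (𝓝[Metric.ball 0 1] (a s))
      (𝓝 (2 * Real.pi * φ s * Complex.I * conj (deriv γ s) * a s)) := by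
    intro s
    have h1 : Tendsto g (𝓝[Metric.ball 0 1] (a s)) (𝓝[Ω] (γ s)) := by
      refine tendsto_nhdsWithin_iff.2 ⟨?_, ?_⟩
      · rw [← hga s]
        exact (hgc.tendsto _).mono_left nhdsWithin_le_nhds
      · filter_upwards [self_mem_nhdsWithin] with w hw using hgm hw
    have h2 : Tendsto (fun w : ℂ => w) (𝓝[Metric.ball 0 1] (a s)) (𝓝 (a s)) := nhdsWithin_le_nhds
    refine (((hlog s).comp h1).mul h2).congr' ?_
    have hane : a s ≠ 0 := Complex.exp_ne_zero _
    filter_upwards [self_mem_nhdsWithin, h2.eventually_ne hane] with w hw hw0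
    simp only [Function.comp_apply, hfg w hw]
    field_simp
  -- The continuous extension of `f' ∘ g` to the closed disc; its values on the circle come from the
  -- limit of `f'/f`.
  let E : ℂ → ℂ := extendFrom (Metric.ball 0 1) fun w => deriv f (g w)
  have hEb : ∀ w ∈ Metric.ball (0 : ℂ) 1, E w = deriv f (g w) := fun w hw =>
    extendFrom_eq (subset_closure hw) (hlimb w hw)
  have hEs : ∀ s, E (a s) = 2 * Real.pi * φ s * Complex.I * conj (deriv γ s) * a s := fun s =>
    extendFrom_eq (hcl _ (by simp [hnorma])) (hlims s)
  have hcases : ∀ w ∈ Metric.closedBall (0 : ℂ) 1, w ∈ Metric.ball (0 : ℂ) 1 ∨ ∃ s, a s = w := by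
    intro w hw
    rw [mem_closedBall_zero_iff] at hw
    rcases hw.lt_or_eq with h | h
    · exact Or.inl (by simpa using h)
    · exact Or.inr (hsphere w h)
  have hEc : ContinuousOn E (Metric.closedBall 0 1) := by
    refine continuousOn_extendFrom (fun w hw => hcl w hw) fun w hw => ?_
    rcases hcases w hw with h | ⟨s, rfl⟩
    · exact ⟨_, hlimb w h⟩
    · exact ⟨_, hlims s⟩
  have hE0 : ∀ w ∈ Metric.closedBall (0 : ℂ) 1, E w ≠ 0 := by
    intro w hw
    rcases hcases w hw with h | ⟨s, rfl⟩
    · rw [hEb w h]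
      exact hd _ (hgm h)
    · rw [hEs]
      exact mul_ne_zero (hne s) (Complex.exp_ne_zero _)
  have hEd : DifferentiableOn ℂ E (Metric.ball 0 1) := hdd.congr hEb
  obtain ⟨k, hk, hkd, hkE⟩ := exists_continuous_log hEc hE0 hEd
  -- The sign appears because `g' = 1/(f' ∘ g)`.
  refine ⟨hpos, hperiod, fun w => -k w, θ, hk.neg, hkd.neg, fun s => ?_⟩
  have h1 := hkE (a s) (by simp [hnorma])
  rw [hEs] at h1
  change _ = Complex.exp (-k (a s)) * (2 * Real.pi * φ s * Complex.I * a s)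
  rw [Complex.exp_neg, h1]
  have h2 := hγ.conj_mul_deriv s
  have hφ0 : (φ s : ℂ) ≠ 0 := by exact_mod_cast (hpos s).ne'
  have hpi0 : (Real.pi : ℂ) ≠ 0 := by exact_mod_cast hpi.ne'
  have ha0 : a s ≠ 0 := Complex.exp_ne_zero _
  have hc0 : conj (deriv γ s) ≠ 0 := left_ne_zero_of_mul_eq_one h2
  have hI := Complex.I_ne_zero
  rw [mul_comm] at h2
  field_simp
  exact h2

/-! ### Poisson and conjugate Poisson kernels -/

/-- The squared distance `|1 - r e^{ix}|²`. -/
def circleDistSq (r x : ℝ) : ℝ := 1 - 2 * r * Real.cos x + r ^ 2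

/-- The conjugate Poisson kernel `2 r sin x / |1 - r e^{ix}|²`. -/
def conjPoisson (r x : ℝ) : ℝ := 2 * r * Real.sin x / circleDistSq r x

/-- The imaginary part of `ζ / (1 - ζ)²` at `ζ = r e^{ix}`, that is, `-1/2` times the derivative of
the Poisson kernel `(1 - r²) / |1 - r e^{ix}|²`. -/
def poissonSlope (r x : ℝ) : ℝ := r * (1 - r ^ 2) * Real.sin x / circleDistSq r x ^ 2

/-- The real part of `ζ / (1 - ζ)²` at `ζ = r e^{ix}`. -/
def conjPoissonSlope (r x : ℝ) : ℝ :=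
  r * ((1 + r ^ 2) * Real.cos x - 2 * r) / circleDistSq r x ^ 2

theorem circleDistSq_eq (r x : ℝ) :
    circleDistSq r x = (1 - r) ^ 2 + 4 * r * Real.sin (x / 2) ^ 2 := by
  have h : Real.cos x = 1 - 2 * Real.sin (x / 2) ^ 2 := by
    have := Real.cos_two_mul (x / 2)
    rw [mul_div_cancel₀ x two_ne_zero] at this
    nlinarith [Real.sin_sq_add_cos_sq (x / 2)]
  rw [circleDistSq, h]; ring

theorem circleDistSq_pos {r : ℝ} (hr₀ : 0 ≤ r) (hr₁ : r < 1) (x : ℝ) : 0 < circleDistSq r x := by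
  rw [circleDistSq_eq]
  have : 0 < 1 - r := by linarith
  positivity

theorem continuous_circleDistSq (r : ℝ) : Continuous (circleDistSq r) := by
  unfold circleDistSq; fun_prop

theorem continuous_conjPoisson {r : ℝ} (hr₀ : 0 ≤ r) (hr₁ : r < 1) : Continuous (conjPoisson r) :=
  Continuous.div (by fun_prop) (continuous_circleDistSq r) fun x => (circleDistSq_pos hr₀ hr₁ x).ne'

theorem continuous_poissonSlope {r : ℝ} (hr₀ : 0 ≤ r) (hr₁ : r < 1) :
    Continuous (poissonSlope r) :=
  Continuous.div (by fun_prop) ((continuous_circleDistSq r).pow 2) fun x =>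
    (pow_pos (circleDistSq_pos hr₀ hr₁ x) 2).ne'

theorem continuous_conjPoissonSlope {r : ℝ} (hr₀ : 0 ≤ r) (hr₁ : r < 1) :
    Continuous (conjPoissonSlope r) :=
  Continuous.div (by fun_prop) ((continuous_circleDistSq r).pow 2) fun x =>
    (pow_pos (circleDistSq_pos hr₀ hr₁ x) 2).ne'

theorem hasDerivAt_circleDistSq (r x : ℝ) :
    HasDerivAt (circleDistSq r) (2 * r * Real.sin x) x := by
  have := (((Real.hasDerivAt_cos x).const_mul (2 * r)).const_sub 1).add_const (r ^ 2)
  exact this.congr_deriv (by ring)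

theorem hasDerivAt_conjPoisson {r : ℝ} (hr₀ : 0 ≤ r) (hr₁ : r < 1) (x : ℝ) :
    HasDerivAt (conjPoisson r) (2 * conjPoissonSlope r x) x := by
  have hD := (circleDistSq_pos hr₀ hr₁ x).ne'
  refine (((Real.hasDerivAt_sin x).const_mul (2 * r)).div (hasDerivAt_circleDistSq r x)
    hD).congr_deriv ?_
  rw [conjPoissonSlope]
  have : Real.sin x ^ 2 = 1 - Real.cos x ^ 2 := by
    linarith [Real.sin_sq_add_cos_sq x]
  field_simp
  rw [this, circleDistSq]
  ring

theorem hasDerivAt_poisson {r : ℝ} (hr₀ : 0 ≤ r) (hr₁ : r < 1) (x : ℝ) :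
    HasDerivAt (fun y => (1 - r ^ 2) / circleDistSq r y) (-2 * poissonSlope r x) x := by
  have hD := (circleDistSq_pos hr₀ hr₁ x).ne'
  refine ((hasDerivAt_const x (1 - r ^ 2)).div (hasDerivAt_circleDistSq r x) hD).congr_deriv ?_
  rw [poissonSlope]
  field_simp
  ring

theorem circleDistSq_two_pi_sub (r x : ℝ) :
    circleDistSq r (2 * Real.pi - x) = circleDistSq r x := by
  simp [circleDistSq, Real.cos_two_pi_sub]

theorem conjPoisson_two_pi_sub (r x : ℝ) : conjPoisson r (2 * Real.pi - x) = -conjPoisson r x := by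
  simp [conjPoisson, circleDistSq_two_pi_sub, Real.sin_two_pi_sub, neg_div]

theorem poissonSlope_two_pi_sub (r x : ℝ) :
    poissonSlope r (2 * Real.pi - x) = -poissonSlope r x := by
  simp [poissonSlope, circleDistSq_two_pi_sub, Real.sin_two_pi_sub, neg_div]

theorem normSq_one_sub_polar (r x : ℝ) :
    Complex.normSq (1 - r * Complex.exp (x * Complex.I)) = circleDistSq r x := by
  rw [Complex.normSq_apply, circleDistSq]
  simp [Complex.exp_re, Complex.exp_im, Complex.mul_re, Complex.mul_im]
  nlinarith [Real.sin_sq_add_cos_sq x]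

/-- Both slope kernels are packaged into one power series in `ζ` without constant term, so that
Cauchy's theorem can relate the integrals of `u` and of `v`. -/
theorem polar_div_one_sub_sq {r : ℝ} (hr₀ : 0 ≤ r) (hr₁ : r < 1) (x : ℝ) :
    (r * Complex.exp (x * Complex.I) / (1 - r * Complex.exp (x * Complex.I)) ^ 2 : ℂ) =
      conjPoissonSlope r x + poissonSlope r x * Complex.I := by
  have hD := (circleDistSq_pos hr₀ hr₁ x).ne'
  have hne : (1 - r * Complex.exp (x * Complex.I) : ℂ) ≠ 0 := by
    intro h
    have := normSq_one_sub_polar r x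
    rw [h, map_zero] at this
    exact hD this.symm
  rw [div_eq_iff (pow_ne_zero 2 hne), conjPoissonSlope, poissonSlope]
  have hDc : ((circleDistSq r x : ℝ) : ℂ) ≠ 0 := by exact_mod_cast hD
  push_cast
  rw [div_mul_eq_mul_div, ← add_div, div_mul_eq_mul_div, eq_div_iff (pow_ne_zero 2 hDc)]
  rw [Complex.exp_mul_I]
  simp only [circleDistSq]
  push_cast
  have h1 : Complex.sin x ^ 2 = 1 - Complex.cos x ^ 2 := by
    linear_combination Complex.sin_sq_add_cos_sq (x : ℂ)
  have h2 : Complex.I ^ 2 = -1 := Complex.I_sq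
  generalize Complex.cos (x : ℂ) = c at *
  generalize Complex.sin (x : ℂ) = s at *
  grind

/-- Pairing a function holomorphic in the unit disc and continuous up to the circle with the
positive frequencies. -/
theorem integral_polar_div_one_sub_sq_mul {k : ℂ → ℂ} (hk : Continuous k)
    (hkd : DifferentiableOn ℂ k (Metric.ball 0 1)) {r : ℝ} (hr₀ : 0 ≤ r) (hr₁ : r < 1) (θ : ℝ) :
    ∫ x in (0 : ℝ)..2 * Real.pi,
      (r * Complex.exp (x * Complex.I) / (1 - r * Complex.exp (x * Complex.I)) ^ 2 : ℂ) *
        k (Complex.exp (((θ + x : ℝ) : ℂ) * Complex.I)) = 0 := by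
  have hne : ∀ z : ℂ, ‖z‖ ≤ 1 → (1 - r * z : ℂ) ≠ 0 := by
    intro z hz h
    have h1 : (r : ℂ) * z = 1 := (sub_eq_zero.1 h).symm
    have h2 : ‖(r : ℂ) * z‖ = 1 := by rw [h1, norm_one]
    rw [norm_mul, Complex.norm_real, Real.norm_of_nonneg hr₀] at h2
    nlinarith [norm_nonneg z]
  set a : ℂ := Complex.exp ((θ : ℂ) * Complex.I) with ha
  have han : ‖a‖ = 1 := Complex.norm_exp_ofReal_mul_I θ
  -- The numerator's factor `e^{ix}` is absorbed by `dz = i e^{ix} dx`, leaving an integrand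
  -- holomorphic in the disc.
  have hd : DiffContOnCl ℂ (fun z : ℂ => (r : ℂ) * k (a * z) / (1 - r * z) ^ 2)
      (Metric.ball 0 1) := by
    constructor
    · refine DifferentiableOn.div ?_ (by fun_prop) fun z hz =>
        pow_ne_zero 2 (hne z (by simpa using (mem_ball_zero_iff.1 hz).le))
      refine DifferentiableOn.const_mul ?_ _
      refine hkd.comp (by fun_prop) fun z hz => ?_
      rw [mem_ball_zero_iff] at hz ⊢
      rwa [norm_mul, han, one_mul]
    · rw [closure_ball _ one_ne_zero]
      refine ContinuousOn.div (by fun_prop) (by fun_prop) fun z hz =>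
        pow_ne_zero 2 (hne z (by simpa using hz))
  have := hd.circleIntegral_eq_zero zero_le_one
  rw [circleIntegral] at this
  have h2 : ∀ x : ℝ, deriv (circleMap 0 1) x • ((r : ℂ) * k (a * circleMap 0 1 x) /
      (1 - r * circleMap 0 1 x) ^ 2) = Complex.I *
      ((r * Complex.exp (x * Complex.I) / (1 - r * Complex.exp (x * Complex.I)) ^ 2 : ℂ) *
        k (Complex.exp (((θ + x : ℝ) : ℂ) * Complex.I))) := by
    intro x
    rw [deriv_circleMap]
    simp only [circleMap, zero_add, Complex.ofReal_one, one_mul, smul_eq_mul]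
    rw [ha, ← Complex.exp_add]
    push_cast
    rw [add_mul]
    ring
  simp only [h2] at this
  rw [intervalIntegral.integral_const_mul] at this
  exact (mul_eq_zero.1 this).resolve_left Complex.I_ne_zero

/-- The conjugate Poisson integral of `u'` is the derivative of the Poisson integral of the
conjugate function. -/
theorem integral_conjPoisson_mul_deriv {k : ℂ → ℂ} (hk : Continuous k)
    (hkd : DifferentiableOn ℂ k (Metric.ball 0 1)) {w : ℝ → ℝ} (hw : Continuous w)
    (hu : ∀ t : ℝ, HasDerivAt (fun t : ℝ => (k (Complex.exp (t * Complex.I))).re) (w t) t)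
    {r : ℝ} (hr₀ : 0 ≤ r) (hr₁ : r < 1) (θ : ℝ) :
    ∫ x in (0 : ℝ)..2 * Real.pi, conjPoisson r x * w (θ + x) =
      -2 * ∫ x in (0 : ℝ)..2 * Real.pi,
        poissonSlope r x * (k (Complex.exp (((θ + x : ℝ) : ℂ) * Complex.I))).im := by
  have hA := continuous_conjPoissonSlope hr₀ hr₁
  have hB := continuous_poissonSlope hr₀ hr₁
  -- The real part reads `∫ conjPoissonSlope · u = ∫ poissonSlope · v`. Integration by parts then
  -- moves the derivative onto `u`, with no boundary term because `conjPoisson` vanishes at `0` and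
  -- `2π`.
  have h0 := congrArg Complex.re (integral_polar_div_one_sub_sq_mul hk hkd hr₀ hr₁ θ)
  have hint : ∀ f : ℝ → ℂ, Continuous f → (∫ x in (0 : ℝ)..2 * Real.pi, f x).re =
      ∫ x in (0 : ℝ)..2 * Real.pi, (f x).re := fun f hf =>
    (Complex.reCLM.intervalIntegral_comp_comm (hf.intervalIntegrable _ _)).symm
  simp only [polar_div_one_sub_sq hr₀ hr₁] at h0
  rw [hint _ (by fun_prop)] at h0
  simp only [Complex.mul_re, Complex.add_re, Complex.add_im, Complex.ofReal_re, Complex.ofReal_im,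
    Complex.mul_im, Complex.I_re, Complex.I_im, mul_zero, mul_one, add_zero,
    zero_add, sub_self, Complex.zero_re] at h0
  rw [intervalIntegral.integral_sub (Continuous.intervalIntegrable (by fun_prop) _ _)
    (Continuous.intervalIntegrable (by fun_prop) _ _)] at h0
  have hparts := intervalIntegral.integral_mul_deriv_eq_deriv_mul (a := 0) (b := 2 * Real.pi)
    (u := conjPoisson r) (v := fun x : ℝ => (k (Complex.exp (((θ + x : ℝ) : ℂ) * Complex.I))).re)
    (u' := fun x => 2 * conjPoissonSlope r x) (v' := fun x => w (θ + x))
    (fun x _ => hasDerivAt_conjPoisson hr₀ hr₁ x)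
    (fun x _ => by
      have := (hu (θ + x)).comp x ((hasDerivAt_id x).const_add θ)
      simpa [Function.comp_def] using this)
    (Continuous.intervalIntegrable (by fun_prop) _ _)
    (Continuous.intervalIntegrable (by fun_prop) _ _)
  rw [hparts]
  have e0 : conjPoisson r 0 = 0 := by simp [conjPoisson]
  have e1 : conjPoisson r (2 * Real.pi) = 0 := by simp [conjPoisson]
  simp only [mul_assoc, intervalIntegral.integral_const_mul]
  rw [e0, e1]
  linear_combination -2 * h0

theorem integral_two_pi_eq_integral_pi {f : ℝ → ℝ} (hf : Continuous f) :
    ∫ x in (0 : ℝ)..2 * Real.pi, f x = ∫ x in (0 : ℝ)..Real.pi, (f x + f (2 * Real.pi - x)) := by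
  rw [intervalIntegral.integral_add (hf.intervalIntegrable _ _)
    (Continuous.intervalIntegrable (by fun_prop) _ _), intervalIntegral.integral_comp_sub_left,
    ← intervalIntegral.integral_add_adjacent_intervals (hf.intervalIntegrable 0 Real.pi)
      (hf.intervalIntegrable Real.pi _)]
  congr 2 <;> ring

/-- The kernel is odd, so folding leaves only the difference across `θ`; its vanishing at `x = 0` is
what makes the singular limit tractable. -/
theorem integral_conjPoisson_mul {w : ℝ → ℝ} (hw : Continuous w)
    (hper : Function.Periodic w (2 * Real.pi)) {r : ℝ} (hr₀ : 0 ≤ r) (hr₁ : r < 1) (θ : ℝ) :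
    ∫ x in (0 : ℝ)..2 * Real.pi, conjPoisson r x * w (θ + x) =
      ∫ x in (0 : ℝ)..Real.pi, conjPoisson r x * (w (θ + x) - w (θ - x)) := by
  have := continuous_conjPoisson hr₀ hr₁
  rw [integral_two_pi_eq_integral_pi (by fun_prop)]
  refine intervalIntegral.integral_congr fun x _ => ?_
  have h := hper (θ - x)
  simp only [conjPoisson_two_pi_sub]
  rw [show θ + (2 * Real.pi - x) = θ - x + 2 * Real.pi by ring, h]
  ring

theorem integral_poissonSlope_mul {v : ℝ → ℝ} (hv : Continuous v)
    (hper : Function.Periodic v (2 * Real.pi)) {r : ℝ} (hr₀ : 0 ≤ r) (hr₁ : r < 1) (θ : ℝ) :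
    ∫ x in (0 : ℝ)..2 * Real.pi, poissonSlope r x * v (θ + x) =
      ∫ x in (0 : ℝ)..Real.pi, poissonSlope r x * (v (θ + x) - v (θ - x)) := by
  have := continuous_poissonSlope hr₀ hr₁
  rw [integral_two_pi_eq_integral_pi (by fun_prop)]
  refine intervalIntegral.integral_congr fun x _ => ?_
  have h := hper (θ - x)
  simp only [poissonSlope_two_pi_sub]
  rw [show θ + (2 * Real.pi - x) = θ - x + 2 * Real.pi by ring, h]
  ring

/-- The conjugacy identity for `k = id`, where `u = cos` and `v = sin`. It normalises the kernel in
Fatou's argument. -/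
theorem integral_conjPoisson_mul_sin {r : ℝ} (hr₀ : 0 ≤ r) (hr₁ : r < 1) :
    ∫ x in (0 : ℝ)..Real.pi, conjPoisson r x * Real.sin x =
      2 * ∫ x in (0 : ℝ)..Real.pi, poissonSlope r x * Real.sin x := by
  have h := integral_conjPoisson_mul_deriv (k := id) continuous_id differentiableOn_id
    (w := fun t => -Real.sin t) (by fun_prop)
    (fun t => by simpa [Complex.exp_re] using Real.hasDerivAt_cos t) hr₀ hr₁ 0
  have hs : (fun x : ℝ => (id (Complex.exp (((0 + x : ℝ) : ℂ) * Complex.I))).im) =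
      fun x => Real.sin (0 + x) := by
    ext x; simp [Complex.exp_im]
  have h1 := integral_conjPoisson_mul (w := fun t => -Real.sin t) (by fun_prop)
    (fun x => by simp) hr₀ hr₁ 0
  have h2 := integral_poissonSlope_mul (v := fun t => Real.sin t) (by fun_prop)
    (fun x => by simp) hr₀ hr₁ 0
  simp only [congrFun hs] at h
  rw [h1, h2] at h
  have h3 : ∀ x : ℝ, conjPoisson r x * (-Real.sin (0 + x) - -Real.sin (0 - x)) =
      -2 * (conjPoisson r x * Real.sin x) := fun x => by simp; ring
  have h4 : ∀ x : ℝ, poissonSlope r x * (Real.sin (0 + x) - Real.sin (0 - x)) =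
      2 * (poissonSlope r x * Real.sin x) := fun x => by simp; ring
  simp only [h3, h4, intervalIntegral.integral_const_mul] at h
  linarith

/-! ### Kernel estimates and approximate identities -/

/-- Jordan's inequality with `π² ≤ 10` gives `sin²(x/2) ≥ x²/10`, and `4r ≥ 2`. -/
theorem le_circleDistSq {r x : ℝ} (hr : 1 / 2 ≤ r) (hx₀ : 0 ≤ x) (hx₁ : x ≤ Real.pi) :
    ((1 - r) ^ 2 + x ^ 2) / 5 ≤ circleDistSq r x := by
  have hpi := Real.pi_pos
  have hs : 2 / Real.pi * (x / 2) ≤ Real.sin (x / 2) :=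
    Real.mul_le_sin (by positivity) (by linarith)
  have h1 : (2 / Real.pi * (x / 2)) ^ 2 ≤ Real.sin (x / 2) ^ 2 := by gcongr
  have h2 : x ^ 2 / 10 ≤ (2 / Real.pi * (x / 2)) ^ 2 := by
    rw [show 2 / Real.pi * (x / 2) = x / Real.pi by ring, div_pow]
    gcongr
    nlinarith [Real.pi_lt_d2]
  rw [circleDistSq_eq]
  nlinarith [sq_nonneg (1 - r), sq_nonneg x, sq_nonneg (Real.sin (x / 2))]

theorem cot_half_nonneg {x : ℝ} (hx₀ : 0 < x) (hx₁ : x ≤ Real.pi) : 0 ≤ Real.cot (x / 2) := by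
  rw [Real.cot_eq_cos_div_sin]
  exact div_nonneg (Real.cos_nonneg_of_mem_Icc ⟨by linarith, by linarith⟩)
    (Real.sin_nonneg_of_nonneg_of_le_pi (by linarith) (by linarith))

theorem cot_half_le {x : ℝ} (hx₀ : 0 < x) (hx₁ : x ≤ Real.pi) : Real.cot (x / 2) ≤ 2 / x := by
  rcases hx₁.eq_or_lt with rfl | hlt
  · rw [Real.cot_eq_cos_div_sin, Real.cos_pi_div_two, zero_div]; positivity
  rw [Real.cot_eq_cos_div_sin]
  have ht := (Real.lt_tan (x := x / 2) (by linarith) (by linarith)).le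
  have hc : 0 < Real.cos (x / 2) := Real.cos_pos_of_mem_Ioo ⟨by linarith, by linarith⟩
  have hs : 0 < Real.sin (x / 2) := Real.sin_pos_of_pos_of_lt_pi (by linarith) (by linarith)
  rw [Real.tan_eq_sin_div_cos, le_div_iff₀ hc] at ht
  rw [div_le_div_iff₀ hs hx₀]
  linarith

/-- In half angles `conjPoisson r x` is `cot(x/2)` times `4r sin²(x/2) / circleDistSq r x`, and the
denominator exceeds that numerator by `(1 - r)²`. -/
theorem cot_half_sub_conjPoisson {r x : ℝ} (hr₀ : 0 ≤ r) (hr₁ : r < 1) (hx₀ : 0 < x)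
    (hx₁ : x ≤ Real.pi) :
    Real.cot (x / 2) - conjPoisson r x = Real.cot (x / 2) * ((1 - r) ^ 2 / circleDistSq r x) := by
  have hD := (circleDistSq_pos hr₀ hr₁ x).ne'
  have hs : Real.sin (x / 2) ≠ 0 :=
    (Real.sin_pos_of_pos_of_lt_pi (by linarith) (by linarith [Real.pi_pos])).ne'
  have h2 : Real.sin x = 2 * Real.sin (x / 2) * Real.cos (x / 2) := by
    rw [← Real.sin_two_mul]; congr 1; ring
  rw [conjPoisson, h2, Real.cot_eq_cos_div_sin]
  field_simp
  rw [circleDistSq_eq]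
  ring

theorem abs_cot_half_sub_conjPoisson_le {r x : ℝ} (hr₀ : 1 / 2 ≤ r) (hr₁ : r < 1) (hx₀ : 0 < x)
    (hx₁ : x ≤ Real.pi) :
    |Real.cot (x / 2) - conjPoisson r x| ≤ 10 / x * ((1 - r) ^ 2 / ((1 - r) ^ 2 + x ^ 2)) := by
  have hD := circleDistSq_pos (by linarith) hr₁ x
  rw [cot_half_sub_conjPoisson (by linarith) hr₁ hx₀ hx₁, abs_of_nonneg
    (mul_nonneg (cot_half_nonneg hx₀ hx₁) (by positivity))]
  calc _ ≤ 2 / x * ((1 - r) ^ 2 / (((1 - r) ^ 2 + x ^ 2) / 5)) := by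
        gcongr
        · exact cot_half_le hx₀ hx₁
        · exact le_circleDistSq hr₀ hx₀.le hx₁
    _ = _ := by field_simp; ring

/-- For `x > 1 - r` the two kernels nearly agree; for `x ≤ 1 - r` the conjugate kernel is still of
order `1/(1 - r)`. Cutting at `1 - r` thus leaves an error of Poisson size. -/
theorem abs_conjPoisson_sub_indicator_le {r x : ℝ} (hr₀ : 1 / 2 ≤ r) (hr₁ : r < 1) (hx₀ : 0 < x)
    (hx₁ : x ≤ Real.pi) :
    |conjPoisson r x - (Ioc (1 - r) Real.pi).indicator (fun y => Real.cot (y / 2)) x| ≤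
      10 * ((1 - r) / ((1 - r) ^ 2 + x ^ 2)) := by
  have hε : 0 < 1 - r := by linarith
  by_cases hx : x ∈ Ioc (1 - r) Real.pi
  · rw [indicator_of_mem hx, abs_sub_comm]
    refine (abs_cot_half_sub_conjPoisson_le hr₀ hr₁ hx₀ hx₁).trans ?_
    rw [div_mul_div_comm, ← mul_div_assoc, div_le_div_iff₀ (by positivity) (by positivity)]
    have : 10 * (1 - r) ^ 2 ≤ 10 * (1 - r) * x := by nlinarith [hx.1]
    nlinarith [mul_le_mul_of_nonneg_right this (show 0 ≤ (1 - r) ^ 2 + x ^ 2 by positivity)]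
  · have hxr : x ≤ 1 - r := by
      by_contra h
      exact hx ⟨not_le.1 h, hx₁⟩
    rw [indicator_of_notMem hx, sub_zero, conjPoisson]
    have hs₀ := Real.sin_nonneg_of_nonneg_of_le_pi hx₀.le hx₁
    have hD := circleDistSq_pos (by linarith) hr₁ x
    rw [abs_of_nonneg (by positivity)]
    calc _ ≤ 2 * 1 * (1 - r) / (((1 - r) ^ 2 + x ^ 2) / 5) := by
          gcongr
          · exact (Real.sin_le hx₀.le).trans hxr
          · exact le_circleDistSq hr₀ hx₀.le hx₁
      _ = _ := by field_simp; norm_num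

/-- The mechanism of Fatou's theorem: `x` times the derivative of the Poisson kernel is again
dominated by a Poisson kernel, so first-order information on `v` suffices. -/
theorem abs_poissonSlope_mul_le {r x : ℝ} (hr₀ : 1 / 2 ≤ r) (hr₁ : r < 1) (hx₀ : 0 < x)
    (hx₁ : x ≤ Real.pi) :
    |poissonSlope r x * x| ≤ 50 * ((1 - r) / ((1 - r) ^ 2 + x ^ 2)) := by
  have hε : 0 < 1 - r := by linarith
  have hs₀ := Real.sin_nonneg_of_nonneg_of_le_pi hx₀.le hx₁
  have hD := circleDistSq_pos (by linarith) hr₁ x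
  have h1 : 0 ≤ 1 - r ^ 2 := by nlinarith
  rw [poissonSlope, abs_of_nonneg (by positivity)]
  calc _ ≤ 1 * (2 * (1 - r)) * x / (((1 - r) ^ 2 + x ^ 2) / 5) ^ 2 * x := by
        gcongr
        · nlinarith
        · exact Real.sin_le hx₀.le
        · exact le_circleDistSq hr₀ hx₀.le hx₁
    _ = 50 * ((1 - r) / ((1 - r) ^ 2 + x ^ 2)) * (x ^ 2 / ((1 - r) ^ 2 + x ^ 2)) := by
        field_simp; norm_num
    _ ≤ 50 * ((1 - r) / ((1 - r) ^ 2 + x ^ 2)) * 1 := by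
        gcongr
        rw [div_le_one (by positivity)]
        nlinarith
    _ = _ := mul_one _

theorem integral_div_sq_add_sq_le {ε : ℝ} (hε : 0 < ε) :
    ∫ x in (0 : ℝ)..Real.pi, ε / (ε ^ 2 + x ^ 2) ≤ 2 := by
  have hd : ∀ x : ℝ, HasDerivAt (fun x => Real.arctan (x / ε)) (ε / (ε ^ 2 + x ^ 2)) x := by
    intro x
    refine ((hasDerivAt_id x).div_const ε).arctan.congr_deriv ?_
    simp only [id]
    field_simp
  rw [intervalIntegral.integral_eq_sub_of_hasDerivAt (fun x _ => hd x)
    (Continuous.intervalIntegrable (Continuous.div (by fun_prop) (by fun_prop)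
      fun x => by positivity) _ _)]
  simp only [zero_div, Real.arctan_zero, sub_zero]
  linarith [Real.arctan_lt_pi_div_two (Real.pi / ε), Real.pi_lt_d2]

/-- Kernels dominated by the Poisson kernel of the half plane, paired with functions vanishing at
the origin. -/
theorem tendsto_integral_mul_of_le_poisson {κ : ℝ → ℝ → ℝ} {δ : ℝ → ℝ} {C : ℝ} (hC : 0 < C)
    (hκ : ∀ r x : ℝ, 1 / 2 ≤ r → r < 1 → 0 < x → x ≤ Real.pi →
      |κ r x| ≤ C * ((1 - r) / ((1 - r) ^ 2 + x ^ 2)))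
    (hδ : ∀ η > 0, ∃ M : ℝ, 0 ≤ M ∧ ∀ x, 0 < x → x ≤ Real.pi → |δ x| ≤ η + M * x ^ 2) :
    Tendsto (fun r => ∫ x in (0 : ℝ)..Real.pi, κ r x * δ x) (𝓝[<] 1) (𝓝 0) := by
  rw [Metric.tendsto_nhds]
  intro η hη
  -- The constant part contributes at most `η/4` times a kernel mass of at most `2`; the `x²` part
  -- cancels the concentration of the kernel and is `O(1 - r)`.
  obtain ⟨M, hM₀, hM⟩ := hδ (η / (4 * C)) (by positivity)
  have hev : ∀ᶠ r : ℝ in 𝓝[<] 1, C * M * (1 - r) * Real.pi < η / 2 := by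
    have : Tendsto (fun r : ℝ => C * M * (1 - r) * Real.pi) (𝓝[<] 1)
        (𝓝 (C * M * (1 - 1) * Real.pi)) :=
      (Continuous.tendsto (by fun_prop) _).mono_left nhdsWithin_le_nhds
    exact this.eventually (gt_mem_nhds (by simpa using by positivity))
  filter_upwards [hev, Ioo_mem_nhdsLT (show (1 / 2 : ℝ) < 1 by norm_num)] with r hr hr2
  have hε : 0 < 1 - r := by linarith [hr2.2]
  rw [dist_zero_right]
  have hcont : Continuous fun x : ℝ => (1 - r) / ((1 - r) ^ 2 + x ^ 2) :=
    Continuous.div (by fun_prop) (by fun_prop) fun x => by positivity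
  have hb : ‖∫ x in (0 : ℝ)..Real.pi, κ r x * δ x‖ ≤ ∫ x in (0 : ℝ)..Real.pi,
      (η / 4 * ((1 - r) / ((1 - r) ^ 2 + x ^ 2)) + C * M * (1 - r)) := by
    refine intervalIntegral.norm_integral_le_of_norm_le Real.pi_pos.le
      (Eventually.of_forall fun x hx => ?_)
      (Continuous.intervalIntegrable (by fun_prop) _ _)
    rw [norm_mul, Real.norm_eq_abs, Real.norm_eq_abs]
    calc |κ r x| * |δ x| ≤ (C * ((1 - r) / ((1 - r) ^ 2 + x ^ 2))) * (η / (4 * C) + M * x ^ 2) :=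
          mul_le_mul (hκ r x hr2.1.le hr2.2 hx.1 hx.2) (hM x hx.1 hx.2) (abs_nonneg _)
            (by positivity)
      _ = η / 4 * ((1 - r) / ((1 - r) ^ 2 + x ^ 2)) +
            C * M * (1 - r) * (x ^ 2 / ((1 - r) ^ 2 + x ^ 2)) := by field_simp
      _ ≤ η / 4 * ((1 - r) / ((1 - r) ^ 2 + x ^ 2)) + C * M * (1 - r) * 1 := by
          gcongr
          rw [div_le_one (by positivity)]
          nlinarith
      _ = _ := by rw [mul_one]
  refine hb.trans_lt ?_
  rw [intervalIntegral.integral_add (Continuous.intervalIntegrable (by fun_prop) _ _)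
    (by simp), intervalIntegral.integral_const_mul, intervalIntegral.integral_const]
  have := integral_div_sq_add_sq_le hε
  simp only [sub_zero, smul_eq_mul]
  nlinarith [mul_le_mul_of_nonneg_left this (show 0 ≤ η / 4 by positivity)]

/-- Near zero the limit gives `η`; away from zero a bounded quantity is absorbed by a large multiple
of `x²`. -/
theorem exists_abs_le_add_mul_sq {q : ℝ → ℝ} (hq : Continuous q) {n : ℕ}
    (hq0 : Tendsto (fun x => q x / x ^ n) (𝓝[>] 0) (𝓝 0)) {η : ℝ} (hη : 0 < η) :
    ∃ M : ℝ, 0 ≤ M ∧ ∀ x, 0 < x → x ≤ Real.pi → |q x / x ^ n| ≤ η + M * x ^ 2 := by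
  obtain ⟨B, hB⟩ := (isCompact_Icc (a := (0 : ℝ)) (b := Real.pi)).exists_bound_of_continuousOn
    hq.continuousOn
  have hev := (Metric.tendsto_nhds.1 hq0) η hη
  obtain ⟨d, hd, hd2⟩ := mem_nhdsGT_iff_exists_Ioo_subset.1 hev
  have hd' : (0 : ℝ) < d := hd
  have hB₀ : 0 ≤ B := (norm_nonneg _).trans (hB 0 ⟨le_rfl, Real.pi_pos.le⟩)
  refine ⟨B / d ^ (n + 2), by positivity, fun x hx₀ hx₁ => ?_⟩
  by_cases hx : x < d
  · have := hd2 ⟨hx₀, hx⟩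
    simp only [mem_ofPred_eq, dist_zero_right, Real.norm_eq_abs] at this
    have : 0 ≤ B / d ^ (n + 2) * x ^ 2 := by positivity
    linarith
  · have hxd := not_lt.1 hx
    rw [abs_div, abs_of_pos (pow_pos hx₀ n)]
    have h1 : |q x| / x ^ n ≤ B / d ^ n := by
      gcongr
      exact hB x ⟨hx₀.le, hx₁⟩
    have h2 : B / d ^ n ≤ B / d ^ (n + 2) * x ^ 2 := by
      rw [pow_add, ← div_div, div_mul_eq_mul_div, le_div_iff₀ (by positivity)]
      gcongr
    linarith

/-! ### Principal values of cotangent integrals -/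

theorem continuousOn_cot_half : ContinuousOn (fun x : ℝ => Real.cot (x / 2)) (Ioo 0 (2 * Real.pi)) := by
  have : (fun x : ℝ => Real.cot (x / 2)) = fun x => Real.cos (x / 2) / Real.sin (x / 2) := by
    ext x; exact Real.cot_eq_cos_div_sin _
  rw [this]
  refine ContinuousOn.div (by fun_prop) (by fun_prop) fun x hx => ?_
  exact (Real.sin_pos_of_pos_of_lt_pi (by linarith [hx.1]) (by linarith [hx.2])).ne'

theorem intervalIntegrable_cot_half_mul {p : ℝ → ℝ} (hp : Continuous p) {a b : ℝ} (ha₀ : 0 < a)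
    (ha₁ : a < 2 * Real.pi) (hb₀ : 0 < b) (hb₁ : b < 2 * Real.pi) :
    IntervalIntegrable (fun x => Real.cot (x / 2) * p x) MeasureTheory.volume a b := by
  refine ContinuousOn.intervalIntegrable (ContinuousOn.mul (continuousOn_cot_half.mono ?_)
    hp.continuousOn)
  intro x hx
  rw [mem_uIcc] at hx
  constructor <;> rcases hx with h | h <;> linarith [h.1, h.2]

/-- The conjugate Poisson integral and the integral against the truncated cotangent are
equivalent. -/
theorem tendsto_integral_conjPoisson_sub_cot {p : ℝ → ℝ} (hp : Continuous p) (hp0 : p 0 = 0) :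
    Tendsto (fun r => (∫ x in (0 : ℝ)..Real.pi, conjPoisson r x * p x) -
      ∫ x in (1 - r)..Real.pi, Real.cot (x / 2) * p x) (𝓝[<] 1) (𝓝 0) := by
  have h := tendsto_integral_mul_of_le_poisson (δ := p) (C := 10) (by norm_num)
    (κ := fun r x => conjPoisson r x -
      (Ioc (1 - r) Real.pi).indicator (fun y => Real.cot (y / 2)) x)
    (fun r x h1 h2 h3 h4 => abs_conjPoisson_sub_indicator_le h1 h2 h3 h4)
    (fun η hη => by
      have := exists_abs_le_add_mul_sq (n := 0) hp (by
        simpa [hp0] using (hp.tendsto 0).mono_left nhdsWithin_le_nhds) hη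
      simpa using this)
  refine h.congr' ?_
  filter_upwards [Ioo_mem_nhdsLT (show (0 : ℝ) < 1 by norm_num)] with r hr
  have hε : 0 < 1 - r := by linarith [hr.2]
  have hεpi : 1 - r ≤ Real.pi := by linarith [hr.1, Real.pi_gt_three]
  have hQ := continuous_conjPoisson hr.1.le hr.2
  have hind : (fun x => (Ioc (1 - r) Real.pi).indicator (fun y => Real.cot (y / 2)) x * p x) =
      (Ioc (1 - r) Real.pi).indicator (fun x => Real.cot (x / 2) * p x) := by
    ext x
    by_cases hx : x ∈ Ioc (1 - r) Real.pi <;> simp [hx]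
  have hcot := intervalIntegrable_cot_half_mul hp hε (b := Real.pi) (by linarith [Real.pi_pos])
    Real.pi_pos (by linarith [Real.pi_pos])
  have hsub : Ioc (1 - r) Real.pi ⊆ Ioc 0 Real.pi := Ioc_subset_Ioc_left hε.le
  have hval : ∫ x in (0 : ℝ)..Real.pi,
      (Ioc (1 - r) Real.pi).indicator (fun x => Real.cot (x / 2) * p x) x =
      ∫ x in (1 - r)..Real.pi, Real.cot (x / 2) * p x := by
    rw [intervalIntegral.integral_of_le Real.pi_pos.le, intervalIntegral.integral_of_le hεpi,
      MeasureTheory.setIntegral_indicator measurableSet_Ioc, inter_eq_right.2 hsub]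
  have hii : IntervalIntegrable ((Ioc (1 - r) Real.pi).indicator
      (fun x => Real.cot (x / 2) * p x)) MeasureTheory.volume 0 Real.pi := by
    rw [intervalIntegrable_iff_integrableOn_Ioc_of_le Real.pi_pos.le]
    rw [intervalIntegrable_iff_integrableOn_Ioc_of_le hεpi] at hcot
    exact (hcot.integrable_indicator measurableSet_Ioc).integrableOn
  simp only [sub_mul]
  rw [← hval, ← hind, ← intervalIntegral.integral_sub (Continuous.intervalIntegrable (by fun_prop) _ _)
    (by rw [hind]; exact hii)]

theorem tendsto_integral_cot_half_of_tendsto {p : ℝ → ℝ} (hp : Continuous p) (hp0 : p 0 = 0)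
    {l : ℝ} (h : Tendsto (fun r => ∫ x in (0 : ℝ)..Real.pi, conjPoisson r x * p x)
      (𝓝[<] 1) (𝓝 l)) :
    Tendsto (fun ε => ∫ x in ε..Real.pi, Real.cot (x / 2) * p x) (𝓝[>] 0) (𝓝 l) := by
  have h1 := h.sub (tendsto_integral_conjPoisson_sub_cot hp hp0)
  simp only [sub_sub_cancel, sub_zero] at h1
  have h2 : Tendsto (fun ε : ℝ => 1 - ε) (𝓝[>] 0) (𝓝[<] 1) := by
    refine tendsto_nhdsWithin_iff.2 ⟨?_, ?_⟩
    · have : Tendsto (fun ε : ℝ => 1 - ε) (𝓝 0) (𝓝 (1 - 0)) := Continuous.tendsto (by fun_prop) _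
      rw [sub_zero] at this
      exact this.mono_left nhdsWithin_le_nhds
    · filter_upwards [self_mem_nhdsWithin] with ε hε
      exact mem_Iio.2 (sub_lt_self _ (mem_Ioi.1 hε))
  have h3 := h1.comp h2
  simpa [Function.comp_def] using h3

/-- By the equivalence with the truncated cotangent it suffices that `cot(x/2) sin x = 1 + cos x`
integrates to `π` over `[0, π]`. -/
theorem tendsto_integral_conjPoisson_mul_sin :
    Tendsto (fun r => ∫ x in (0 : ℝ)..Real.pi, conjPoisson r x * Real.sin x)
      (𝓝[<] 1) (𝓝 Real.pi) := by
  have h := tendsto_integral_conjPoisson_sub_cot Real.continuous_sin Real.sin_zero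
  have hF : ∀ ε ∈ Ioo (0 : ℝ) 1, ∫ x in ε..Real.pi, Real.cot (x / 2) * Real.sin x =
      Real.pi - ε - Real.sin ε := by
    intro ε hε
    have h1 : ∀ x ∈ uIcc ε Real.pi, Real.cot (x / 2) * Real.sin x = 1 + Real.cos x := by
      intro x hx
      rw [uIcc_of_le (by linarith [hε.2, Real.pi_gt_three])] at hx
      have hs : Real.sin (x / 2) ≠ 0 := (Real.sin_pos_of_pos_of_lt_pi (by linarith [hx.1, hε.1])
        (by linarith [hx.2, Real.pi_pos])).ne'
      have h2 := Real.sin_two_mul (x / 2)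
      have h3 := Real.cos_two_mul (x / 2)
      rw [mul_div_cancel₀ x two_ne_zero] at h2 h3
      rw [h2, h3, Real.cot_eq_cos_div_sin]
      field_simp
      ring
    rw [intervalIntegral.integral_congr h1, intervalIntegral.integral_add
      (by simp) (Real.continuous_cos.intervalIntegrable _ _), integral_cos]
    simp
    ring
  have h2 : Tendsto (fun r : ℝ => ∫ x in (1 - r)..Real.pi, Real.cot (x / 2) * Real.sin x)
      (𝓝[<] 1) (𝓝 Real.pi) := by
    have h3 : Tendsto (fun r : ℝ => Real.pi - (1 - r) - Real.sin (1 - r)) (𝓝[<] 1)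
        (𝓝 (Real.pi - (1 - 1) - Real.sin (1 - 1))) :=
      (Continuous.tendsto (by fun_prop) _).mono_left nhdsWithin_le_nhds
    simp only [sub_self, Real.sin_zero, sub_zero] at h3
    refine h3.congr' ?_
    filter_upwards [Ioo_mem_nhdsLT (show (0 : ℝ) < 1 by norm_num)] with r hr
    exact (hF _ ⟨by linarith [hr.2], by linarith [hr.1]⟩).symm
  simpa using h.add h2

/-- If the conjugate function `v` is differentiable at `θ`, then the principal value of the
cotangent integral of `u'` at `θ` exists and is `-2π v'(θ)`. -/
theorem tendsto_integral_cot_half_of_hasDerivAt {v w : ℝ → ℝ} (hv : Continuous v)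
    (hw : Continuous w) {θ d : ℝ} (hd : HasDerivAt v d θ)
    (hvw : ∀ r, 0 ≤ r → r < 1 →
      ∫ x in (0 : ℝ)..Real.pi, conjPoisson r x * (w (θ + x) - w (θ - x)) =
      -2 * ∫ x in (0 : ℝ)..Real.pi, poissonSlope r x * (v (θ + x) - v (θ - x))) :
    Tendsto (fun ε => ∫ x in ε..Real.pi, Real.cot (x / 2) * (w (θ + x) - w (θ - x)))
      (𝓝[>] 0) (𝓝 (-(2 * Real.pi * d))) := by
  refine tendsto_integral_cot_half_of_tendsto (by fun_prop) (by simp) ?_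
  -- Subtracting `2d sin x`, whose integral is known, leaves a remainder that is `o(x)` at `0`.
  -- Dividing it by `x` and giving the `x` to the kernel reduces the claim to the approximate
  -- identity.
  set q : ℝ → ℝ := fun x => v (θ + x) - v (θ - x) - 2 * d * Real.sin x with hq
  have hqc : Continuous q := by fun_prop
  have hqd : HasDerivAt q 0 0 := by
    have h1 : HasDerivAt (fun x => v (θ + x)) d 0 := by
      have hd' : HasDerivAt v d (θ + 0) := by simpa using hd
      simpa [Function.comp_def] using hd'.comp (0 : ℝ) ((hasDerivAt_id (0 : ℝ)).const_add θ)
    have h2 : HasDerivAt (fun x => v (θ - x)) (-d) 0 := by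
      have hd' : HasDerivAt v d (θ - 0) := by simpa using hd
      simpa [Function.comp_def] using hd'.comp (0 : ℝ) ((hasDerivAt_id (0 : ℝ)).const_sub θ)
    refine ((h1.sub h2).sub ((Real.hasDerivAt_sin 0).const_mul (2 * d))).congr_deriv ?_
    simp; ring
  have hq1 : Tendsto (fun x => q x / x ^ 1) (𝓝[>] 0) (𝓝 0) := by
    have := (hasDerivAt_iff_tendsto_slope.1 hqd).mono_left
      (nhdsWithin_mono 0 (fun x (hx : (0 : ℝ) < x) => hx.ne' : Ioi (0 : ℝ) ⊆ {0}ᶜ))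
    refine this.congr fun x => ?_
    simp [slope_def_field, hq]
  have hB := tendsto_integral_mul_of_le_poisson (C := 50) (by norm_num)
    (κ := fun r x => poissonSlope r x * x) (δ := fun x => q x / x ^ 1)
    (fun r x h1 h2 h3 h4 => abs_poissonSlope_mul_le h1 h2 h3 h4)
    (fun η hη => exists_abs_le_add_mul_sq hqc hq1 hη)
  have h := (hB.const_mul (-2)).sub (tendsto_integral_conjPoisson_mul_sin.const_mul (2 * d))
  rw [show (-2 * 0 - 2 * d * Real.pi : ℝ) = -(2 * Real.pi * d) by ring] at h
  refine h.congr' ?_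
  filter_upwards [Ioo_mem_nhdsLT (show (0 : ℝ) < 1 by norm_num)] with r hr
  have hc1 := continuous_poissonSlope hr.1.le hr.2
  have e1 : ∫ x in (0 : ℝ)..Real.pi, poissonSlope r x * x * (q x / x ^ 1) =
      ∫ x in (0 : ℝ)..Real.pi, (poissonSlope r x * (v (θ + x) - v (θ - x)) -
        2 * d * (poissonSlope r x * Real.sin x)) := by
    refine intervalIntegral.integral_congr fun x _ => ?_
    rcases eq_or_ne x 0 with rfl | hx
    · simp
    · simp only [hq, pow_one]
      field_simp
  rw [hvw r hr.1.le hr.2, e1, intervalIntegral.integral_sub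
    (Continuous.intervalIntegrable (by fun_prop) _ _)
    (Continuous.intervalIntegrable (by fun_prop) _ _), intervalIntegral.integral_const_mul,
    integral_conjPoisson_mul_sin hr.1.le hr.2]
  ring

theorem intervalIntegral_cot_half_reflect (w : ℝ → ℝ) (θ a b : ℝ)
    (hper : Function.Periodic w (2 * Real.pi)) :
    ∫ x in a..(2 * Real.pi - b), Real.cot (x / 2) * w (θ + x) =
      ∫ x in b..(2 * Real.pi - a), -(Real.cot (x / 2) * w (θ - x)) := by
  have h := intervalIntegral.integral_comp_sub_left
    (fun x => Real.cot (x / 2) * w (θ + x)) (2 * Real.pi) (a := b) (b := 2 * Real.pi - a)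
  rw [sub_sub_cancel] at h
  rw [← h]
  refine intervalIntegral.integral_congr fun x _ => ?_
  have h1 : Real.cot ((2 * Real.pi - x) / 2) = -Real.cot (x / 2) := by
    rw [show (2 * Real.pi - x) / 2 = Real.pi - x / 2 by ring, Real.cot_eq_cos_div_sin,
      Real.cot_eq_cos_div_sin, Real.cos_pi_sub, Real.sin_pi_sub, neg_div]
  have h2 := hper (θ - x)
  simp only [h1]
  rw [show θ + (2 * Real.pi - x) = θ - x + 2 * Real.pi by ring, h2]
  ring

/-- Asymmetric truncations give the same principal value if they are asymptotically symmetric. -/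
theorem tendsto_integral_cot_half_asymmetric {w : ℝ → ℝ} (hw : Continuous w)
    (hper : Function.Periodic w (2 * Real.pi)) {θ l : ℝ}
    (h : Tendsto (fun ε => ∫ x in ε..Real.pi, Real.cot (x / 2) * (w (θ + x) - w (θ - x)))
      (𝓝[>] 0) (𝓝 l)) {ι : Type*} {F : Filter ι} {a b : ι → ℝ}
    (ha : Tendsto a F (𝓝[>] 0)) (hb : Tendsto b F (𝓝[>] 0))
    (hab : Tendsto (fun i => b i / a i) F (𝓝 1)) :
    Tendsto (fun i => ∫ x in a i..(2 * Real.pi - b i), Real.cot (x / 2) * w (θ + x)) F (𝓝 l) := by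
  have hpi := Real.pi_gt_three
  obtain ⟨M, hM⟩ := (isCompact_Icc (a := θ - 1) (b := θ + 1)).exists_bound_of_continuousOn
    hw.continuousOn
  have hM₀ : 0 ≤ M := (norm_nonneg _).trans (hM θ ⟨by linarith, by linarith⟩)
  have haI : ∀ᶠ i in F, a i ∈ Ioo 0 1 := ha (Ioo_mem_nhdsGT one_pos)
  have hbI : ∀ᶠ i in F, b i ∈ Ioo 0 1 := hb (Ioo_mem_nhdsGT one_pos)
  -- The asymmetry costs an integral between `a` and `b`, where the cotangent is at most `4/a`; it
  -- is bounded by `4M|b/a - 1|`.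
  have herr : Tendsto (fun i => ∫ x in a i..b i, Real.cot (x / 2) * w (θ - x)) F (𝓝 0) := by
    have hlim : Tendsto (fun i => 4 * M * |b i / a i - 1|) F (𝓝 0) := by
      simpa using ((hab.sub_const 1).abs).const_mul (4 * M)
    refine squeeze_zero_norm' ?_ hlim
    filter_upwards [haI, hbI, hab.eventually (lt_mem_nhds (show (1 / 2 : ℝ) < 1 by norm_num))]
      with i hai hbi hr
    have hb2 : a i / 2 < b i := by
      rw [lt_div_iff₀ hai.1] at hr
      linarith
    have := intervalIntegral.norm_integral_le_of_norm_le_const (a := a i) (b := b i)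
      (f := fun x => Real.cot (x / 2) * w (θ - x)) (C := 4 / a i * M) fun x hx => by
        have hx1 : a i / 2 ≤ x ∧ x ≤ 1 := by
          rw [mem_uIoc] at hx
          constructor <;> rcases hx with h | h <;> linarith [h.1, h.2, hai.1, hai.2, hbi.1, hbi.2]
        have hx0 : 0 < x := by linarith [hai.1]
        have hxpi : x ≤ Real.pi := by linarith
        rw [norm_mul, Real.norm_of_nonneg (cot_half_nonneg hx0 hxpi)]
        have hai' := hai.1
        gcongr
        · refine (cot_half_le hx0 hxpi).trans ?_
          rw [div_le_div_iff₀ hx0 hai.1]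
          linarith
        · exact hM _ ⟨by linarith, by linarith⟩
    refine this.trans (le_of_eq ?_)
    have hai' := hai.1
    have : |b i / a i - 1| = |b i - a i| / a i := by
      rw [← abs_of_pos hai.1, ← abs_div, abs_of_pos hai.1]
      congr 1
      field_simp
    rw [this]
    ring
  have h2 := (h.comp ha).add herr
  rw [add_zero] at h2
  refine h2.congr' ?_
  filter_upwards [haI, hbI] with i hai hbi
  have hI : ∀ {p : ℝ → ℝ}, Continuous p → ∀ {a b : ℝ}, 0 < a → a ≤ 4 → 0 < b → b < 2 * Real.pi →
      IntervalIntegrable (fun x => Real.cot (x / 2) * p x) MeasureTheory.volume a b :=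
    fun hp _ _ h1 h2 h3 h4 => intervalIntegrable_cot_half_mul hp h1 (by linarith) h3 h4
  have hp4 : Real.pi ≤ 4 := Real.pi_le_four
  have c1 : Continuous fun x => w (θ + x) := by fun_prop
  have c2 : Continuous fun x => w (θ - x) := by fun_prop
  have e1 : ∫ x in Real.pi..(2 * Real.pi - b i), Real.cot (x / 2) * w (θ + x) =
      -∫ x in b i..Real.pi, Real.cot (x / 2) * w (θ - x) := by
    rw [intervalIntegral_cot_half_reflect w θ _ _ hper, intervalIntegral.integral_neg]
    congr 2
    ring
  rw [← intervalIntegral.integral_add_adjacent_intervals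
    (hI c1 hai.1 (by linarith [hai.2]) Real.pi_pos (by linarith))
    (hI c1 Real.pi_pos hp4 (b := 2 * Real.pi - b i) (by linarith [hbi.2]) (by linarith [hbi.1])),
    e1, ← intervalIntegral.integral_add_adjacent_intervals
      (hI c2 hbi.1 (by linarith [hbi.2]) (b := a i) hai.1 (by linarith [hai.2]))
      (hI c2 hai.1 (by linarith [hai.2]) Real.pi_pos (by linarith)),
    intervalIntegral.integral_symm (a i) (b i)]
  simp only [Function.comp, mul_sub]
  rw [intervalIntegral.integral_sub
    (hI c1 hai.1 (by linarith [hai.2]) Real.pi_pos (by linarith))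
    (hI c2 hai.1 (by linarith [hai.2]) Real.pi_pos (by linarith))]
  ring

/-! ### Differentiability of the conjugate function -/

/-- The Poisson integral formula on the circle of radius `r`. -/
theorem eq_integral_poisson {k : ℂ → ℂ} (hk : Continuous k)
    (hkd : DifferentiableOn ℂ k (Metric.ball 0 1)) {r : ℝ} (hr₀ : 0 ≤ r) (hr₁ : r < 1) (θ : ℝ) :
    (k (r * Complex.exp (θ * Complex.I))).im = (2 * Real.pi)⁻¹ *
      ∫ t in (0 : ℝ)..2 * Real.pi, (1 - r ^ 2) / circleDistSq r (t - θ) *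
        (k (Complex.exp (t * Complex.I))).im := by
  have hd : DiffContOnCl ℂ k (Metric.ball 0 1) := ⟨hkd, hk.continuousOn⟩
  have hmem : (r * Complex.exp (θ * Complex.I) : ℂ) ∈ Metric.ball (0 : ℂ) 1 := by
    rw [mem_ball_zero_iff, norm_mul, Complex.norm_exp_ofReal_mul_I, Complex.norm_real,
      Real.norm_of_nonneg hr₀, mul_one]
    exact hr₁
  have h := hd.circleAverage_poissonKernel_smul' hmem
  rw [Real.circleAverage_def] at h
  have hint : ∀ t : ℝ, ((‖circleMap 0 1 t - 0‖ ^ 2 -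
      ‖(r * Complex.exp (θ * Complex.I) : ℂ) - 0‖ ^ 2) /
      ‖circleMap 0 1 t - 0 - ((r * Complex.exp (θ * Complex.I) : ℂ) - 0)‖ ^ 2) •
        k (circleMap 0 1 t) =
      (((1 - r ^ 2) / circleDistSq r (t - θ) : ℝ) : ℂ) * k (Complex.exp (t * Complex.I)) := by
    intro t
    have h1 : circleDistSq r (t - θ) =
        ‖circleMap 0 1 t - r * Complex.exp (θ * Complex.I)‖ ^ 2 := by
      have h2 : circleMap 0 1 t - r * Complex.exp (θ * Complex.I) = Complex.exp (t * Complex.I) *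
          (1 - r * Complex.exp ((-(t - θ) : ℝ) * Complex.I)) := by
        simp only [circleMap, zero_add, Complex.ofReal_one, one_mul]
        push_cast
        rw [mul_sub, mul_one, mul_left_comm, ← Complex.exp_add]
        congr 3
        ring
      rw [h2, norm_mul, Complex.norm_exp_ofReal_mul_I, one_mul, ← Complex.normSq_eq_norm_sq,
        normSq_one_sub_polar, circleDistSq, circleDistSq, Real.cos_neg]
    rw [sub_zero, sub_zero, ← h1, norm_mul, Complex.norm_exp_ofReal_mul_I, Complex.norm_real,
      Real.norm_of_nonneg hr₀, mul_one, norm_circleMap_zero]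
    simp [circleMap]
  simp only [hint] at h
  have hP : Continuous fun t => (1 - r ^ 2) / circleDistSq r (t - θ) :=
    Continuous.div (by fun_prop) ((continuous_circleDistSq r).comp (by fun_prop))
      fun t => (circleDistSq_pos hr₀ hr₁ _).ne'
  rw [← h, Complex.smul_im, smul_eq_mul]
  congr 1
  have := Complex.imCLM.intervalIntegral_comp_comm (a := 0) (b := 2 * Real.pi)
    (μ := MeasureTheory.volume)
    (f := fun t : ℝ => (((1 - r ^ 2) / circleDistSq r (t - θ) : ℝ) : ℂ) *
      k (Complex.exp (t * Complex.I))) (Continuous.intervalIntegrable (by fun_prop) _ _)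
  rw [Complex.imCLM_apply] at this
  rw [← this]
  refine intervalIntegral.integral_congr fun t _ => ?_
  simp only [Complex.imCLM_apply, Complex.im_ofReal_mul]

/-- Differentiate the Poisson integral of `v` under the integral sign, then exchange `v` for `u'` by
the conjugacy identity. The derivative is thus expressed by data whose limit `r → 1` is controlled.
-/
theorem hasDerivAt_im_polar {k : ℂ → ℂ} (hk : Continuous k)
    (hkd : DifferentiableOn ℂ k (Metric.ball 0 1)) {w : ℝ → ℝ} (hw : Continuous w)
    (hu : ∀ t : ℝ, HasDerivAt (fun t : ℝ => (k (Complex.exp (t * Complex.I))).re) (w t) t)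
    {r : ℝ} (hr₀ : 0 ≤ r) (hr₁ : r < 1) (θ : ℝ) :
    HasDerivAt (fun θ : ℝ => (k (r * Complex.exp (θ * Complex.I))).im)
      (-(2 * Real.pi)⁻¹ * ∫ x in (0 : ℝ)..2 * Real.pi, conjPoisson r x * w (θ + x)) θ := by
  have hB := continuous_poissonSlope hr₀ hr₁
  have hv : Continuous fun t : ℝ => (k (Complex.exp (t * Complex.I))).im := by fun_prop
  have hfun : (fun θ : ℝ => (k (r * Complex.exp (θ * Complex.I))).im) = fun θ : ℝ =>
      (2 * Real.pi)⁻¹ * ∫ t in (0 : ℝ)..2 * Real.pi, (1 - r ^ 2) / circleDistSq r (t - θ) *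
        (k (Complex.exp (t * Complex.I))).im := funext fun θ => eq_integral_poisson hk hkd hr₀ hr₁ θ
  rw [hfun]
  have hP : ∀ θ : ℝ, Continuous fun t => (1 - r ^ 2) / circleDistSq r (t - θ) := fun θ =>
    Continuous.div (by fun_prop) ((continuous_circleDistSq r).comp (by fun_prop))
      fun t => (circleDistSq_pos hr₀ hr₁ _).ne'
  have hcpt : Continuous fun p : ℝ × ℝ => 2 * poissonSlope r (p.2 - p.1) *
      (k (Complex.exp (p.2 * Complex.I))).im := by fun_prop
  obtain ⟨M, hM⟩ := ((isCompact_Icc (a := θ - 1) (b := θ + 1)).prod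
    (isCompact_Icc (a := 0) (b := 2 * Real.pi))).exists_bound_of_continuousOn hcpt.continuousOn
  have hder := (intervalIntegral.hasDerivAt_integral_of_dominated_loc_of_deriv_le
    (μ := MeasureTheory.volume) (a := 0) (b := 2 * Real.pi) (x₀ := θ) (s := Icc (θ - 1) (θ + 1))
    (F := fun θ t => (1 - r ^ 2) / circleDistSq r (t - θ) * (k (Complex.exp (t * Complex.I))).im)
    (F' := fun θ t => 2 * poissonSlope r (t - θ) * (k (Complex.exp (t * Complex.I))).im)
    (bound := fun _ => M) (Icc_mem_nhds (by linarith) (by linarith))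
    (Eventually.of_forall fun θ' => ((hP θ').mul hv).aestronglyMeasurable)
    (((hP θ).mul hv).intervalIntegrable _ _)
    (Continuous.aestronglyMeasurable (by fun_prop))
    (Eventually.of_forall fun t ht x hx => hM (x, t) ⟨hx, by
      rw [uIoc_of_le (by positivity)] at ht
      exact ⟨ht.1.le, ht.2⟩⟩)
    (by simp)
    (Eventually.of_forall fun t _ x _ => by
      have := (hasDerivAt_poisson hr₀ hr₁ (t - x)).comp x ((hasDerivAt_id x).const_sub t)
      simpa [Function.comp_def] using this.mul_const _)).2
  refine (hder.const_mul (2 * Real.pi)⁻¹).congr_deriv ?_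
  rw [integral_conjPoisson_mul_deriv hk hkd hw hu hr₀ hr₁ θ]
  have hshift : ∫ t in (0 : ℝ)..2 * Real.pi, 2 * poissonSlope r (t - θ) *
      (k (Complex.exp (t * Complex.I))).im = 2 * ∫ x in (0 : ℝ)..2 * Real.pi,
        poissonSlope r x * (k (Complex.exp (((θ + x : ℝ) : ℂ) * Complex.I))).im := by
    have hper : Function.Periodic (fun t : ℝ => 2 * poissonSlope r (t - θ) *
      (k (Complex.exp (t * Complex.I))).im) (2 * Real.pi) := by
      intro t
      have h1 : Complex.exp (((t + 2 * Real.pi : ℝ) : ℂ) * Complex.I) =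
          Complex.exp (t * Complex.I) := by
        push_cast
        rw [add_mul, Complex.exp_add, Complex.exp_two_pi_mul_I, mul_one]
      have h2 : poissonSlope r (t + 2 * Real.pi - θ) = poissonSlope r (t - θ) := by
        rw [show t + 2 * Real.pi - θ = t - θ + 2 * Real.pi by ring]
        simp [poissonSlope, circleDistSq]
      simp only [h1, h2]
    have h := hper.intervalIntegral_add_eq 0 θ
    rw [zero_add] at h
    rw [h, ← intervalIntegral.integral_const_mul]
    have h3 := intervalIntegral.integral_comp_add_left (a := 0) (b := 2 * Real.pi)
      (fun t : ℝ => 2 * poissonSlope r (t - θ) * (k (Complex.exp (t * Complex.I))).im) θ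
    rw [add_zero] at h3
    rw [← h3]
    refine intervalIntegral.integral_congr fun x _ => ?_
    simp only [add_sub_cancel_left]
    ring
  rw [hshift]
  ring

/-- If `u'` is Hölder continuous, then the conjugate function is differentiable. -/
theorem exists_hasDerivAt_im_circle {k : ℂ → ℂ} (hk : Continuous k)
    (hkd : DifferentiableOn ℂ k (Metric.ball 0 1)) {w : ℝ → ℝ} (hw : Continuous w)
    (hper : Function.Periodic w (2 * Real.pi))
    (hu : ∀ t : ℝ, HasDerivAt (fun t : ℝ => (k (Complex.exp (t * Complex.I))).re) (w t) t)
    {C β : ℝ} (hC : 0 ≤ C) (hβ₀ : 0 < β) (hβ₁ : β ≤ 1)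
    (hHol : ∀ x y : ℝ, |w x - w y| ≤ C * |x - y| ^ β) (θ : ℝ) :
    ∃ d : ℝ, HasDerivAt (fun t : ℝ => (k (Complex.exp (t * Complex.I))).im) d θ := by
  have hpi := Real.pi_pos
  -- The candidate derivative; Hölder continuity makes the integral absolutely convergent.
  set g : ℝ → ℝ := fun θ => -(2 * Real.pi)⁻¹ *
    ∫ x in (0 : ℝ)..Real.pi, Real.cot (x / 2) * (w (θ + x) - w (θ - x)) with hg
  refine ⟨g θ, ?_⟩
  have hp : ∀ θ x : ℝ, 0 < x → |w (θ + x) - w (θ - x)| ≤ 2 * C * x ^ β := by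
    intro θ x hx
    have h1 := hHol (θ + x) (θ - x)
    rw [show θ + x - (θ - x) = 2 * x by ring, abs_of_pos (show 0 < 2 * x by positivity),
      Real.mul_rpow zero_le_two hx.le] at h1
    have h2 : (2 : ℝ) ^ β ≤ 2 := by
      simpa using Real.rpow_le_rpow_of_exponent_le one_le_two hβ₁
    have h3 : 0 ≤ x ^ β := by positivity
    calc _ ≤ _ := h1
      _ ≤ C * (2 * x ^ β) := by gcongr
      _ = _ := by ring
  have hxint : ∀ c : ℝ, 0 < c → IntervalIntegrable (fun x : ℝ => x ^ (c - 1))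
      MeasureTheory.volume 0 Real.pi := fun c hc =>
    intervalIntegral.intervalIntegrable_rpow' (by linarith)
  have hcint : ∀ θ : ℝ, IntervalIntegrable
      (fun x => Real.cot (x / 2) * (w (θ + x) - w (θ - x))) MeasureTheory.volume 0 Real.pi := by
    intro θ
    refine ((hxint β hβ₀).const_mul (4 * C)).mono_fun ?_ ?_
    · rw [uIoc_of_le hpi.le]
      refine ContinuousOn.aestronglyMeasurable (ContinuousOn.mul (continuousOn_cot_half.mono
        fun x hx => ⟨hx.1, by linarith [hx.2]⟩) (Continuous.continuousOn (by fun_prop)))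
        measurableSet_Ioc
    · rw [uIoc_of_le hpi.le]
      refine (MeasureTheory.ae_restrict_mem measurableSet_Ioc).mono fun x hx => ?_
      have hx0 : 0 < x := hx.1
      simp only []
      rw [norm_mul, Real.norm_of_nonneg (cot_half_nonneg hx.1 hx.2),
        Real.norm_of_nonneg (show (0 : ℝ) ≤ 4 * C * x ^ (β - 1) by positivity)]
      calc _ ≤ 2 / x * (2 * C * x ^ β) := by
            gcongr
            · exact cot_half_le hx.1 hx.2
            · exact hp θ x hx.1
        _ = _ := by rw [Real.rpow_sub_one hx0.ne']; ring
  -- Half of the Hölder exponent pays for the uniform rate `(1 - r)^(β/2)`, the other half keeps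
  -- `x^(β/2 - 1)` integrable at zero.
  have hkey : ∀ r : ℝ, 1 / 2 ≤ r → r < 1 → ∀ θ : ℝ,
      |(∫ x in (0 : ℝ)..Real.pi, Real.cot (x / 2) * (w (θ + x) - w (θ - x))) -
        ∫ x in (0 : ℝ)..Real.pi, conjPoisson r x * (w (θ + x) - w (θ - x))| ≤
      20 * C * (∫ x in (0 : ℝ)..Real.pi, x ^ (β / 2 - 1)) * (1 - r) ^ (β / 2) := by
    intro r hr₀ hr₁ θ
    have hε : 0 < 1 - r := by linarith
    have hQ := continuous_conjPoisson (by linarith) hr₁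
    rw [← intervalIntegral.integral_sub (hcint θ) (Continuous.intervalIntegrable (by fun_prop) _ _),
      mul_right_comm, ← intervalIntegral.integral_const_mul, ← Real.norm_eq_abs]
    refine intervalIntegral.norm_integral_le_of_norm_le hpi.le (Eventually.of_forall fun x hx => ?_)
      ((hxint (β / 2) (by positivity)).const_mul _)
    have hx0 : 0 < x := hx.1
    rw [← sub_mul, norm_mul, Real.norm_eq_abs, Real.norm_eq_abs]
    have hq : (1 - r) ^ 2 / ((1 - r) ^ 2 + x ^ 2) ≤ ((1 - r) / x) ^ (β / 2) := by
      have ht : 0 < (1 - r) / x := by positivity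
      rcases le_total ((1 - r) / x) 1 with h1 | h1
      · calc _ ≤ ((1 - r) / x) ^ (2 : ℝ) := by
              rw [Real.rpow_two, div_pow]
              gcongr
              nlinarith
          _ ≤ _ := Real.rpow_le_rpow_of_exponent_ge ht h1 (by linarith)
      · calc _ ≤ (1 : ℝ) := by
              rw [div_le_one (by positivity)]
              nlinarith
          _ ≤ _ := Real.one_le_rpow h1 (by positivity)
    calc _ ≤ 10 / x * ((1 - r) / x) ^ (β / 2) * (2 * C * x ^ β) := by
          refine mul_le_mul ((abs_cot_half_sub_conjPoisson_le hr₀ hr₁ hx.1 hx.2).trans ?_)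
            (hp θ x hx.1) (abs_nonneg _) (by positivity)
          gcongr
      _ = 20 * C * (1 - r) ^ (β / 2) * x ^ (β / 2 - 1) := by
          have : x ^ β = x ^ (β / 2) * x ^ (β / 2) := by
            rw [← Real.rpow_add hx0, add_halves]
          rw [Real.div_rpow hε.le hx0.le, Real.rpow_sub_one hx0.ne', this]
          have : 0 < x ^ (β / 2) := by positivity
          field_simp
          ring
  -- Over circles of radius `r` the derivatives converge uniformly and the functions pointwise, so
  -- the limit is differentiable.
  refine hasDerivAt_of_tendstoUniformly (𝕜 := ℝ) (l := 𝓝[<] (1 : ℝ))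
    (f := fun r θ : ℝ => (k (r * Complex.exp (θ * Complex.I))).im)
    (f' := fun r θ : ℝ => -(2 * Real.pi)⁻¹ * ∫ x in (0 : ℝ)..2 * Real.pi, conjPoisson r x * w (θ + x))
    (g' := g) ?_ ?_ ?_ θ
  · rw [Metric.tendstoUniformly_iff]
    intro η hη
    have hlim : Tendsto (fun r : ℝ => (2 * Real.pi)⁻¹ *
        (20 * C * (∫ x in (0 : ℝ)..Real.pi, x ^ (β / 2 - 1)) * (1 - r) ^ (β / 2)))
        (𝓝[<] 1) (𝓝 0) := by
      have hc : ContinuousAt (fun r : ℝ => (1 - r) ^ (β / 2)) 1 :=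
        ContinuousAt.rpow_const (by fun_prop) (Or.inr (by positivity))
      have h0 : Tendsto (fun r : ℝ => (1 - r) ^ (β / 2)) (𝓝[<] 1) (𝓝 0) := by
        have := hc.tendsto.mono_left (nhdsWithin_le_nhds (s := Iio (1 : ℝ)))
        rwa [sub_self, Real.zero_rpow (by positivity)] at this
      simpa using (h0.const_mul _).const_mul _
    filter_upwards [hlim.eventually (gt_mem_nhds hη),
      Ioo_mem_nhdsLT (show (1 / 2 : ℝ) < 1 by norm_num)] with r hr hr2 θ
    rw [integral_conjPoisson_mul hw hper (by linarith [hr2.1]) hr2.2, Real.dist_eq, hg, ← mul_sub,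
      abs_mul, abs_neg, abs_of_pos (by positivity)]
    refine lt_of_le_of_lt ?_ hr
    gcongr
    exact hkey r hr2.1.le hr2.2 θ
  · filter_upwards [Ioo_mem_nhdsLT (show (0 : ℝ) < 1 by norm_num)] with r hr θ
    exact hasDerivAt_im_polar hk hkd hw hu hr.1.le hr.2 θ
  · intro θ
    have hc : Continuous fun r : ℝ => (k (r * Complex.exp (θ * Complex.I))).im := by fun_prop
    simpa using (hc.tendsto 1).mono_left nhdsWithin_le_nhds

/-! ### Transfer between arclength and angle -/

theorem exists_inverse_bigPhi_add {φ : ℝ → ℝ} {L : ℝ} (hL : 0 < L) (hφ : Continuous φ)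
    (hpos : ∀ s, 0 < φ s) (hper : Function.Periodic φ L) (θ : ℝ) :
    ∃ S : ℝ → ℝ, Continuous S ∧ (∀ t, bigPhi φ (S t) + θ = t) ∧ (∀ s, S (bigPhi φ s + θ) = s) ∧
      ∀ t, HasDerivAt S (2 * Real.pi * φ (S t))⁻¹ t := by
  have hmono : StrictMono fun s => bigPhi φ s + θ := fun x y h => by
    have := strictMono_bigPhi hφ hpos h
    simpa using this
  have hsurj : Function.Surjective fun s => bigPhi φ s + θ := fun t => by
    obtain ⟨s, hs⟩ := surjective_bigPhi hL hφ hpos hper (t - θ)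
    exact ⟨s, by simp [hs]⟩
  let e := StrictMono.orderIsoOfSurjective _ hmono hsurj
  have h1 : ∀ t, bigPhi φ (e.symm t) + θ = t := fun t => e.apply_symm_apply t
  refine ⟨e.symm, e.symm.continuous, h1, fun s => e.symm_apply_apply s, fun t => ?_⟩
  refine HasDerivAt.of_local_left_inverse e.symm.continuous.continuousAt
    ((hasDerivAt_bigPhi hφ (e.symm t)).add_const θ) ?_ (Eventually.of_forall h1)
  have := hpos (e.symm t)
  positivity

/-- The principal value along the boundary curve, in the coordinate `Φ`. -/
theorem hasCotPV_of_tendsto {φ : ℝ → ℝ} {L : ℝ} (hL : 0 < L) (hφ₁ : ContDiff ℝ 1 φ)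
    (hpos : ∀ s, 0 < φ s) (hper : Function.Periodic φ L) (htot : bigPhi φ L = 2 * Real.pi)
    {w : ℝ → ℝ} {θ : ℝ} (hw : Continuous w) (hwper : Function.Periodic w (2 * Real.pi))
    (hwφ : ∀ s, deriv φ s / φ s = -(w (bigPhi φ s + θ) * (2 * Real.pi * φ s))) {s J : ℝ}
    (h : Tendsto (fun ε => ∫ x in ε..Real.pi, Real.cot (x / 2) *
      (w (bigPhi φ s + θ + x) - w (bigPhi φ s + θ - x))) (𝓝[>] 0) (𝓝 J)) :
    HasCotPV φ L s J := by
  have hφ := hφ₁.continuous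
  have hpi := Real.pi_pos
  have hmono := strictMono_bigPhi hφ hpos
  have hslope := (hasDerivAt_iff_tendsto_slope.1 (hasDerivAt_bigPhi hφ s))
  have hposs : 0 < 2 * Real.pi * φ s := by have := hpos s; positivity
  -- The two cuts at arclength `ε` seen in the angle. They differ in general, but both are `2πφ(s)
  -- ε` to first order, so their ratio tends to `1`.
  set a : ℝ → ℝ := fun ε => bigPhi φ (s + ε) - bigPhi φ s with ha
  set b : ℝ → ℝ := fun ε => bigPhi φ s - bigPhi φ (s - ε) with hb
  have hcont := continuous_bigPhi hφ
  have ha0 : Tendsto a (𝓝[>] 0) (𝓝[>] 0) := by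
    refine tendsto_nhdsWithin_iff.2 ⟨?_, ?_⟩
    · have hc : Continuous a := by fun_prop
      simpa [ha] using (hc.tendsto 0).mono_left nhdsWithin_le_nhds
    · filter_upwards [self_mem_nhdsWithin] with ε hε
      have hε' : 0 < ε := hε
      exact sub_pos.2 (hmono (by linarith))
  have hb0 : Tendsto b (𝓝[>] 0) (𝓝[>] 0) := by
    refine tendsto_nhdsWithin_iff.2 ⟨?_, ?_⟩
    · have hc : Continuous b := by fun_prop
      simpa [hb] using (hc.tendsto 0).mono_left nhdsWithin_le_nhds
    · filter_upwards [self_mem_nhdsWithin] with ε hε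
      have hε' : 0 < ε := hε
      exact sub_pos.2 (hmono (by linarith))
  have hda : Tendsto (fun ε => a ε / ε) (𝓝[>] 0) (𝓝 (2 * Real.pi * φ s)) := by
    have h1 : Tendsto (fun ε : ℝ => s + ε) (𝓝[>] 0) (𝓝[≠] s) := by
      refine tendsto_nhdsWithin_iff.2 ⟨?_, ?_⟩
      · simpa using (Continuous.tendsto (by fun_prop : Continuous fun ε : ℝ => s + ε) 0).mono_left
          nhdsWithin_le_nhds
      · filter_upwards [self_mem_nhdsWithin] with ε hε
        have hε' : 0 < ε := hε
        simp [hε'.ne']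
    refine (hslope.comp h1).congr fun ε => ?_
    simp [slope_def_field, ha]
  have hdb : Tendsto (fun ε => b ε / ε) (𝓝[>] 0) (𝓝 (2 * Real.pi * φ s)) := by
    have h1 : Tendsto (fun ε : ℝ => s - ε) (𝓝[>] 0) (𝓝[≠] s) := by
      refine tendsto_nhdsWithin_iff.2 ⟨?_, ?_⟩
      · simpa using (Continuous.tendsto (by fun_prop : Continuous fun ε : ℝ => s - ε) 0).mono_left
          nhdsWithin_le_nhds
      · filter_upwards [self_mem_nhdsWithin] with ε hε
        have hε' : 0 < ε := hε
        simp [hε'.ne']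
    refine (hslope.comp h1).congr fun ε => ?_
    simp only [Function.comp, slope_def_field, hb, sub_sub_cancel_left]
    rw [div_neg, ← neg_div, neg_sub]
  have hba : Tendsto (fun ε => b ε / a ε) (𝓝[>] 0) (𝓝 1) := by
    have := hdb.div hda hposs.ne'
    rw [div_self hposs.ne'] at this
    refine this.congr' ?_
    filter_upwards [self_mem_nhdsWithin] with ε hε
    have hε' : ε ≠ 0 := (mem_Ioi.1 hε).ne'
    exact div_div_div_cancel_right₀ hε' _ _
  refine (tendsto_integral_cot_half_asymmetric hw hwper h ha0 hb0 hba).congr' ?_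
  filter_upwards [Ioo_mem_nhdsGT (show 0 < L / 2 by positivity)] with ε hε
  have hle : s + ε ≤ s + L - ε := by linarith [hε.2]
  have hX : bigPhi φ (s + L - ε) - bigPhi φ s = 2 * Real.pi - b ε := by
    have := bigPhi_add_period hφ hper (s - ε)
    rw [show s + L - ε = s - ε + L by ring, this, htot, hb]
    ring
  -- Substitution `x = Φ(σ) - Φ(s)`. The sign from the oddness of the cotangent cancels the one in
  -- `hwφ`.
  have hsub := intervalIntegral.integral_comp_mul_deriv'' (a := s + ε) (b := s + L - ε)
    (f := fun σ => bigPhi φ σ - bigPhi φ s) (f' := fun σ => 2 * Real.pi * φ σ)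
    (g := fun x => Real.cot (x / 2) * w (bigPhi φ s + θ + x)) (by fun_prop)
    (fun x _ => ((hasDerivAt_bigPhi hφ x).sub_const _).hasDerivWithinAt) (by fun_prop) (by
      refine ContinuousOn.mul (continuousOn_cot_half.mono ?_) (by fun_prop)
      rintro _ ⟨σ, hσ, rfl⟩
      rw [uIcc_of_le hle] at hσ
      have h1 : bigPhi φ s < bigPhi φ σ := hmono (by linarith [hσ.1, hε.1])
      have h2 : bigPhi φ σ < bigPhi φ (s + L) := hmono (by linarith [hσ.2, hε.1])
      rw [bigPhi_add_period hφ hper, htot] at h2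
      exact ⟨by linarith, by linarith⟩)
  rw [hX] at hsub
  rw [← hsub]
  refine intervalIntegral.integral_congr fun σ _ => ?_
  have hlog : deriv (fun x => Real.log (φ x)) σ = deriv φ σ / φ σ :=
    (((hφ₁.differentiable one_ne_zero) σ).hasDerivAt.log (hpos σ).ne').deriv
  have hcot : Real.cot ((bigPhi φ s - bigPhi φ σ) / 2) =
      -Real.cot ((bigPhi φ σ - bigPhi φ s) / 2) := by
    rw [show (bigPhi φ s - bigPhi φ σ) / 2 = -((bigPhi φ σ - bigPhi φ s) / 2) by ring,
      Real.cot_eq_cos_div_sin, Real.cot_eq_cos_div_sin, Real.cos_neg, Real.sin_neg, div_neg]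
  simp only [Function.comp, hlog, hcot, hwφ]
  rw [show bigPhi φ s + θ + (bigPhi φ σ - bigPhi φ s) = bigPhi φ σ + θ by ring]
  ring

/-- A bounded Hölder function keeps any smaller exponent: at distance at most `1` powers compare,
beyond it the bound `2M` is enough. -/
theorem abs_sub_le_mul_rpow_of_bounded {f : ℝ → ℝ} {C M b b' : ℝ} (hC : 0 ≤ C) (hb : 0 < b')
    (hbb : b' ≤ b) (hM : ∀ x, |f x| ≤ M) (hf : ∀ x y, |f x - f y| ≤ C * |x - y| ^ b) (x y : ℝ) :
    |f x - f y| ≤ (C + 2 * M) * |x - y| ^ b' := by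
  have hM₀ : 0 ≤ M := (abs_nonneg _).trans (hM x)
  have h0 := abs_nonneg (x - y)
  rcases le_total |x - y| 1 with h1 | h1
  · calc _ ≤ C * |x - y| ^ b := hf x y
      _ ≤ (C + 2 * M) * |x - y| ^ b' := by
        rcases h0.eq_or_lt with h | h
        · rw [← h, Real.zero_rpow (hb.trans_le hbb).ne', Real.zero_rpow hb.ne']; simp
        · have := Real.rpow_le_rpow_of_exponent_ge h h1 hbb
          gcongr
          linarith
  · calc _ ≤ |f x| + |f y| := abs_sub _ _
      _ ≤ (C + 2 * M) * 1 := by linarith [hM x, hM y]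
      _ ≤ (C + 2 * M) * |x - y| ^ b' := by
        gcongr
        exact Real.one_le_rpow h1 hb.le

/-- If `φ'` is Hölder continuous, then so is `φ'/(2πφ²)`. -/
theorem exists_holder_deriv_div_sq {φ : ℝ → ℝ} {L : ℝ} (hL : 0 < L) (hφ₁ : ContDiff ℝ 1 φ)
    (hpos : ∀ s, 0 < φ s) (hper : Function.Periodic φ L) {C β : ℝ≥0} (hβ : 0 < β)
    (hH : HolderWith C β (deriv φ)) :
    ∃ K β' : ℝ, 0 ≤ K ∧ 0 < β' ∧ β' ≤ 1 ∧ ∀ x y, |deriv φ x / (2 * Real.pi * φ x ^ 2) -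
      deriv φ y / (2 * Real.pi * φ y ^ 2)| ≤ K * |x - y| ^ β' := by
  have hpi := Real.pi_pos
  obtain ⟨m, hm, hmφ⟩ := exists_pos_le_of_periodic hL hφ₁.continuous hpos hper
  have hd : ∀ x, HasDerivAt φ (deriv φ x) x := fun x =>
    ((hφ₁.differentiable one_ne_zero) x).hasDerivAt
  have hdper : Function.Periodic (deriv φ) L := fun x => by
    rw [← deriv_comp_add_const]
    congr 1
    exact funext hper
  obtain ⟨M, hM'⟩ := (isCompact_Icc (a := 0) (b := L)).exists_bound_of_continuousOn
    (hφ₁.continuous_deriv le_rfl).continuousOn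
  have hM : ∀ x, |deriv φ x| ≤ M := fun x => by
    obtain ⟨t, ht, hxt⟩ := hdper.exists_mem_Ico₀ hL x
    rw [hxt]
    exact hM' t ⟨ht.1, ht.2.le⟩
  have hM₀ : 0 ≤ M := (abs_nonneg _).trans (hM 0)
  set g : ℝ → ℝ := fun x => (2 * Real.pi * φ x ^ 2)⁻¹ with hg
  set G : ℝ := (2 * Real.pi * m ^ 2)⁻¹ with hG
  have hgG : ∀ x, |g x| ≤ G := fun x => by
    have := hpos x
    rw [abs_of_pos (by positivity), hg, hG]
    have := hmφ x
    simp only []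
    gcongr
  have hG₀ : 0 ≤ G := (abs_nonneg _).trans (hgG 0)
  set K₁ : ℝ := M / (Real.pi * m ^ 3) with hK₁
  have hgd : ∀ x, HasDerivAt g (-(deriv φ x) / (Real.pi * φ x ^ 3)) x := fun x => by
    have hx := hpos x
    refine ((((hd x).pow 2).const_mul (2 * Real.pi)).inv
      (show 2 * Real.pi * φ x ^ 2 ≠ 0 by positivity)).congr_deriv ?_
    simp only [Pi.pow_apply]
    field_simp
    simp only [Nat.cast_ofNat, Nat.add_one_sub_one, pow_one]
    ring
  have hgL : ∀ x y, |g x - g y| ≤ K₁ * |x - y| ^ (1 : ℝ) := fun x y => by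
    rw [Real.rpow_one]
    refine convex_univ.norm_image_sub_le_of_norm_hasDerivWithin_le (f := g) (C := K₁)
      (fun z _ => (hgd z).hasDerivWithinAt) (fun z _ => ?_) (mem_univ y) (mem_univ x)
    have hz := hpos z
    have := hmφ z
    rw [Real.norm_eq_abs, abs_div, abs_neg, abs_of_pos (show 0 < Real.pi * φ z ^ 3 by positivity)]
    have := hM z
    rw [hK₁]
    gcongr
  have hH' : ∀ x y, |deriv φ x - deriv φ y| ≤ C * |x - y| ^ (β : ℝ) := fun x y => by
    simpa [Real.dist_eq] using hH.dist_le x y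
  -- A common exponent for both factors: `1/(2πφ²)` is Lipschitz, and `β` itself may exceed `1`.
  set β' : ℝ := min β 1 with hβ'
  have hβ'0 : 0 < β' := lt_min (by exact_mod_cast hβ) one_pos
  have h1 := abs_sub_le_mul_rpow_of_bounded C.2 hβ'0 (min_le_left _ _) hM hH'
  have h2 := abs_sub_le_mul_rpow_of_bounded (show 0 ≤ K₁ by positivity) hβ'0 (min_le_right _ _)
    hgG hgL
  refine ⟨(C + 2 * M) * G + M * (K₁ + 2 * G), β', by positivity, hβ'0, min_le_right _ _,
    fun x y => ?_⟩
  have e : deriv φ x / (2 * Real.pi * φ x ^ 2) - deriv φ y / (2 * Real.pi * φ y ^ 2) =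
      (deriv φ x - deriv φ y) * g x + deriv φ y * (g x - g y) := by
    simp only [hg, div_eq_mul_inv]; ring
  have hr : 0 ≤ |x - y| ^ β' := by positivity
  rw [e]
  refine (abs_add_le _ _).trans ?_
  rw [abs_mul, abs_mul]
  calc _ ≤ (C + 2 * M) * |x - y| ^ β' * G + M * ((K₁ + 2 * G) * |x - y| ^ β') := by
        gcongr
        · exact h1 x y
        · exact hgG x
        · exact hM y
        · exact h2 x y
    _ = _ := by ring

/-! ### Modulus and argument of the tangent -/

theorem re_eq_neg_log_of_norm_exp_mul_eq_one {z ζ : ℂ} {c : ℝ} (hc : 0 < c) (hζ : ‖ζ‖ = 1)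
    (h : ‖Complex.exp z * (c * Complex.I * ζ)‖ = 1) : z.re = -Real.log c := by
  rw [norm_mul, norm_mul, norm_mul, hζ, Complex.norm_I, Complex.norm_exp, Complex.norm_real,
    Real.norm_of_nonneg hc.le, mul_one, mul_one] at h
  have h2 : Real.exp z.re = c⁻¹ := eq_inv_of_mul_eq_one_left h
  rw [← Real.log_inv, ← h2, Real.log_exp]

/-- The real part of `z` cancels `c`, and the factor `i` contributes the `π/2`. -/
theorem exp_mul_eq_exp_angle {z : ℂ} {c x : ℝ} (hc : 0 < c) (hz : z.re = -Real.log c) :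
    Complex.exp z * (c * Complex.I * Complex.exp (x * Complex.I)) =
      Complex.exp (((z.im + x + Real.pi / 2 : ℝ) : ℂ) * Complex.I) := by
  have h1 : (c : ℂ) = Complex.exp (Real.log c : ℝ) := by
    rw [← Complex.ofReal_exp, Real.exp_log hc]
  have h2 : Complex.I = Complex.exp ((Real.pi / 2 : ℝ) * Complex.I) := by
    rw [Complex.exp_mul_I, ← Complex.ofReal_cos, ← Complex.ofReal_sin]
    simp
  have h3 : z = ((-Real.log c : ℝ) : ℂ) + (z.im : ℂ) * Complex.I := by
    rw [← hz, Complex.re_add_im]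
  calc _ = Complex.exp (((-Real.log c : ℝ) : ℂ) + (z.im : ℂ) * Complex.I) *
        (Complex.exp (Real.log c : ℝ) * Complex.exp ((Real.pi / 2 : ℝ) * Complex.I) *
          Complex.exp (x * Complex.I)) := by rw [← h1, ← h2, ← h3]
    _ = _ := by
        rw [← Complex.exp_add, ← Complex.exp_add, ← Complex.exp_add]
        congr 1
        push_cast
        ring

/-- Two continuous determinations of the angle differ locally by a constant. -/
theorem HasDerivAt.of_exp_mul_I_eq {ψ χ : ℝ → ℝ} (hψ : Continuous ψ) (hχ : Continuous χ)
    (h : ∀ t, Complex.exp ((ψ t : ℂ) * Complex.I) = Complex.exp ((χ t : ℂ) * Complex.I)) {s d : ℝ}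
    (hd : HasDerivAt ψ d s) : HasDerivAt χ d s := by
  have hpi := Real.pi_pos
  have hint : ∀ t, ∃ n : ℤ, ψ t - χ t = n * (2 * Real.pi) := fun t => by
    obtain ⟨n, hn⟩ := Complex.exp_eq_exp_iff_exists_int.1 (h t)
    refine ⟨n, ?_⟩
    have := congrArg Complex.im hn
    simp at this
    linarith
  have hev : ∀ᶠ t in 𝓝 s, |ψ t - χ t - (ψ s - χ s)| < 2 * Real.pi := by
    have hc : Continuous fun t => |ψ t - χ t - (ψ s - χ s)| := by fun_prop
    exact (hc.tendsto s).eventually (gt_mem_nhds (by simpa using hpi))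
  refine (hd.sub_const (ψ s - χ s)).congr_of_eventuallyEq ?_
  filter_upwards [hev] with t ht
  obtain ⟨n, hn⟩ := hint t
  obtain ⟨l, hl⟩ := hint s
  rw [hn, hl, ← sub_mul, abs_mul, abs_of_pos (show 0 < 2 * Real.pi by positivity)] at ht
  have h1 : |((n - l : ℤ) : ℝ)| < 1 := by
    push_cast
    by_contra hcon
    nlinarith [not_lt.1 hcon]
  have h2 : n - l = 0 := by
    rw [← Int.cast_abs] at h1
    exact Int.abs_lt_one_iff.1 (by exact_mod_cast h1)
  have h3 : n = l := by omega
  subst h3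
  linarith

/-! ### The curvature formula -/

theorem theorem4p1 (α : ℝ≥0) (hα₀ : 0 < α) (hα₁ : α < 1)
    (Ω : Set ℂ) (ζc ζb : ℂ) (hΩ : IsC1HolderDomain α Ω) (hc : ζc ∈ Ω)
    (L : ℝ) (γ : ℝ → ℂ) (hγ : IsBoundaryParam Ω ζb L γ)
    (U : ℂ → ℝ) (hU : IsGreenFunction Ω ζc U)
    (φ : ℝ → ℝ) (hφ : IsNormalDerivative Ω γ U φ) (hφ₁ : ContDiff ℝ 1 φ) :
    (∀ s k : ℝ, HasSignedCurvatureAt γ s k →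
      ∃ J : ℝ, HasCotPV φ L s J ∧
        k = 2 * Real.pi * φ s * (1 - 1 / (2 * Real.pi) * J)) ∧
    ((∃ C β : ℝ≥0, 0 < β ∧ HolderWith C β (deriv φ)) →
      ∀ s : ℝ, ∃ k : ℝ, HasSignedCurvatureAt γ s k) := by

  have hφc := hφ₁.continuous
  obtain ⟨hpos, htot, k, θ, hk, hkd, hγ'⟩ := exists_boundary_log hα₀ hα₁ hΩ hc hγ hU hφ hφc
  have hper := hφ.periodic hγ
  have hpi := Real.pi_pos
  obtain ⟨S, hS, hTS, hST, hS'⟩ := exists_inverse_bigPhi_add hγ.pos hφc hpos hper θ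
  have hT := continuous_bigPhi hφc
  have hc2 : ∀ s, 0 < 2 * Real.pi * φ s := fun s => by have := hpos s; positivity
  set v : ℝ → ℝ := fun t => (k (Complex.exp (t * Complex.I))).im with hv
  have hvc : Continuous v := by fun_prop
  have hγ'' : ∀ s, deriv γ s =
      Complex.exp (k (Complex.exp (((bigPhi φ s + θ : ℝ) : ℂ) * Complex.I))) *
        ((2 * Real.pi * φ s : ℝ) * Complex.I *
          Complex.exp (((bigPhi φ s + θ : ℝ) : ℂ) * Complex.I)) := fun s => by
    rw [hγ' s]; push_cast; rfl
  have hre : ∀ s, (k (Complex.exp (((bigPhi φ s + θ : ℝ) : ℂ) * Complex.I))).re =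
      -Real.log (2 * Real.pi * φ s) := fun s =>
    re_eq_neg_log_of_norm_exp_mul_eq_one (hc2 s) (Complex.norm_exp_ofReal_mul_I _)
      (by rw [← hγ'' s]; exact hγ.unit_speed s)
  -- The derivative of `u = -log(2πφ)` with respect to the angle, through the inverse `S` of `s ↦
  -- Φ(s) + θ`.
  set w : ℝ → ℝ := fun t => -(deriv φ (S t) / (2 * Real.pi * φ (S t) ^ 2)) with hw
  have hwc : Continuous w := by
    have := hφ₁.continuous_deriv le_rfl
    refine (Continuous.div (by fun_prop) (by fun_prop) fun t => ?_).neg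
    have := hpos (S t)
    positivity
  have hu : ∀ t : ℝ, HasDerivAt (fun t : ℝ => (k (Complex.exp (t * Complex.I))).re) (w t) t := by
    intro t
    have hfun : (fun t : ℝ => (k (Complex.exp (t * Complex.I))).re) =
        fun t => -Real.log (2 * Real.pi * φ (S t)) := funext fun t => by rw [← hre, hTS]
    rw [hfun]
    have h1 : HasDerivAt φ (deriv φ (S t)) (S t) :=
      ((hφ₁.differentiable one_ne_zero) _).hasDerivAt
    refine ((((h1.comp t (hS' t)).const_mul (2 * Real.pi)).log (hc2 _).ne').neg).congr_deriv ?_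
    have := hpos (S t)
    simp only [hw, Function.comp]
    field_simp
  have hexp : ∀ t : ℝ, Complex.exp (((t + 2 * Real.pi : ℝ) : ℂ) * Complex.I) =
      Complex.exp (t * Complex.I) := fun t => by
    push_cast
    rw [add_mul, Complex.exp_add, Complex.exp_two_pi_mul_I, mul_one]
  have hvper : Function.Periodic v (2 * Real.pi) := fun t => by simp only [hv, hexp]
  have hwper : Function.Periodic w (2 * Real.pi) := fun t => by
    have h1 := (hu (t + 2 * Real.pi)).comp_add_const t (2 * Real.pi)
    simp only [hexp] at h1
    exact h1.unique (hu t)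
  have hvw : ∀ θ r : ℝ, 0 ≤ r → r < 1 →
      ∫ x in (0 : ℝ)..Real.pi, conjPoisson r x * (w (θ + x) - w (θ - x)) =
      -2 * ∫ x in (0 : ℝ)..Real.pi, poissonSlope r x * (v (θ + x) - v (θ - x)) := by
    intro θ r hr₀ hr₁
    rw [← integral_conjPoisson_mul hwc hwper hr₀ hr₁, ← integral_poissonSlope_mul hvc hvper hr₀ hr₁]
    exact integral_conjPoisson_mul_deriv hk hkd hwc hu hr₀ hr₁ θ
  have hwφ : ∀ s, deriv φ s / φ s = -(w (bigPhi φ s + θ) * (2 * Real.pi * φ s)) := fun s => by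
    have := hpos s
    simp only [hw, hST]
    field_simp
  -- A continuous tangent angle. Any other determination differs from it locally by a constant, so
  -- differentiability and derivative agree.
  set χ : ℝ → ℝ := fun s => v (bigPhi φ s + θ) + (bigPhi φ s + θ) + Real.pi / 2 with hχ
  have hχc : Continuous χ := by fun_prop
  have hχγ : ∀ s, deriv γ s = Complex.exp ((χ s : ℂ) * Complex.I) := fun s => by
    rw [hγ'' s, exp_mul_eq_exp_angle (hc2 s) (hre s)]
  constructor
  · rintro s κ ⟨ψ, hψ, hψγ, hψd⟩
    have hχd : HasDerivAt χ κ s :=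
      HasDerivAt.of_exp_mul_I_eq hψ hχc (fun t => by rw [← hψγ, hχγ]) hψd
    -- The chain rule through `S` turns existence of the curvature at `s` into differentiability of
    -- `v` at the corresponding angle.
    have hvd : HasDerivAt v ((κ - 2 * Real.pi * φ s) * (2 * Real.pi * φ s)⁻¹)
        (bigPhi φ s + θ) := by
      have h1 : HasDerivAt (fun s => v (bigPhi φ s + θ)) (κ - 2 * Real.pi * φ s) s := by
        refine ((hχd.sub ((hasDerivAt_bigPhi hφc s).add_const θ)).sub_const
          (Real.pi / 2)).congr_of_eventuallyEq (Eventually.of_forall fun t => ?_)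
        simp only [hχ, Pi.sub_apply]
        ring
      have h2 := hS' (bigPhi φ s + θ)
      rw [hST] at h2
      have h3 : HasDerivAt (fun s => v (bigPhi φ s + θ)) (κ - 2 * Real.pi * φ s)
          (S (bigPhi φ s + θ)) := by rwa [hST]
      refine (h3.comp _ h2).congr_of_eventuallyEq (Eventually.of_forall fun t => ?_)
      simp only [Function.comp, hTS]
    refine ⟨-(2 * Real.pi * ((κ - 2 * Real.pi * φ s) * (2 * Real.pi * φ s)⁻¹)),
      hasCotPV_of_tendsto hγ.pos hφ₁ hpos hper htot hwc hwper hwφ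
        (tendsto_integral_cot_half_of_hasDerivAt hvc hwc hvd (hvw _)), ?_⟩
    have := hpos s
    field_simp
    ring
  · rintro ⟨C, β, hβ, hH⟩ s
    obtain ⟨K, β', hK, hβ₀, hβ₁, hHol⟩ := exists_holder_deriv_div_sq hγ.pos hφ₁ hpos hper hβ hH
    obtain ⟨m, hm, hmφ⟩ := exists_pos_le_of_periodic hγ.pos hφc hpos hper
    have hSL : ∀ x y, |S x - S y| ≤ (2 * Real.pi * m)⁻¹ * |x - y| := fun x y => by
      refine convex_univ.norm_image_sub_le_of_norm_hasDerivWithin_le (f := S)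
        (C := (2 * Real.pi * m)⁻¹)
        (fun z _ => (hS' z).hasDerivWithinAt) (fun z _ => ?_) (mem_univ y) (mem_univ x)
      rw [norm_inv, Real.norm_of_nonneg (hc2 _).le]
      have := hmφ (S z)
      gcongr
    obtain ⟨d, hd⟩ := exists_hasDerivAt_im_circle hk hkd hwc hwper hu
      -- Hölder continuity passes from arclength to angle because `S` is Lipschitz with constant
      -- `1/(2πm)`.
      (C := K * ((2 * Real.pi * m)⁻¹) ^ β') (by positivity) hβ₀ hβ₁ (fun x y => by
        have h1 := hHol (S y) (S x)
        rw [show w x - w y = deriv φ (S y) / (2 * Real.pi * φ (S y) ^ 2) -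
          deriv φ (S x) / (2 * Real.pi * φ (S x) ^ 2) by simp only [hw]; ring]
        refine h1.trans ?_
        rw [abs_sub_comm (S y), mul_assoc, ← Real.mul_rpow (by positivity) (abs_nonneg _)]
        gcongr
        exact hSL x y) (bigPhi φ s + θ)
    have hT' : HasDerivAt (fun s => bigPhi φ s + θ) (2 * Real.pi * φ s) s :=
      (hasDerivAt_bigPhi hφc s).add_const θ
    exact ⟨_, χ, hχc, hχγ, ((hd.comp s hT').add hT').add_const _⟩

end
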